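/- Consider a chain $$u_{n,xy}=\alpha\,u_{n,x}u_{n,y}+\beta\,u_{n,x}+\gamma\,u_{n,y}+\delta,\qquad n\in\mathbb Z,\tag{1}$$ where $\alpha,\beta,\gamma,\delta$ are functions of $(u_{n+1},u_n,u_{n-1})$, analytic in a domain $D\subset\mathbb C^3$, and neither $\partial\alpha/\partial u_{n+1}$ nor $\partial\alpha/\partial u_{n-1}$ vanishes identically. Write $f_n$ for the right-hand side of (1) and $D_x$ for total differentiation in $x$ by virtue of (1), acting on functions of the dynamical variables $u_n,u_{n,x},u_{n,xx},\dots$ and $u_{n,y}$, and put $$X_i=\frac{\partial}{\partial u_{i,y}},\qquad Y=\sum_{i}\Big(u_{i,y}\frac{\partial}{\partial u_i}+f_i\frac{\partial}{\partial u_{i,x}}+D_x(f_i)\frac{\partial}{\partial u_{i,xx}}+\cdots\Big),\qquad Y_i=[X_i,Y],$$ $W_1=[Y_0,Y_1]$, $W_2=[Y_0,W_1]$, and $Z_0=Y_0$, $Z_1=Y_1$, $Z_2=Y_2$, $Z_3=[Y_1,Y_0]$, $Z_4=[Y_2,Y_1]$, $Z_5=[Y_2,Z_3]$, $Z_6=[Y_1,Z_3]$,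 $Z_7=[Y_1,Z_4]$, $Z_8=[Y_1,Z_5]$. The expansions $$W_2=\lambda W_1+\sigma Y_1+\delta Y_0,\qquad Z_8=\lambda Z_7+\mu Z_6+\nu Z_5+\rho Z_4+\kappa Z_3+\sigma Z_2+\delta Z_1+\eta Z_0$$ (unrelated coefficients in the two formulas, each a locally analytic function of finitely many dynamical variables) both hold, near every point of the space of dynamical variables with $(u_{n+1},u_n,u_{n-1})\in D$ for all $n$, if and only if, up to a point transformation, $\alpha$ and $\gamma$ have the form $$\alpha(u_{n+1},u_n,u_{n-1})=\frac1{u_n-u_{n-1}}-\frac1{u_{n+1}-u_n},\qquad \gamma(u_{n+1},u_n,u_{n-1})=r'(u_n)-r(u_n)\,\alpha(u_{n+1},u_n,u_{n-1}),\tag{2}$$ where $r(u)=\frac{k_1}{2}u^2+k_2u+k_3$ with constants $k_1,k_2,k_3$. Here "up to a point transformation" means: for every sequence $(u^*_n)_{n\in\mathbb Z}$ with $(u^*_{n+1},u^*_n,u^*_{n-1})\in D$ for all $n$ there are a sequence $(v_n^*)$ with $v^*_{n+1}\neq v^*_n$ and analytic, locally invertible changes of variables $u_n=g_n(v_n)$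 near $v^*_n$ with $g_n(v^*_n)=u^*_n$, such that in the variables $v_n$ the chain takes the form (1) near $(v_n^*)$ with coefficients of $v_{n,x}v_{n,y}$ and $v_{n,y}$ given by (2) (with $v$ in place of $u$), with $k_1,k_2,k_3$ independent of $n$. Moreover, if $\alpha$ itself is given by the first formula of (2) on $D$, and there is at least one sequence $(u_n)_{n\in\mathbb Z}$ with $(u_{n+1},u_n,u_{n-1})\in D$ for all $n$, then both expansions hold if and only if, for some constants $k_1,k_2,k_3$, $\gamma$ is given by the second formula of (2) on $D$. -/

import Mathlib

open Filter Topology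

noncomputable section

/-- The data of a quasilinear chain
`u_{n,xy} = α u_{n,x} u_{n,y} + β u_{n,x} + γ u_{n,y} + δ`, `n ∈ ℤ`, where `α, β, γ, δ` are
functions of `(u_{n+1}, u_n, u_{n-1})`, analytic in a domain `D ⊆ ℂ³`. -/
structure QLChain where
  D : Set (ℂ × ℂ × ℂ)
  α : ℂ × ℂ × ℂ → ℂ
  β : ℂ × ℂ × ℂ → ℂ
  γ : ℂ × ℂ × ℂ → ℂ
  δ : ℂ × ℂ × ℂ → ℂ
  isOpen_D : IsOpen D
  isConnected_D : IsConnected D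
  analytic_α : AnalyticOnNhd ℂ α D
  analytic_β : AnalyticOnNhd ℂ β D
  analytic_γ : AnalyticOnNhd ℂ γ D
  analytic_δ : AnalyticOnNhd ℂ δ D

/-- The right-hand side of the chain at `z = (u_{n+1}, u_n, u_{n-1})`, `ξ = u_{n,x}`,
`η = u_{n,y}`. -/
def QLChain.rhs (C : QLChain) (z : ℂ × ℂ × ℂ) (ξ η : ℂ) : ℂ :=
  C.α z * ξ * η + C.β z * ξ + C.γ z * η + C.δ z

/-- The standing assumption: neither `∂α/∂u_{n+1}` nor `∂α/∂u_{n-1}` vanishes identically. -/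
def QLChain.Nondegenerate (C : QLChain) : Prop :=
  (∃ z ∈ C.D, deriv (fun t => C.α (t, z.2.1, z.2.2)) z.1 ≠ 0) ∧
  (∃ z ∈ C.D, deriv (fun t => C.α (z.1, z.2.1, t)) z.2.2 ≠ 0)

/-- Labels of the dynamical variables: `jet n k` is the `k`-th `x`-derivative of `u_n`
(so `jet n 0` is `u_n` itself), and `vel n` is `u_{n,y}`. -/
inductive DynVar where
  | jet (n : ℤ) (k : ℕ) : DynVar
  | vel (n : ℤ) : DynVar
deriving DecidableEq

/-- A point of the space of dynamical variables. -/
abbrev DynPoint : Type := DynVar → ℂ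

/-- The triple `(u_{n+1}, u_n, u_{n-1})` of a sequence `u`. -/
def triple (u : ℤ → ℂ) (n : ℤ) : ℂ × ℂ × ℂ := (u (n + 1), u n, u (n - 1))

/-- The sequence `(u_n)` underlying a point of the space of dynamical variables. -/
def DynPoint.base (p : DynPoint) : ℤ → ℂ := fun n => p (.jet n 0)

/-- The sequence `(u_n)` lies in the domain of the chain at every site. -/
def QLChain.InDomain (C : QLChain) (u : ℤ → ℂ) : Prop := ∀ n : ℤ, triple u n ∈ C.D

/-- Partial derivative with respect to one dynamical variable. -/
def pderivAt (c : DynVar) (F : DynPoint → ℂ) : DynPoint → ℂ :=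
  fun p => deriv (fun t => F (Function.update p c t)) (p c)

/-- A formal vector field `∑_c Z_c ∂/∂c` (possibly infinitely many components). -/
abbrev FormalVF : Type := DynVar → DynPoint → ℂ

/-- The action of a vector field on a function; for a function of finitely many dynamical
variables the sum has finitely many nonzero terms. -/
def FormalVF.act (Z : FormalVF) (F : DynPoint → ℂ) : DynPoint → ℂ :=
  fun p => ∑ᶠ c : DynVar, Z c p * pderivAt c F p

/-- The commutator `[Z, W] = ZW - WZ` of vector fields, by components. -/
def FormalVF.comm (Z W : FormalVF) : FormalVF :=
  fun c => Z.act (W c) - W.act (Z c)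

/-- `f_n`, as a function of the dynamical variables. -/
def QLChain.f (C : QLChain) (n : ℤ) : DynPoint → ℂ :=
  fun p => C.rhs (triple p.base n) (p (.jet n 1)) (p (.vel n))

/-- The operator `D_x` of total differentiation with respect to `x`, by virtue of the chain. -/
def QLChain.Dx (C : QLChain) : FormalVF
  | .jet n k => fun p => p (.jet n (k + 1))
  | .vel n => C.f n

/-- The characteristic operator
`Y = ∑_i (u_{i,y} ∂/∂u_i + f_i ∂/∂u_{i,x} + D_x(f_i) ∂/∂u_{i,xx} + ⋯)`. -/
def QLChain.Y (C : QLChain) : FormalVF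
  | .jet n 0 => fun p => p (.vel n)
  | .jet n (k + 1) => (C.Dx.act)^[k] (C.f n)
  | .vel _ => 0

/-- The characteristic operator `X_i = ∂/∂u_{i,y}`. -/
def Xop (i : ℤ) : FormalVF := fun c _ => if c = .vel i then 1 else 0

/-- `Y_i = [X_i, Y]`. -/
def QLChain.Yop (C : QLChain) (i : ℤ) : FormalVF := (Xop i).comm C.Y

/-- `W_1 = [Y_0, Y_1]` and `W_{k+1} = [Y_0, W_k]`; here `C.W k` is `W_{k+1}`. -/
def QLChain.W (C : QLChain) : ℕ → FormalVF
  | 0 => (C.Yop 0).comm (C.Yop 1)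
  | k + 1 => (C.Yop 0).comm (C.W k)

/-- `Z_0, Z_1, Z_2` are `Y_0, Y_1, Y_2`; `Z_3 = [Y_1, Y_0]`, `Z_4 = [Y_2, Y_1]`,
`Z_5 = [Y_2, Z_3]`; and `Z_m = [Y_1, Z_{m-3}]` for `m ≥ 6`. -/
def QLChain.Z (C : QLChain) : ℕ → FormalVF
  | 0 => C.Yop 0
  | 1 => C.Yop 1
  | 2 => C.Yop 2
  | 3 => (C.Yop 1).comm (C.Yop 0)
  | 4 => (C.Yop 2).comm (C.Yop 1)
  | 5 => (C.Yop 2).comm ((C.Yop 1).comm (C.Yop 0))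
  | m + 6 => (C.Yop 1).comm (C.Z (m + 3))

/-- `F` is, near `p`, an analytic function of finitely many dynamical variables. -/
def LocAnalyticAt (F : DynPoint → ℂ) (p : DynPoint) : Prop :=
  ∃ (S : Finset DynVar) (h : (S → ℂ) → ℂ),
    AnalyticAt ℂ h (fun c : S => p c) ∧ ∀ᶠ q in 𝓝 p, F q = h (fun c : S => q c)

/-- Near `p`, the vector field `Z` is a linear combination of `V_0, …, V_{m-1}` whose
coefficients are locally analytic functions of the dynamical variables. -/
def ExpandsAt {m : ℕ} (Z : FormalVF) (V : Fin m → FormalVF) (p : DynPoint) : Prop :=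
  ∃ a : Fin m → DynPoint → ℂ, (∀ i, LocAnalyticAt (a i) p) ∧
    ∀ᶠ q in 𝓝 p, ∀ c : DynVar, Z c q = ∑ i, a i q * V i c q

/-- `W_2 = λ W_1 + σ Y_1 + δ Y_0`, locally at every point of the space of dynamical variables
over the domain of the chain. -/
def QLChain.FirstExpansion (C : QLChain) : Prop :=
  ∀ p : DynPoint, C.InDomain p.base →
    ExpandsAt (C.W 1) ![C.W 0, C.Yop 1, C.Yop 0] p

/-- `Z_8 = λ Z_7 + μ Z_6 + ν Z_5 + ρ Z_4 + κ Z_3 + σ Z_2 + δ Z_1 + η Z_0`, locally at every point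
of the space of dynamical variables over the domain of the chain. -/
def QLChain.SecondExpansion (C : QLChain) : Prop :=
  ∀ p : DynPoint, C.InDomain p.base →
    ExpandsAt (C.Z 8) (fun i : Fin 8 => C.Z i) p

/-- The family `g` of functions defines a locally invertible point transformation
`u_n = g_n(v_n)` from a neighbourhood of the sequence `v` to a neighbourhood of the
sequence `u`. -/
def IsPointTransformation (g : ℤ → ℂ → ℂ) (v u : ℤ → ℂ) : Prop :=
  ∀ n : ℤ, AnalyticAt ℂ (g n) (v n) ∧ deriv (g n) (v n) ≠ 0 ∧ g n (v n) = u n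

/-- Near the sequence `v`, the substitution `u_n = g_n(v_n)` takes the chain to
`v_{n,xy} = a_n v_{n,x} v_{n,y} + b_n v_{n,x} + c_n v_{n,y} + d_n`, with coefficients that are
functions of `(v_{n+1}, v_n, v_{n-1})`. The left-hand side below is `u_{n,xy}` according to the
chain, with `u_{n,x} = g_n' v_{n,x}`, `u_{n,y} = g_n' v_{n,y}`; the right-hand side is
`u_{n,xy} = g_n'' v_{n,x} v_{n,y} + g_n' v_{n,xy}`. -/
def QLChain.TransformsTo (C : QLChain) (g : ℤ → ℂ → ℂ) (v : ℤ → ℂ)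
    (a b c d : ℤ → ℂ × ℂ × ℂ → ℂ) : Prop :=
  ∀ n : ℤ, ∀ᶠ z in 𝓝 (triple v n), ∀ ξ η : ℂ,
    C.rhs (g (n + 1) z.1, g n z.2.1, g (n - 1) z.2.2)
        (deriv (g n) z.2.1 * ξ) (deriv (g n) z.2.1 * η) =
      deriv (deriv (g n)) z.2.1 * ξ * η +
        deriv (g n) z.2.1 * (a n z * ξ * η + b n z * ξ + c n z * η + d n z)

/-- `α = 1/(u_n - u_{n-1}) - 1/(u_{n+1} - u_n)`. -/
def alphaStd (z : ℂ × ℂ × ℂ) : ℂ := 1 / (z.2.1 - z.2.2) - 1 / (z.1 - z.2.1)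

/-- `r(t) = (k₁/2) t² + k₂ t + k₃`. -/
def rPoly (k₁ k₂ k₃ t : ℂ) : ℂ := k₁ / 2 * t ^ 2 + k₂ * t + k₃

/-- `γ = r'(u_n) - r(u_n) α`. -/
def gammaStd (k₁ k₂ k₃ : ℂ) (z : ℂ × ℂ × ℂ) : ℂ :=
  deriv (rPoly k₁ k₂ k₃) z.2.1 - rPoly k₁ k₂ k₃ z.2.1 * alphaStd z

end

/-! ### Locally analytic functions of finitely many dynamical variables -/

noncomputable section

/-! The brackets are computed in the Lie algebra of derivations of the ring of locally analytic
functions on a small open set. With D the differentiation along the x-jets, everything rests on [D,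
Y_n] = -A_n Y_n, where A_n = α_n u_{n,x} + γ_n (`QLChain.lie_jetD_yVF`); β and δ never enter. In the
other direction, a vector field R with no components at the u_n and u_{n,y} and with [D, R] = aR is
zero (`IsVF.eq_zero_of_lie_jetD`). A bracket identity can therefore be proved by showing that the
difference of its sides is an eigenvector of ad D.

Sufficiency. If v_n = V_n(u_n) are coordinates in which the chain is standard, the rescaled fields
Y_n / V_n' act as ∂/∂v_n on the base, and their eigenvalues are explicit. For λ = 2/(v_1 - v_0) the
field [Y_0, [Y_0, Y_1]] - λ [Y_0, Y_1] is an eigenvector (`lie_std_pair`), and so is Z_8 - ν Z_5 for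
ν = 1/(v_2 - v_1) - 1/(v_1 - v_0) (`lie_std_triple`). Hence W_2 is a multiple of W_1 and Z_8 a
multiple of Z_5; undoing the rescaling only changes the factors.

Necessity uses the first expansion alone, so the second one is a consequence of it. Base components
force W_2 = λ W_1, and applying ad D gives differential equations linking α, γ and λ = L_n(u_n,
u_{n+1}) at every site (`relations_of_lie`, `exists_relations`). They make α a sum of a function of
(u_n, u_{n+1}) and one of (u_{n-1}, u_n), and say that s ↦ L_{n+1}(s, t) solves the Riccati equation
whose potential is the Schwarzian derivative of t ↦ L_n(s, t) (`schwarzian_eq`). Solving it yields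
coordinates V_n, unique up to fractional linear maps, with L_n = V_n''/V_n' - 2V_n'/(V_n - V_{n+1})
for all n at once (`exists_isChartSystem`); this is the standard α. The ratio h_n of ∂γ/∂u_{n-1} and
∂α/∂u_{n-1} depends on u_n only, and h_n V_n' is a quadratic polynomial in V_n whose coefficients do
not depend on n; this is the standard γ (`exists_γ_eq`). If α is already standard, the identity is
such a system of coordinates, and the identity theorem extends the formula for γ to D. -/

/-- Restriction of a point of the space of dynamical variables to finitely many of them. -/
def resL (S : Finset DynVar) : DynPoint →L[ℂ] (S → ℂ) :=
  ContinuousLinearMap.pi fun c => ContinuousLinearMap.proj (c : DynVar)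

@[simp] lemma resL_apply (S : Finset DynVar) (p : DynPoint) (c : S) : resL S p c = p c := rfl

/-- Near `p`, the function `F` is analytic and depends on the variables in `S` only. -/
def AnalyticIn (S : Finset DynVar) (F : DynPoint → ℂ) (p : DynPoint) : Prop :=
  ∃ h : (S → ℂ) → ℂ, AnalyticAt ℂ h (resL S p) ∧ F =ᶠ[𝓝 p] fun q => h (resL S q)

lemma locAnalyticAt_iff {F : DynPoint → ℂ} {p : DynPoint} :
    LocAnalyticAt F p ↔ ∃ S, AnalyticIn S F p := Iff.rfl

namespace AnalyticIn

variable {S T : Finset DynVar} {F G : DynPoint → ℂ} {p : DynPoint}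

lemma mono (hF : AnalyticIn S F p) (hST : S ⊆ T) : AnalyticIn T F p := by
  obtain ⟨h, hh, he⟩ := hF
  let r : (T → ℂ) →L[ℂ] (S → ℂ) :=
    ContinuousLinearMap.pi fun c => ContinuousLinearMap.proj (⟨c, hST c.2⟩ : T)
  refine ⟨fun x => h (r x), ?_, ?_⟩
  · exact AnalyticAt.fun_comp (g := h) (f := r) (x := resL T p) hh (r.analyticAt _)
  · exact he

lemma congr (hF : AnalyticIn S F p) (hFG : F =ᶠ[𝓝 p] G) : AnalyticIn S G p := by
  obtain ⟨h, hh, he⟩ := hF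
  exact ⟨h, hh, hFG.symm.trans he⟩

lemma add (hF : AnalyticIn S F p) (hG : AnalyticIn S G p) :
    AnalyticIn S (fun q => F q + G q) p := by
  obtain ⟨h, hh, he⟩ := hF
  obtain ⟨k, hk, ke⟩ := hG
  exact ⟨fun x => h x + k x, hh.add hk, he.add ke⟩

lemma mul (hF : AnalyticIn S F p) (hG : AnalyticIn S G p) :
    AnalyticIn S (fun q => F q * G q) p := by
  obtain ⟨h, hh, he⟩ := hF
  obtain ⟨k, hk, ke⟩ := hG
  exact ⟨fun x => h x * k x, hh.mul hk, he.mul ke⟩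

lemma const (S : Finset DynVar) (a : ℂ) : AnalyticIn S (fun _ => a) p :=
  ⟨fun _ => a, analyticAt_const, .rfl⟩

lemma sum {ι : Type*} (s : Finset ι) {f : ι → DynPoint → ℂ}
    (hf : ∀ i ∈ s, AnalyticIn S (f i) p) : AnalyticIn S (fun q => ∑ i ∈ s, f i q) p := by
  classical
  induction s using Finset.induction_on with
  | empty => simpa using const S 0
  | insert a s ha ih =>
    simp only [Finset.sum_insert ha]
    exact (hf a (by simp)).add (ih fun i hi => hf i (by simp [hi]))

lemma eventually (hF : AnalyticIn S F p) : ∀ᶠ q in 𝓝 p, AnalyticIn S F q := by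
  obtain ⟨h, hh, he⟩ := hF
  have h1 : ∀ᶠ q in 𝓝 p, AnalyticAt ℂ h (resL S q) :=
    (resL S).continuous.continuousAt.eventually hh.eventually_analyticAt
  filter_upwards [h1, he.eventually_nhds] with q hq hq'
  exact ⟨h, hq, hq'⟩

lemma continuousAt (hF : AnalyticIn S F p) : ContinuousAt F p := by
  obtain ⟨h, hh, he⟩ := hF
  exact (ContinuousAt.comp' (g := h) hh.continuousAt (resL S).continuous.continuousAt).congr he.symm

end AnalyticIn

lemma update_eq_add (q : DynPoint) (c : DynVar) (t : ℂ) :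
    Function.update q c t = q + (t - q c) • (Pi.single c 1 : DynPoint) := by
  ext d
  by_cases h : d = c
  · subst h; simp
  · simp [h]

lemma continuous_update_right (q : DynPoint) (c : DynVar) :
    Continuous (fun t : ℂ => Function.update q c t) :=
  continuous_const.update c continuous_id

lemma tendsto_update_self (q : DynPoint) (c : DynVar) :
    Tendsto (fun t : ℂ => Function.update q c t) (𝓝 (q c)) (𝓝 q) := by
  have := (continuous_update_right q c).tendsto (q c)
  simpa using this

namespace AnalyticIn

variable {S T : Finset DynVar} {F G : DynPoint → ℂ} {p : DynPoint}

lemma hasDerivAt_slice_comp {h : (S → ℂ) → ℂ} (q : DynPoint) (c : DynVar)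
    (hh : AnalyticAt ℂ h (resL S q)) :
    HasDerivAt (fun t => h (resL S (Function.update q c t)))
      (fderiv ℂ h (resL S q) (resL S (Pi.single c 1))) (q c) := by
  have h1 : HasDerivAt (fun t => resL S (Function.update q c t)) (resL S (Pi.single c 1)) (q c) := by
    have : HasDerivAt (fun t : ℂ => resL S q + (t - q c) • resL S (Pi.single c 1))
        ((1 : ℂ) • resL S (Pi.single c 1)) (q c) :=
      (((hasDerivAt_id (q c)).sub_const (q c)).smul_const _).const_add _
    simpa [update_eq_add q c, map_add, map_smul] using this
  have h2 : HasFDerivAt h (fderiv ℂ h (resL S q)) (resL S (Function.update q c (q c))) := by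
    simpa using hh.differentiableAt.hasFDerivAt
  exact h2.comp_hasDerivAt (q c) h1

lemma hasDerivAt_slice (hF : AnalyticIn S F p) (c : DynVar) :
    HasDerivAt (fun t => F (Function.update p c t)) (pderivAt c F p) (p c) := by
  obtain ⟨h, hh, he⟩ := hF
  have h1 := hasDerivAt_slice_comp p c hh
  have h2 := h1.congr_of_eventuallyEq ((tendsto_update_self p c).eventually he)
  exact h2.differentiableAt.hasDerivAt

lemma exists_pderivAt_eq (hF : AnalyticIn S F p) : ∃ h : (S → ℂ) → ℂ, AnalyticAt ℂ h (resL S p) ∧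
    ∀ c, pderivAt c F =ᶠ[𝓝 p] fun q => fderiv ℂ h (resL S q) (resL S (Pi.single c 1)) := by
  obtain ⟨h, hh, he⟩ := hF
  have h1 : ∀ᶠ q in 𝓝 p, AnalyticAt ℂ h (resL S q) :=
    (resL S).continuous.continuousAt.eventually hh.eventually_analyticAt
  refine ⟨h, hh, fun c => ?_⟩
  filter_upwards [h1, he.eventually_nhds] with q hq hq'
  exact ((hasDerivAt_slice_comp q c hq).congr_of_eventuallyEq
    ((tendsto_update_self q c).eventually hq')).deriv

lemma analyticAt_fderiv_apply {h : (S → ℂ) → ℂ} {x : S → ℂ} (hh : AnalyticAt ℂ h x) (v : S → ℂ) :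
    AnalyticAt ℂ (fun y => fderiv ℂ h y v) x :=
  AnalyticAt.fun_comp (g := ContinuousLinearMap.apply ℂ ℂ v) (f := fderiv ℂ h)
    (ContinuousLinearMap.analyticAt _ _) hh.fderiv

lemma pderivAt (hF : AnalyticIn S F p) (c : DynVar) : AnalyticIn S (pderivAt c F) p := by
  obtain ⟨h, hh, he⟩ := hF.exists_pderivAt_eq
  exact ⟨_, analyticAt_fderiv_apply hh _, he c⟩

lemma pderivAt_eq_zero (hF : AnalyticIn S F p) {c : DynVar} (hc : c ∉ S) :
    _root_.pderivAt c F p = 0 := by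
  obtain ⟨h, hh, he⟩ := hF.exists_pderivAt_eq
  rw [(he c).self_of_nhds]
  have : resL S (Pi.single c 1) = 0 := by
    ext d
    have : (d : DynVar) ≠ c := fun h => hc (h ▸ d.2)
    simp [this]
  simp only [this, map_zero]

lemma pderivAt_comm (hF : AnalyticIn S F p) (c d : DynVar) :
    _root_.pderivAt c (_root_.pderivAt d F) p = _root_.pderivAt d (_root_.pderivAt c F) p := by
  obtain ⟨h, hh, he⟩ := hF.exists_pderivAt_eq
  have key : ∀ c d, _root_.pderivAt c (_root_.pderivAt d F) p =
      fderiv ℂ (fderiv ℂ h) (resL S p) (resL S (Pi.single c 1)) (resL S (Pi.single d 1)) := by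
    intro c d
    have h1 := hasDerivAt_slice_comp p c (analyticAt_fderiv_apply hh (resL S (Pi.single d 1)))
    have h2 := (h1.congr_of_eventuallyEq ((tendsto_update_self p c).eventually (he d))).deriv
    refine h2.trans ?_
    rw [fderiv_clm_apply hh.fderiv.differentiableAt (differentiableAt_const _)]
    simp
  rw [key, key]
  exact (hh.contDiffAt (n := ⊤)).isSymmSndFDerivAt_of_omega _ _

end AnalyticIn

lemma pderivAt_congr {F G : DynPoint → ℂ} {p : DynPoint} (h : F =ᶠ[𝓝 p] G) (c : DynVar) :
    pderivAt c F p = pderivAt c G p :=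
  Filter.EventuallyEq.deriv_eq ((tendsto_update_self p c).eventually h)

lemma FormalVF.act_congr (Z : FormalVF) {F G : DynPoint → ℂ} {p : DynPoint} (h : F =ᶠ[𝓝 p] G) :
    Z.act F p = Z.act G p := by
  simp only [FormalVF.act, pderivAt_congr h]

lemma AnalyticIn.act_eq_sum {S : Finset DynVar} {F : DynPoint → ℂ} {p : DynPoint}
    (hF : AnalyticIn S F p) (Z : FormalVF) :
    Z.act F p = ∑ c ∈ S, Z c p * _root_.pderivAt c F p := by
  apply finsum_eq_sum_of_support_subset
  intro c hc
  by_contra hcS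
  exact hc (by simp [hF.pderivAt_eq_zero hcS])

namespace LocAnalyticAt

variable {F G : DynPoint → ℂ} {p : DynPoint}

lemma exists_common (hF : LocAnalyticAt F p) (hG : LocAnalyticAt G p) :
    ∃ S, AnalyticIn S F p ∧ AnalyticIn S G p := by
  obtain ⟨S, hS⟩ := locAnalyticAt_iff.1 hF
  obtain ⟨T, hT⟩ := locAnalyticAt_iff.1 hG
  exact ⟨S ∪ T, hS.mono Finset.subset_union_left, hT.mono Finset.subset_union_right⟩

lemma congr (hF : LocAnalyticAt F p) (h : F =ᶠ[𝓝 p] G) : LocAnalyticAt G p :=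
  let ⟨S, hS⟩ := locAnalyticAt_iff.1 hF
  ⟨S, hS.congr h⟩

lemma add (hF : LocAnalyticAt F p) (hG : LocAnalyticAt G p) :
    LocAnalyticAt (fun q => F q + G q) p :=
  let ⟨S, hS, hT⟩ := hF.exists_common hG
  ⟨S, hS.add hT⟩

lemma mul (hF : LocAnalyticAt F p) (hG : LocAnalyticAt G p) :
    LocAnalyticAt (fun q => F q * G q) p :=
  let ⟨S, hS, hT⟩ := hF.exists_common hG
  ⟨S, hS.mul hT⟩

lemma const (a : ℂ) : LocAnalyticAt (fun _ => a) p := ⟨∅, AnalyticIn.const ∅ a⟩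

lemma eventually (hF : LocAnalyticAt F p) : ∀ᶠ q in 𝓝 p, LocAnalyticAt F q := by
  obtain ⟨S, hS⟩ := locAnalyticAt_iff.1 hF
  exact hS.eventually.mono fun q hq => ⟨S, hq⟩

lemma continuousAt (hF : LocAnalyticAt F p) : ContinuousAt F p :=
  let ⟨_, hS⟩ := locAnalyticAt_iff.1 hF
  hS.continuousAt

lemma pderivAt_comm (hF : LocAnalyticAt F p) (c d : DynVar) :
    _root_.pderivAt c (_root_.pderivAt d F) p = _root_.pderivAt d (_root_.pderivAt c F) p :=
  let ⟨_, hS⟩ := locAnalyticAt_iff.1 hF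
  hS.pderivAt_comm c d

lemma hasDerivAt_slice (hF : LocAnalyticAt F p) (c : DynVar) :
    HasDerivAt (fun t => F (Function.update p c t)) (_root_.pderivAt c F p) (p c) :=
  let ⟨_, hS⟩ := locAnalyticAt_iff.1 hF
  hS.hasDerivAt_slice c

/-- An analytic function of finitely many coordinates is locally analytic. -/
lemma of_analyticAt {ι : Type} [Fintype ι] (c : ι → DynVar) {h : (ι → ℂ) → ℂ}
    (hh : AnalyticAt ℂ h fun i => p (c i)) : LocAnalyticAt (fun q => h fun i => q (c i)) p := by
  classical
  let S : Finset DynVar := Finset.univ.image c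
  let r : (S → ℂ) →L[ℂ] (ι → ℂ) :=
    ContinuousLinearMap.pi fun i => ContinuousLinearMap.proj (⟨c i, by simp [S]⟩ : S)
  exact ⟨S, fun x => h (r x),
    AnalyticAt.fun_comp (g := h) (f := r) (x := resL S p) hh (r.analyticAt _), EventuallyEq.rfl⟩

lemma coord (c : DynVar) : LocAnalyticAt (fun q => q c) p :=
  of_analyticAt (fun _ : Unit => c) (h := fun x => x ())
    ((ContinuousLinearMap.proj (R := ℂ) (φ := fun _ : Unit => ℂ) ()).analyticAt _)

lemma of_analyticAt_prod₃ (a b c : DynVar) {h : ℂ × ℂ × ℂ → ℂ}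
    (hh : AnalyticAt ℂ h (p a, p b, p c)) : LocAnalyticAt (fun q => h (q a, q b, q c)) p := by
  let r : (Fin 3 → ℂ) →L[ℂ] ℂ × ℂ × ℂ :=
    (ContinuousLinearMap.proj 0).prod
      ((ContinuousLinearMap.proj 1).prod (ContinuousLinearMap.proj 2))
  exact of_analyticAt (![a, b, c]) (h := fun x => h (r x))
    (AnalyticAt.fun_comp (g := h) (f := r) hh (r.analyticAt _))

lemma of_analyticAt_one (a : DynVar) {h : ℂ → ℂ}
    (hh : AnalyticAt ℂ h (p a)) : LocAnalyticAt (fun q => h (q a)) p := by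
  let r : (Fin 1 → ℂ) →L[ℂ] ℂ := ContinuousLinearMap.proj 0
  exact of_analyticAt (![a]) (h := fun x => h (r x))
    (AnalyticAt.fun_comp (g := h) (f := r) hh (r.analyticAt _))

/-- Each component of `Z` may depend on its own finite set of variables; only the components along
the finitely many variables of `F` contribute, so a finite union suffices. -/
lemma act (hF : LocAnalyticAt F p) {Z : FormalVF} (hZ : ∀ c, LocAnalyticAt (Z c) p) :
    LocAnalyticAt (Z.act F) p := by
  classical
  obtain ⟨S, hS⟩ := locAnalyticAt_iff.1 hF
  choose T hT using fun c => locAnalyticAt_iff.1 (hZ c)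
  have hsum : AnalyticIn (S ∪ S.biUnion T)
      (fun q => ∑ c ∈ S, Z c q * _root_.pderivAt c F q) p :=
    AnalyticIn.sum S fun c hc => ((hT c).mono ((Finset.subset_biUnion_of_mem T hc).trans
      Finset.subset_union_right)).mul ((hS.pderivAt c).mono Finset.subset_union_left)
  exact ⟨_, hsum.congr (hS.eventually.mono fun q hq => (hq.act_eq_sum Z).symm)⟩

end LocAnalyticAt

/-! ### The algebra of locally analytic functions on an open set -/

open TopologicalSpace (Opens)

/-- Extension by zero of a function on an open set of dynamical points. -/
def extendZero {U : Opens DynPoint} (F : U → ℂ) : DynPoint → ℂ :=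
  open Classical in fun q => if h : q ∈ U then F ⟨q, h⟩ else 0

lemma extendZero_apply {U : Opens DynPoint} (F : U → ℂ) (q : U) : extendZero F q = F q := by
  simp [extendZero]

/-- Germs at points of `U` are not affected by the extension, so `pderivAt` and `LocAnalyticAt`,
which refer to functions on the whole space, apply to functions on `U`. -/
lemma extendZero_eventuallyEq {U : Opens DynPoint} {F : DynPoint → ℂ} {p : DynPoint} (hp : p ∈ U) :
    extendZero (fun q : U => F q) =ᶠ[𝓝 p] F := by
  filter_upwards [U.isOpen.mem_nhds hp] with q hq
  exact extendZero_apply (fun q : U => F q) ⟨q, hq⟩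

/-- The algebra of functions on `U` that are locally analytic functions of finitely many
dynamical variables. -/
def anaAlg (U : Opens DynPoint) : Subalgebra ℂ (U → ℂ) where
  carrier := {F | ∀ p ∈ U, LocAnalyticAt (extendZero F) p}
  mul_mem' {F G} hF hG p hp := ((hF p hp).mul (hG p hp)).congr <| by
    filter_upwards [U.isOpen.mem_nhds hp] with q hq
    simp [extendZero, show q ∈ U from hq]
  add_mem' {F G} hF hG p hp := ((hF p hp).add (hG p hp)).congr <| by
    filter_upwards [U.isOpen.mem_nhds hp] with q hq
    simp [extendZero, show q ∈ U from hq]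
  algebraMap_mem' a p hp := (LocAnalyticAt.const a).congr
    (extendZero_eventuallyEq (F := fun _ => a) hp).symm

/-- Locally analytic functions on `U`. -/
def AnaFun (U : Opens DynPoint) : Type := anaAlg U

namespace AnaFun

instance (U : Opens DynPoint) : CommRing (AnaFun U) := inferInstanceAs (CommRing (anaAlg U))

instance (U : Opens DynPoint) : Algebra ℂ (AnaFun U) := inferInstanceAs (Algebra ℂ (anaAlg U))

variable {U : Opens DynPoint}

/-- A function on all points that is locally analytic on `U`, as an element of the algebra. -/
def of (F : DynPoint → ℂ) (hF : ∀ p ∈ U, LocAnalyticAt F p) : AnaFun U :=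
  ⟨fun q => F q, fun p hp => (hF p hp).congr (extendZero_eventuallyEq hp).symm⟩

/-- Extension of a locally analytic function by zero. -/
def ext (F : AnaFun U) : DynPoint → ℂ := extendZero F.1

lemma ext_apply (F : AnaFun U) (q : U) : F.ext q = F.1 q := extendZero_apply _ _

lemma locAnalyticAt_ext (F : AnaFun U) {p : DynPoint} (hp : p ∈ U) : LocAnalyticAt F.ext p :=
  F.2 p hp

lemma of_apply {F : DynPoint → ℂ} (hF : ∀ p ∈ U, LocAnalyticAt F p) (q : U) :
    (of F hF).1 q = F q := rfl

lemma ext_of_eventuallyEq {F : DynPoint → ℂ} (hF : ∀ p ∈ U, LocAnalyticAt F p) {p : DynPoint}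
    (hp : p ∈ U) : (of F hF).ext =ᶠ[𝓝 p] F := extendZero_eventuallyEq hp

lemma eq_iff {F G : AnaFun U} : F = G ↔ ∀ q : U, F.1 q = G.1 q := by
  exact (Subtype.ext_iff (p := (· ∈ anaAlg U))).trans funext_iff

@[simp] lemma add_apply (F G : AnaFun U) (q : U) : (F + G).1 q = F.1 q + G.1 q := rfl
@[simp] lemma mul_apply (F G : AnaFun U) (q : U) : (F * G).1 q = F.1 q * G.1 q := rfl
@[simp] lemma sub_apply (F G : AnaFun U) (q : U) : (F - G).1 q = F.1 q - G.1 q := rfl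
@[simp] lemma zero_apply (q : U) : (0 : AnaFun U).1 q = 0 := rfl
@[simp] lemma one_apply (q : U) : (1 : AnaFun U).1 q = 1 := rfl
@[simp] lemma smul_apply (a : ℂ) (F : AnaFun U) (q : U) : (a • F).1 q = a * F.1 q := rfl

lemma sum_apply {ι : Type*} (s : Finset ι) (f : ι → AnaFun U) (q : U) :
    (∑ i ∈ s, f i).1 q = ∑ i ∈ s, (f i).1 q := by
  classical
  induction s using Finset.induction_on with
  | empty => simp
  | insert a s ha ih => rw [Finset.sum_insert ha, Finset.sum_insert ha, add_apply, ih]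

lemma ext_eventuallyEq_add (F G : AnaFun U) {p : DynPoint} (hp : p ∈ U) :
    (F + G).ext =ᶠ[𝓝 p] fun q => F.ext q + G.ext q := by
  filter_upwards [U.isOpen.mem_nhds hp] with q hq
  lift q to U using hq
  simp [ext_apply]

lemma ext_eventuallyEq_mul (F G : AnaFun U) {p : DynPoint} (hp : p ∈ U) :
    (F * G).ext =ᶠ[𝓝 p] fun q => F.ext q * G.ext q := by
  filter_upwards [U.isOpen.mem_nhds hp] with q hq
  lift q to U using hq
  simp [ext_apply]

lemma ext_eventuallyEq_smul (a : ℂ) (F : AnaFun U) {p : DynPoint} (hp : p ∈ U) :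
    (a • F).ext =ᶠ[𝓝 p] fun q => a * F.ext q := by
  filter_upwards [U.isOpen.mem_nhds hp] with q hq
  lift q to U using hq
  simp [ext_apply]

lemma pderivAt_add (F G : AnaFun U) (c : DynVar) (q : U) :
    pderivAt c (F + G).ext q = pderivAt c F.ext q + pderivAt c G.ext q := by
  rw [pderivAt_congr (ext_eventuallyEq_add F G q.2)]
  exact (((F.locAnalyticAt_ext q.2).hasDerivAt_slice c).add
    ((G.locAnalyticAt_ext q.2).hasDerivAt_slice c)).deriv

lemma pderivAt_mul (F G : AnaFun U) (c : DynVar) (q : U) :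
    pderivAt c (F * G).ext q = F.1 q * pderivAt c G.ext q + G.1 q * pderivAt c F.ext q := by
  rw [pderivAt_congr (ext_eventuallyEq_mul F G q.2)]
  have := (((F.locAnalyticAt_ext q.2).hasDerivAt_slice c).mul
    ((G.locAnalyticAt_ext q.2).hasDerivAt_slice c)).deriv
  simp only [Function.update_eq_self, ext_apply] at this
  refine this.trans ?_
  ring

lemma pderivAt_smul (a : ℂ) (F : AnaFun U) (c : DynVar) (q : U) :
    pderivAt c (a • F).ext q = a * pderivAt c F.ext q := by
  rw [pderivAt_congr (ext_eventuallyEq_smul a F q.2)]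
  exact (((F.locAnalyticAt_ext q.2).hasDerivAt_slice c).const_mul a).deriv

lemma hasFiniteSupport (Z F : DynVar → ℂ) (S : Finset DynVar) (hS : ∀ c ∉ S, F c = 0) :
    Function.HasFiniteSupport fun c => Z c * F c :=
  S.finite_toSet.subset fun c hc => by
    by_contra h
    exact hc (by simp [hS c h])

lemma exists_finset (F G : AnaFun U) (q : U) : ∃ S : Finset DynVar, ∀ c ∉ S,
    pderivAt c F.ext q = 0 ∧ pderivAt c G.ext q = 0 := by
  obtain ⟨S, h1, h2⟩ := (F.locAnalyticAt_ext q.2).exists_common (G.locAnalyticAt_ext q.2)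
  exact ⟨S, fun c hc => ⟨h1.pderivAt_eq_zero hc, h2.pderivAt_eq_zero hc⟩⟩

/-- The derivation of the algebra of locally analytic functions with given components. -/
def vf (Z : DynVar → AnaFun U) : Derivation ℂ (AnaFun U) (AnaFun U) :=
  Derivation.mk'
    { toFun := fun F => of (FormalVF.act (fun c => (Z c).ext) F.ext) fun p hp =>
        (F.locAnalyticAt_ext hp).act fun c => (Z c).locAnalyticAt_ext hp
      map_add' := fun F G => eq_iff.2 fun q => by
        obtain ⟨S, hS⟩ := exists_finset F G q
        simp only [of_apply, add_apply, FormalVF.act, pderivAt_add, mul_add]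
        exact finsum_add_distrib (hasFiniteSupport _ _ S fun c hc => (hS c hc).1)
          (hasFiniteSupport _ _ S fun c hc => (hS c hc).2)
      map_smul' := fun a F => eq_iff.2 fun q => by
        simp only [of_apply, smul_apply, FormalVF.act, pderivAt_smul, RingHom.id_apply]
        rw [mul_finsum]
        exact finsum_congr fun c => by ring }
    fun F G => eq_iff.2 fun q => by
        obtain ⟨S, hS⟩ := exists_finset F G q
        simp only [of_apply, add_apply, smul_eq_mul, mul_apply, FormalVF.act, pderivAt_mul,
          LinearMap.coe_mk, AddHom.coe_mk]
        have h1 := hasFiniteSupport (fun c => (Z c).ext q) _ S fun c hc => (hS c hc).1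
        have h2 := hasFiniteSupport (fun c => (Z c).ext q) _ S fun c hc => (hS c hc).2
        rw [mul_finsum, mul_finsum, ← finsum_add_distrib]
        · exact finsum_congr fun c => by ring
        · exact h2.subset fun c hc h => hc (by simp only at h ⊢; rw [h, mul_zero])
        · exact h1.subset fun c hc h => hc (by simp only at h ⊢; rw [h, mul_zero])

lemma vf_apply (Z : DynVar → AnaFun U) (F : AnaFun U) (q : U) :
    (vf Z F).1 q = FormalVF.act (fun c => (Z c).ext) F.ext q := rfl

end AnaFun
end

/-! ### Vector fields as derivations -/

noncomputable section

open TopologicalSpace (Opens)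

namespace AnaFun

variable {U : Opens DynPoint}

/-- Derivations of the algebra of locally analytic functions. -/
abbrev VF (U : Opens DynPoint) : Type := Derivation ℂ (AnaFun U) (AnaFun U)

/-- A dynamical variable as an element of the algebra. -/
def coord (c : DynVar) : AnaFun U := of (fun q => q c) fun _ _ => LocAnalyticAt.coord c

@[simp] lemma coord_apply (c : DynVar) (q : U) : (coord c : AnaFun U).1 q = q.1 c := rfl

/-- Partial differentiation as a derivation of the algebra. -/
def pd (c : DynVar) : VF U := vf (Pi.single c 1)

lemma ext_single (c d : DynVar) (q : U) :
    ((Pi.single c 1 : DynVar → AnaFun U) d).ext q = if d = c then 1 else 0 := by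
  rw [ext_apply]
  by_cases h : d = c
  · subst h; simp
  · simp [h]

lemma pd_apply (c : DynVar) (F : AnaFun U) (q : U) : (pd c F).1 q = pderivAt c F.ext q := by
  rw [pd, vf_apply, FormalVF.act, finsum_eq_single _ c]
  · simp only [ext_single, if_pos, one_mul]
  · intro d hd
    simp only [ext_single, if_neg hd, zero_mul]

lemma pd_ext_eventuallyEq (c : DynVar) (F : AnaFun U) {p : DynPoint} (hp : p ∈ U) :
    (pd c F).ext =ᶠ[𝓝 p] pderivAt c F.ext := by
  filter_upwards [U.isOpen.mem_nhds hp] with q hq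
  lift q to U using hq
  rw [ext_apply, pd_apply]

lemma pd_of_apply (c : DynVar) {F : DynPoint → ℂ} (hF : ∀ p ∈ U, LocAnalyticAt F p) (q : U) :
    (pd c (of F hF)).1 q = pderivAt c F q := by
  rw [pd_apply, pderivAt_congr (ext_of_eventuallyEq hF q.2)]

lemma pd_of_eq_zero {c : DynVar} {F : DynPoint → ℂ} (hF : ∀ p ∈ U, LocAnalyticAt F p)
    (h : ∀ q t, F (Function.update q c t) = F q) : pd c (of F hF) = 0 :=
  eq_iff.2 fun q => by simp [pd_of_apply, pderivAt, h]

lemma pd_coord (c d : DynVar) : pd c (coord d : AnaFun U) = if c = d then 1 else 0 := by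
  refine eq_iff.2 fun q => ?_
  rw [coord, pd_of_apply, pderivAt]
  by_cases h : c = d
  · subst h; simp
  · simp [h, Function.update_of_ne (Ne.symm h)]

lemma pd_comm (c d : DynVar) (F : AnaFun U) : pd c (pd d F) = pd d (pd c F) :=
  eq_iff.2 fun q => by
    rw [pd_apply, pd_apply, pderivAt_congr (pd_ext_eventuallyEq d F q.2),
      pderivAt_congr (pd_ext_eventuallyEq c F q.2)]
    exact (F.locAnalyticAt_ext q.2).pderivAt_comm c d

lemma vf_eq_sum_of_analyticIn (Z : DynVar → AnaFun U) {F : AnaFun U} {q : U} {S : Finset DynVar}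
    (hS : AnalyticIn S F.ext q) : (vf Z F).1 q = ∑ c ∈ S, (Z c).1 q * (pd c F).1 q := by
  simp only [vf_apply, hS.act_eq_sum, ext_apply, pd_apply]

lemma vf_eq_finsum (Z : DynVar → AnaFun U) (F : AnaFun U) (q : U) :
    (vf Z F).1 q = ∑ᶠ c, (Z c).1 q * (pd c F).1 q := by
  simp only [vf_apply, FormalVF.act, ext_apply, pd_apply]

/-- The chain rule for functions of finitely many variables. -/
lemma vf_eq_sum (Z : DynVar → AnaFun U) {F : AnaFun U} (S : Finset DynVar)
    (hS : ∀ c ∉ S, pd c F = 0) : vf Z F = ∑ c ∈ S, Z c * pd c F := by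
  refine eq_iff.2 fun q => ?_
  rw [vf_eq_finsum, finsum_eq_sum_of_support_subset (s := S)]
  · simp only [sum_apply, mul_apply]
  · intro c hc
    by_contra h
    exact hc (by simp [hS c h])

lemma vf_congr_germ (Z : DynVar → AnaFun U) {F G : AnaFun U} {q : U}
    (h : F.ext =ᶠ[𝓝 q.1] G.ext) : (vf Z F).1 q = (vf Z G).1 q := by
  rw [vf_apply, vf_apply, FormalVF.act_congr _ h]

@[simp] lemma vf_coord (Z : DynVar → AnaFun U) (c : DynVar) : vf Z (coord c) = Z c := by
  rw [vf_eq_sum Z {c}]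
  · simp [pd_coord]
  · intro d hd
    rw [pd_coord, if_neg (by simpa using hd)]

/-- A derivation that acts as the vector field with its components. -/
def IsVF (X : VF U) : Prop := X = vf fun c => X (coord c)

lemma isVF_vf (Z : DynVar → AnaFun U) : IsVF (vf Z) := by
  simp only [IsVF, vf_coord]

/-- Derivations of the algebra are not known in advance to be determined by their values at the
coordinates; `IsVF` supplies exactly this. -/
lemma IsVF.ext {X Y : VF U} (hX : IsVF X) (hY : IsVF Y)
    (h : ∀ c, X (coord c) = Y (coord c)) : X = Y := by
  rw [hX, hY]
  simp only [h]

lemma IsVF.add {X Y : VF U} (hX : IsVF X) (hY : IsVF Y) :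
    IsVF (X + Y) := by
  ext1 F
  refine eq_iff.2 fun q => ?_
  obtain ⟨S, hS⟩ := locAnalyticAt_iff.1 (F.locAnalyticAt_ext q.2)
  have h1 := congrFun (congrArg DFunLike.coe hX) F
  have h2 := congrFun (congrArg DFunLike.coe hY) F
  rw [Derivation.add_apply, h1, h2, add_apply]
  simp only [vf_eq_sum_of_analyticIn _ hS, Derivation.add_apply, add_apply, add_mul,
    Finset.sum_add_distrib]

lemma IsVF.smul (a : AnaFun U) {X : VF U} (hX : IsVF X) :
    IsVF (a • X) := by
  ext1 F
  refine eq_iff.2 fun q => ?_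
  obtain ⟨S, hS⟩ := locAnalyticAt_iff.1 (F.locAnalyticAt_ext q.2)
  have h1 := congrFun (congrArg DFunLike.coe hX) F
  rw [Derivation.smul_apply, h1, smul_eq_mul, mul_apply]
  simp only [vf_eq_sum_of_analyticIn _ hS, Derivation.smul_apply, smul_eq_mul, mul_apply,
    Finset.mul_sum, mul_assoc]

lemma IsVF.neg {X : VF U} (hX : IsVF X) : IsVF (-X) := by
  simpa using hX.smul (-1)

lemma IsVF.sub {X Y : VF U} (hX : IsVF X) (hY : IsVF Y) :
    IsVF (X - Y) := by
  simpa [sub_eq_add_neg] using hX.add hY.neg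

/-- Near `q` the inner derivative is a finite sum, to which the Leibniz rule applies. The
second-order part is isolated because it is what must cancel in a commutator. -/
lemma vf_vf_apply (Z W : DynVar → AnaFun U) {F : AnaFun U} {q : U} {S : Finset DynVar}
    (hS : AnalyticIn S F.ext q) : (vf Z (vf W F)).1 q =
      ∑ c ∈ S, (vf Z (W c)).1 q * (pd c F).1 q +
        ∑ c ∈ S, ∑ d ∈ S, (W c).1 q * (Z d).1 q * (pd d (pd c F)).1 q := by
  have h1 : (vf W F).ext =ᶠ[𝓝 q.1] (∑ c ∈ S, W c * pd c F).ext := by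
    filter_upwards [U.isOpen.mem_nhds q.2, hS.eventually] with r hr hrS
    lift r to U using hr
    rw [ext_apply, ext_apply, vf_eq_sum_of_analyticIn _ hrS]
    simp only [sum_apply, mul_apply]
  rw [vf_congr_germ Z h1, map_sum]
  simp only [sum_apply, Derivation.leibniz, smul_eq_mul,
    add_apply, mul_apply]
  rw [Finset.sum_add_distrib, add_comm]
  congr 1
  · exact Finset.sum_congr rfl fun c _ => mul_comm _ _
  · refine Finset.sum_congr rfl fun c _ => ?_
    have h2 : AnalyticIn S (pd c F).ext q :=
      (hS.pderivAt c).congr (pd_ext_eventuallyEq c F q.2).symm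
    rw [vf_eq_sum_of_analyticIn Z h2, Finset.mul_sum]
    exact Finset.sum_congr rfl fun d _ => by ring

lemma IsVF.lie {X Y : VF U} (hX : IsVF X) (hY : IsVF Y) :
    IsVF ⁅X, Y⁆ := by
  set Z := fun c => X (coord c) with hZ
  set W := fun c => Y (coord c) with hW
  ext1 F
  refine eq_iff.2 fun q => ?_
  obtain ⟨S, hS⟩ := locAnalyticAt_iff.1 (F.locAnalyticAt_ext q.2)
  rw [hX, hY, Derivation.commutator_apply]
  simp only [← hZ, ← hW, sub_apply, vf_vf_apply _ _ hS, vf_eq_sum_of_analyticIn _ hS,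
    Derivation.commutator_apply, vf_coord, sub_mul, Finset.sum_sub_distrib]
  -- After the indices are exchanged, symmetry of the mixed partial derivatives identifies the two
  -- second-order sums.
  rw [Finset.sum_comm (f := fun c d => (Z c).1 q * (W d).1 q * (pd d (pd c F)).1 q)]
  have : ∀ c d, (W c).1 q * (Z d).1 q * (pd d (pd c F)).1 q =
      (Z d).1 q * (W c).1 q * (pd c (pd d F)).1 q := fun c d => by rw [pd_comm c d]; ring
  simp only [this]
  ring

/-- The formal vector field `Z` is represented on `U` by the derivation `X`. -/
def Represents (X : VF U) (Z : FormalVF) : Prop :=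
  IsVF X ∧ ∀ (c : DynVar) (q : U), Z c q = (X (coord c)).1 q

lemma Represents.eventuallyEq {X : VF U} {Z : FormalVF}
    (h : Represents X Z) (c : DynVar) {p : DynPoint} (hp : p ∈ U) :
    Z c =ᶠ[𝓝 p] (X (coord c)).ext := by
  filter_upwards [U.isOpen.mem_nhds hp] with q hq
  lift q to U using hq
  rw [ext_apply, h.2]

lemma Represents.act_apply {X : VF U} {Z : FormalVF}
    (h : Represents X Z) (F : AnaFun U) (q : U) : Z.act F.ext q = (X F).1 q := by
  rw [h.1, vf_apply]
  simp only [FormalVF.act, h.2, ext_apply]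

/-- This transfers iterated formal commutators to Lie brackets of derivations, where the Jacobi
identity and ring arithmetic are available. -/
lemma Represents.comm {X Y : VF U} {Z W : FormalVF}
    (hX : Represents X Z) (hY : Represents Y W) : Represents ⁅X, Y⁆ (Z.comm W) := by
  refine ⟨hX.1.lie hY.1, fun c q => ?_⟩
  rw [Derivation.commutator_apply, sub_apply, ← hX.act_apply, ← hY.act_apply, FormalVF.comm,
    Pi.sub_apply, FormalVF.act_congr _ (hY.eventuallyEq c q.2),
    FormalVF.act_congr _ (hX.eventuallyEq c q.2)]

/-- Components of total differentiation with respect to `x`, on functions that do not depend on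
the `u_{n,y}`. -/
def jetShift : DynVar → AnaFun U
  | .jet n k => coord (.jet n (k + 1))
  | .vel _ => 0

/-- Total differentiation with respect to `x`, on functions that do not depend on
the `u_{n,y}`. -/
def jetD (U : Opens DynPoint) : VF U := vf jetShift

lemma isVF_jetD : IsVF (jetD U) := isVF_vf _

@[simp] lemma jetD_jet (n : ℤ) (k : ℕ) :
    jetD U (coord (.jet n k) : AnaFun U) = coord (.jet n (k + 1)) := vf_coord _ _

@[simp] lemma jetD_vel (n : ℤ) : jetD U (coord (.vel n) : AnaFun U) = 0 := vf_coord _ _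

/-- A vector field whose commutator with total differentiation is proportional to itself is
determined by its components at the variables `u_n` and `u_{n,y}`. -/
lemma IsVF.eq_zero_of_lie_jetD {R : VF U} (hR : IsVF R)
    {a : AnaFun U} (h : ⁅jetD U, R⁆ = a • R) (h0 : ∀ n, R (coord (.jet n 0)) = 0)
    (hv : ∀ n, R (coord (.vel n)) = 0) : R = 0 := by
  -- The next jet is the D-derivative of the previous one, and R(Dx) = D(Rx) - a Rx, so vanishing
  -- passes from order k to order k + 1.
  have key : ∀ k n, R (coord (.jet n k)) = 0 := by
    intro k
    induction k with
    | zero => exact h0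
    | succ k ih =>
      intro n
      have := congrArg (fun X => X (coord (.jet n k))) h
      simpa [Derivation.commutator_apply, ih n] using this
  have h0 : IsVF (0 : VF U) := by
    simpa using hR.smul 0
  refine hR.ext h0 fun c => ?_
  cases c with
  | jet n k => simpa using key k n
  | vel n => simpa using hv n

lemma lie_pd_jetD_vel (n : ℤ) : ⁅(pd (.vel n) : VF U), jetD U⁆ =
    0 := by
  refine ((isVF_vf _).lie isVF_jetD).ext (by simpa using (isVF_jetD (U := U)).smul 0) fun c => ?_
  change ⁅(pd (.vel n) : VF U), jetD U⁆ (coord c) = _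
  cases c <;> simp [Derivation.commutator_apply, pd_coord] <;> split_ifs <;> simp

end AnaFun
end

noncomputable section

open TopologicalSpace (Opens)

/-! ### Partial derivatives of functions of three variables -/

/-- Partial derivative with respect to the first variable. -/
def dX (h : ℂ × ℂ × ℂ → ℂ) (z : ℂ × ℂ × ℂ) : ℂ := deriv (fun t => h (t, z.2.1, z.2.2)) z.1

/-- Partial derivative with respect to the second variable. -/
def dY (h : ℂ × ℂ × ℂ → ℂ) (z : ℂ × ℂ × ℂ) : ℂ := deriv (fun t => h (z.1, t, z.2.2)) z.2.1

/-- Partial derivative with respect to the third variable. -/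
def dZ (h : ℂ × ℂ × ℂ → ℂ) (z : ℂ × ℂ × ℂ) : ℂ := deriv (fun t => h (z.1, z.2.1, t)) z.2.2

section Partial

variable {h : ℂ × ℂ × ℂ → ℂ} {z : ℂ × ℂ × ℂ}

lemma AnalyticAt.hasDerivAt_dX' (hh : AnalyticAt ℂ h z) :
    HasDerivAt (fun t => h (t, z.2.1, z.2.2)) (fderiv ℂ h z (1, 0, 0)) z.1 := by
  have h1 : HasDerivAt (fun t : ℂ => (t, z.2.1, z.2.2)) (1, 0, 0) z.1 :=
    (hasDerivAt_id _).prodMk ((hasDerivAt_const _ _).prodMk (hasDerivAt_const _ _))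
  exact (hh.differentiableAt.hasFDerivAt (x := z)).comp_hasDerivAt z.1 h1

lemma AnalyticAt.hasDerivAt_dY' (hh : AnalyticAt ℂ h z) :
    HasDerivAt (fun t => h (z.1, t, z.2.2)) (fderiv ℂ h z (0, 1, 0)) z.2.1 := by
  have h1 : HasDerivAt (fun t : ℂ => (z.1, t, z.2.2)) (0, 1, 0) z.2.1 :=
    (hasDerivAt_const _ _).prodMk ((hasDerivAt_id _).prodMk (hasDerivAt_const _ _))
  exact (hh.differentiableAt.hasFDerivAt (x := z)).comp_hasDerivAt z.2.1 h1

lemma AnalyticAt.hasDerivAt_dZ' (hh : AnalyticAt ℂ h z) :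
    HasDerivAt (fun t => h (z.1, z.2.1, t)) (fderiv ℂ h z (0, 0, 1)) z.2.2 := by
  have h1 : HasDerivAt (fun t : ℂ => (z.1, z.2.1, t)) (0, 0, 1) z.2.2 :=
    (hasDerivAt_const _ _).prodMk ((hasDerivAt_const _ _).prodMk (hasDerivAt_id _))
  exact (hh.differentiableAt.hasFDerivAt (x := z)).comp_hasDerivAt z.2.2 h1

lemma AnalyticAt.hasDerivAt_dY (hh : AnalyticAt ℂ h z) :
    HasDerivAt (fun t => h (z.1, t, z.2.2)) (dY h z) z.2.1 :=
  hh.hasDerivAt_dY'.differentiableAt.hasDerivAt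

lemma AnalyticAt.hasDerivAt_dZ (hh : AnalyticAt ℂ h z) :
    HasDerivAt (fun t => h (z.1, z.2.1, t)) (dZ h z) z.2.2 :=
  hh.hasDerivAt_dZ'.differentiableAt.hasDerivAt

lemma AnalyticAt.fderiv_apply_const {E : Type*} [NormedAddCommGroup E] [NormedSpace ℂ E]
    {h : E → ℂ} {z : E} (hh : AnalyticAt ℂ h z) (v : E) :
    AnalyticAt ℂ (fun y => fderiv ℂ h y v) z :=
  AnalyticAt.fun_comp (g := ContinuousLinearMap.apply ℂ ℂ v) (f := fderiv ℂ h)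
    (ContinuousLinearMap.analyticAt _ _) hh.fderiv

lemma AnalyticAt.dX (hh : AnalyticAt ℂ h z) : AnalyticAt ℂ (dX h) z :=
  (hh.fderiv_apply_const (1, 0, 0)).congr
    (hh.eventually_analyticAt.mono fun _ hy => hy.hasDerivAt_dX'.deriv.symm)

lemma AnalyticAt.dY (hh : AnalyticAt ℂ h z) : AnalyticAt ℂ (dY h) z :=
  (hh.fderiv_apply_const (0, 1, 0)).congr
    (hh.eventually_analyticAt.mono fun _ hy => hy.hasDerivAt_dY'.deriv.symm)

lemma AnalyticAt.dZ (hh : AnalyticAt ℂ h z) : AnalyticAt ℂ (dZ h) z :=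
  (hh.fderiv_apply_const (0, 0, 1)).congr
    (hh.eventually_analyticAt.mono fun _ hy => hy.hasDerivAt_dZ'.deriv.symm)

lemma AnalyticOnNhd.dX {D : Set (ℂ × ℂ × ℂ)} (hh : AnalyticOnNhd ℂ h D) :
    AnalyticOnNhd ℂ (dX h) D := fun z hz => (hh z hz).dX

lemma AnalyticOnNhd.dY {D : Set (ℂ × ℂ × ℂ)} (hh : AnalyticOnNhd ℂ h D) :
    AnalyticOnNhd ℂ (dY h) D := fun z hz => (hh z hz).dY

lemma AnalyticOnNhd.dZ {D : Set (ℂ × ℂ × ℂ)} (hh : AnalyticOnNhd ℂ h D) :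
    AnalyticOnNhd ℂ (dZ h) D := fun z hz => (hh z hz).dZ

end Partial

/-! ### The coefficients of the chain and the fields Y_n in the algebra -/

namespace QLChain

variable (C : QLChain) {U : Opens DynPoint}

/-- All points of `U` have their triple at site `n` in the domain of the chain. -/
def Over (n : ℤ) (U : Opens DynPoint) : Prop := ∀ q ∈ U, triple (DynPoint.base q) n ∈ C.D

variable {C} {n : ℤ}

open AnaFun

lemma locAnalyticAt_coef {h : ℂ × ℂ × ℂ → ℂ} (hh : AnalyticOnNhd ℂ h C.D) (hU : C.Over n U) :
    ∀ p ∈ U, LocAnalyticAt (fun q => h (triple (DynPoint.base q) n)) p := fun p hp =>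
  LocAnalyticAt.of_analyticAt_prod₃ (.jet (n + 1) 0) (.jet n 0) (.jet (n - 1) 0) (hh _ (hU p hp))

/-- A function of `(u_{n+1}, u_n, u_{n-1})`. -/
def coef {h : ℂ × ℂ × ℂ → ℂ} (hh : AnalyticOnNhd ℂ h C.D) (hU : C.Over n U) : AnaFun U :=
  of (fun q => h (triple (DynPoint.base q) n)) (locAnalyticAt_coef hh hU)

variable {h : ℂ × ℂ × ℂ → ℂ} (hh : AnalyticOnNhd ℂ h C.D) (hU : C.Over n U)

lemma coef_apply (q : U) : (coef hh hU).1 q = h (triple (DynPoint.base q.1) n) := rfl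

lemma pd_coef_succ : pd (.jet (n + 1) 0) (coef hh hU) = coef hh.dX hU := by
  refine eq_iff.2 fun q => ?_
  rw [coef, pd_of_apply, pderivAt, coef_apply, dX]
  have : n - 1 ≠ n + 1 := by omega
  simp [triple, DynPoint.base, this]

lemma pd_coef_self : pd (.jet n 0) (coef hh hU) = coef hh.dY hU := by
  refine eq_iff.2 fun q => ?_
  rw [coef, pd_of_apply, pderivAt, coef_apply, dY]
  simp [triple, DynPoint.base]

lemma pd_coef_pred : pd (.jet (n - 1) 0) (coef hh hU) = coef hh.dZ hU := by
  refine eq_iff.2 fun q => ?_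
  rw [coef, pd_of_apply, pderivAt, coef_apply, dZ]
  have : n + 1 ≠ n - 1 := by omega
  have h' : n ≠ n - 1 := by omega
  simp [triple, DynPoint.base, this, h']

lemma pd_coef_of_ne {c : DynVar} (h1 : c ≠ .jet (n + 1) 0) (h2 : c ≠ .jet n 0)
    (h3 : c ≠ .jet (n - 1) 0) : pd c (coef hh hU) = 0 :=
  pd_of_eq_zero _ fun q t => by
    simp [triple, DynPoint.base, Function.update_of_ne h1.symm, Function.update_of_ne h2.symm,
      Function.update_of_ne h3.symm]

lemma vf_coef (Z : DynVar → AnaFun U) : vf Z (coef hh hU) =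
    Z (.jet (n + 1) 0) * coef hh.dX hU + Z (.jet n 0) * coef hh.dY hU +
      Z (.jet (n - 1) 0) * coef hh.dZ hU := by
  rw [vf_eq_sum Z {.jet (n + 1) 0, .jet n 0, .jet (n - 1) 0}]
  · have : n + 1 ≠ n - 1 := by omega
    have h' : n ≠ n - 1 := by omega
    rw [Finset.sum_insert (by simp [this]), Finset.sum_insert (by simp [h']), Finset.sum_singleton,
      pd_coef_succ, pd_coef_self, pd_coef_pred, add_assoc]
  · intro c hc
    simp only [Finset.mem_insert, Finset.mem_singleton, not_or] at hc
    exact pd_coef_of_ne hh hU hc.1 hc.2.1 hc.2.2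

/-- The function `A_n = α_n u_{n,x} + γ_n`. -/
def slope (hU : C.Over n U) : AnaFun U :=
  coef C.analytic_α hU * coord (.jet n 1) + coef C.analytic_γ hU

/-- The right-hand side `f_n` as a locally analytic function. -/
def fFun (hU : C.Over n U) : AnaFun U :=
  slope hU * coord (.vel n) + (coef C.analytic_β hU * coord (.jet n 1) + coef C.analytic_δ hU)

lemma fFun_apply (q : U) : (fFun hU).1 q = C.f n q := by
  simp only [fFun, slope, add_apply, mul_apply, coef_apply, coord_apply, f, rhs]
  ring

lemma pd_vel_coef (m : ℤ) : pd (.vel m) (coef hh hU) = 0 :=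
  pd_coef_of_ne hh hU (by simp) (by simp) (by simp)

lemma pd_vel_slope (m : ℤ) : pd (.vel m) (slope hU) = 0 := by
  simp [slope, pd_vel_coef, pd_coord]

lemma pd_vel_fFun_self : pd (.vel n) (fFun hU) = slope hU := by
  simp [fFun, pd_vel_slope, pd_vel_coef, pd_coord]

lemma pd_vel_fFun_of_ne {m : ℤ} (hm : m ≠ n) : pd (.vel m) (fFun hU) = 0 := by
  simp [fFun, pd_vel_slope, pd_vel_coef, pd_coord, hm]

/-- Total differentiation on functions of the `x`-jets and `u_{n,y}`. -/
def siteD (hU : C.Over n U) : VF U := jetD U + fFun hU • pd (.vel n)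

/-- The function `D_x^k f_n`. -/
def iterF (hU : C.Over n U) (k : ℕ) : AnaFun U := (siteD hU)^[k] (fFun hU)

lemma iterF_succ (k : ℕ) : iterF hU (k + 1) = siteD hU (iterF hU k) :=
  Function.iterate_succ_apply' _ _ _

lemma pd_jetD_vel (m : ℤ) (F : AnaFun U) : pd (.vel m) (jetD U F) = jetD U (pd (.vel m) F) := by
  have := congrArg (fun X => X F) (lie_pd_jetD_vel (U := U) m)
  simpa [Derivation.commutator_apply, sub_eq_zero] using this

lemma pd_vel_iterF_of_ne {m : ℤ} (hm : m ≠ n) (k : ℕ) : pd (.vel m) (iterF hU k) = 0 := by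
  induction k with
  | zero => exact pd_vel_fFun_of_ne hU hm
  | succ k ih =>
    simp [iterF_succ, siteD, pd_jetD_vel, ih, pd_vel_fFun_of_ne hU hm, pd_comm (.vel m) (.vel n)]

/-- The coefficient of `u_{n,y}` in `D_x^k f_n`. -/
def velCoef (hU : C.Over n U) (k : ℕ) : AnaFun U := pd (.vel n) (iterF hU k)

lemma velCoef_zero : velCoef hU 0 = slope hU := pd_vel_fFun_self hU

lemma velCoef_succ_aux (k : ℕ) : velCoef hU (k + 1) =
    jetD U (velCoef hU k) + slope hU * velCoef hU k + fFun hU * pd (.vel n) (velCoef hU k) := by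
  simp [velCoef, iterF_succ, siteD, pd_jetD_vel, pd_vel_fFun_self]
  ring

/-- The functions D_x^k f_n are affine in u_{n,y}, so the components of Y_n are free of velocities.
This is why `jetD`, which ignores the velocities, may replace D_x. -/
lemma pd_vel_velCoef (k : ℕ) : pd (.vel n) (velCoef hU k) = 0 := by
  induction k with
  | zero => rw [velCoef_zero, pd_vel_slope]
  | succ k ih => simp [velCoef_succ_aux, pd_jetD_vel, ih, pd_vel_slope]

lemma velCoef_succ (k : ℕ) : velCoef hU (k + 1) =
    jetD U (velCoef hU k) + slope hU * velCoef hU k := by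
  rw [velCoef_succ_aux, pd_vel_velCoef, mul_zero, add_zero]

/-- Among the velocities only u_{n,y} occurs in D_x^k f_n, so D_x acts on it as `siteD`, and
analyticity at the single site `n` is enough. -/
lemma Dx_iterate_eq (k : ℕ) {p : DynPoint} (hp : p ∈ U) :
    (C.Dx.act)^[k] (C.f n) =ᶠ[𝓝 p] (iterF hU k).ext := by
  induction k generalizing p with
  | zero =>
    filter_upwards [U.isOpen.mem_nhds hp] with q hq
    lift q to U using hq
    exact (fFun_apply hU q).symm.trans (ext_apply _ _).symm
  | succ k ih =>
    filter_upwards [U.isOpen.mem_nhds hp] with q hq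
    rw [Function.iterate_succ_apply', FormalVF.act_congr _ (ih hq)]
    lift q to U using hq
    rw [ext_apply, iterF_succ, siteD]
    obtain ⟨S, hS⟩ := locAnalyticAt_iff.1 ((iterF hU k).locAnalyticAt_ext q.2)
    have hS' := hS.mono (Finset.subset_insert (.vel n) S)
    rw [hS'.act_eq_sum, Derivation.add_apply, add_apply, jetD, vf_eq_sum_of_analyticIn _ hS',
      Derivation.smul_apply, smul_eq_mul, mul_apply,
      ← Finset.sum_ite_eq' (insert (.vel n) S) (.vel n)
        (fun c => (fFun hU).1 q * (pd c (iterF hU k)).1 q) |>.trans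
        (if_pos (Finset.mem_insert_self _ _)), ← Finset.sum_add_distrib]
    refine Finset.sum_congr rfl fun c _ => ?_
    rw [← pd_apply]
    cases c with
    | jet m j => simp [Dx, jetShift]
    | vel m =>
      by_cases hm : m = n
      · subst hm; simp [Dx, jetShift, fFun_apply]
      · simp [Dx, jetShift, hm, pd_vel_iterF_of_ne hU hm]

/-- The components of `Y_n`. -/
def yComp (hU : C.Over n U) : DynVar → AnaFun U
  | .jet m 0 => if m = n then 1 else 0
  | .jet m (k + 1) => if m = n then velCoef hU k else 0
  | .vel _ => 0

/-- The derivation `Y_n`. -/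
def yVF (hU : C.Over n U) : VF U := vf (yComp hU)

lemma isVF_yVF : IsVF (yVF hU) := isVF_vf _

lemma yVF_jet_zero (m : ℤ) : yVF hU (coord (.jet m 0)) = if m = n then 1 else 0 := vf_coord _ _

lemma yVF_jet_succ (m : ℤ) (k : ℕ) :
    yVF hU (coord (.jet m (k + 1))) = if m = n then velCoef hU k else 0 := vf_coord _ _

lemma yVF_jet_one (m : ℤ) :
    yVF hU (coord (.jet m 1)) = if m = n then slope hU else 0 := by
  rw [← velCoef_zero]
  exact yVF_jet_succ hU m 0

lemma yVF_vel (m : ℤ) : yVF hU (coord (.vel m)) = 0 := vf_coord _ _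

/-- This restates the recursion `velCoef_succ` for the components of Y_n: each step in the jet order
costs one D-derivative plus multiplication by A_n. -/
lemma lie_jetD_yVF : ⁅jetD U, yVF hU⁆ = -(slope hU) • yVF hU := by
  refine (isVF_jetD.lie (isVF_yVF hU)).ext ((isVF_yVF hU).smul _) fun c => ?_
  rcases c with ⟨m, _ | k⟩ | m
  · simp only [Derivation.commutator_apply, yVF_jet_zero, jetD_jet, zero_add,
      yVF_jet_one, Derivation.smul_apply]
    split_ifs <;> simp
  · simp only [Derivation.commutator_apply, yVF_jet_succ, jetD_jet, Derivation.smul_apply]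
    split_ifs
    · rw [velCoef_succ, smul_eq_mul]; ring
    · simp
  · simp [Derivation.commutator_apply, yVF_vel]

/-- The open set lies over the domain of the chain at one site only, so at the other sites the
right-hand side may fail to be analytic. Independence of the foreign velocity is therefore proved by
pure substitution. -/
lemma update_Dx_iterate (C : QLChain) {m n : ℤ} (hm : m ≠ n) (k : ℕ) (q : DynPoint) (t : ℂ) :
    (C.Dx.act)^[k] (C.f n) (Function.update q (.vel m) t) = (C.Dx.act)^[k] (C.f n) q := by
  induction k generalizing q t with
  | zero =>
    simp [f, triple, DynPoint.base, Ne.symm hm]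
  | succ k ih =>
    rw [Function.iterate_succ_apply', FormalVF.act, FormalVF.act]
    refine finsum_congr fun c => ?_
    by_cases hc : c = .vel m
    · subst hc
      simp [pderivAt, ih]
    · have h1 : C.Dx c (Function.update q (.vel m) t) = C.Dx c q := by
        cases c with
        | jet j l => simp [Dx]
        | vel j =>
          have : j ≠ m := fun h => hc (by rw [h])
          simp [Dx, f, triple, DynPoint.base, this]
      rw [h1, pderivAt, pderivAt, Function.update_of_ne hc]
      congr 2
      ext s
      rw [Function.update_comm (Ne.symm hc), ih]

lemma Xop_act (m : ℤ) (F : DynPoint → ℂ) : (Xop m).act F = pderivAt (.vel m) F := by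
  ext q
  rw [FormalVF.act, finsum_eq_single _ (.vel m)]
  · simp [Xop]
  · intro c hc
    simp [Xop, hc]

lemma Yop_apply (C : QLChain) (m : ℤ) (c : DynVar) (q : DynPoint) :
    C.Yop m c q = pderivAt (.vel m) (C.Y c) q := by
  have h : C.Y.act (Xop m c) q = 0 := by
    simp [FormalVF.act, Xop, pderivAt]
  rw [Yop, FormalVF.comm, Pi.sub_apply, h, Xop_act, sub_zero]

lemma represents_yVF : Represents (yVF hU) (C.Yop n) := by
  refine ⟨isVF_yVF hU, fun c q => ?_⟩
  rw [Yop_apply]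
  rcases c with ⟨m, _ | k⟩ | m
  · rw [yVF_jet_zero, pderivAt]
    by_cases hm : m = n
    · subst hm; simp [Y]
    · simp [Y, hm]
  · rw [yVF_jet_succ]
    by_cases hm : m = n
    · subst hm
      rw [if_pos rfl, velCoef, pd_apply]
      exact pderivAt_congr (Dx_iterate_eq hU k q.2) _
    · rw [if_neg hm, zero_apply, pderivAt]
      simp [Y, update_Dx_iterate C (Ne.symm hm)]
  · rw [yVF_vel, pderivAt]
    simp [Y]

end QLChain
end

noncomputable section

/-! ### Identities in Lie algebras of derivations -/

namespace Derivation

variable {A : Type*} [CommRing A] [Algebra ℂ A]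

lemma smul_lie' (f : A) (X Y : Derivation ℂ A A) : ⁅f • X, Y⁆ = f • ⁅X, Y⁆ - Y f • X := by
  ext F
  simp [commutator_apply]
  ring

lemma lie_smul' (f : A) (X Y : Derivation ℂ A A) : ⁅X, f • Y⁆ = f • ⁅X, Y⁆ + X f • Y := by
  ext F
  simp [commutator_apply]

variable {D Y Y' : Derivation ℂ A A} {a a' : A}

lemma lie_lie_of_eigen (hY : ⁅D, Y⁆ = -a • Y) (hY' : ⁅D, Y'⁆ = -a' • Y') :
    ⁅D, ⁅Y, Y'⁆⁆ = -(a + a') • ⁅Y, Y'⁆ + Y' a • Y - Y a' • Y' := by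
  rw [leibniz_lie, hY, hY', smul_lie', lie_smul']
  ext F
  simp
  ring

/-- Used both ways: if the last three coefficients vanish, the difference is an eigenvector of ad D;
if the difference itself vanishes, the remaining relation gives equations for `l`, `a` and `a'`. -/
lemma lie_lie_lie_sub_of_eigen (hY : ⁅D, Y⁆ = -a • Y) (hY' : ⁅D, Y'⁆ = -a' • Y') (l : A) :
    ⁅D, ⁅Y, ⁅Y, Y'⁆⁆ - l • ⁅Y, Y'⁆⁆ = -(2 * a + a') • (⁅Y, ⁅Y, Y'⁆⁆ - l • ⁅Y, Y'⁆)
      - (D l + l * a + Y a + 2 * Y a') • ⁅Y, Y'⁆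
      + (2 * Y (Y' a) - Y' (Y a) - l * Y' a) • Y - (Y (Y a') - l * Y a') • Y' := by
  rw [lie_sub, leibniz_lie D Y, lie_smul', hY, lie_lie_of_eigen hY hY', smul_lie', lie_sub, lie_add,
    lie_smul', lie_smul', lie_smul', lie_self]
  ext F
  simp [commutator_apply]
  ring

/-- The element `i` plays the role of 1/(y' - y) in a ring without division. -/
lemma map_inv_sub (X : Derivation ℂ A A) {i y y' : A} (h : i * (y' - y) = 1) :
    X i = -i ^ 2 * (X y' - X y) := by
  rw [X.leibniz_of_mul_eq_one h, map_sub, smul_eq_mul]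

@[simp] lemma map_two (X : Derivation ℂ A A) : X 2 = 0 := by
  simpa using X.map_natCast 2

variable {y y' z w i p q : A} {k₁ k₂ k₃ : ℂ}

/-- The quadratic polynomial `k₁ y² + k₂ y + k₃` in a commutative algebra. -/
def quad (k₁ k₂ k₃ : ℂ) (y : A) : A :=
  algebraMap ℂ A k₁ * y ^ 2 + algebraMap ℂ A k₂ * y + algebraMap ℂ A k₃

/-- The derivative of `quad`. -/
def quad' (k₁ k₂ : ℂ) (y : A) : A := 2 * algebraMap ℂ A k₁ * y + algebraMap ℂ A k₂

lemma map_quad (X : Derivation ℂ A A) (y : A) : X (quad k₁ k₂ k₃ y) = quad' k₁ k₂ y * X y := by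
  simp [quad, quad', leibniz_pow]
  ring

lemma map_quad' (X : Derivation ℂ A A) (y : A) :
    X (quad' k₁ k₂ y) = 2 * algebraMap ℂ A k₁ * X y := by
  simp [quad', leibniz]

lemma quad_sub (y y' : A) : quad k₁ k₂ k₃ y' = quad k₁ k₂ k₃ y + quad' k₁ k₂ y * (y' - y) +
    algebraMap ℂ A k₁ * (y' - y) ^ 2 := by
  simp only [quad, quad']
  ring

lemma map_of_eigen (hY : ⁅D, Y⁆ = -a • Y) (hy : Y y = 1) : Y (D y) = a := by
  have := congrArg (fun X => X y) hY
  simp only [commutator_apply, hy, map_one_eq_zero, smul_apply, smul_eq_mul] at this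
  linear_combination -this

lemma map_of_eigen_zero (hY : ⁅D, Y⁆ = -a • Y) (hy : Y y = 0) : Y (D y) = 0 := by
  have := congrArg (fun X => X y) hY
  simp only [commutator_apply, hy, map_zero, smul_apply, smul_eq_mul] at this
  linear_combination -this

/-- For the chain with standard coefficients the commutator `R = [Y, [Y, Y']] - λ [Y, Y']` with
`λ = 2 / (y' - y)` is an eigenvector of total differentiation. -/
lemma lie_std_pair (hY : ⁅D, Y⁆ = -a • Y) (hY' : ⁅D, Y'⁆ = -a' • Y')
    (h1 : Y y = 1) (h2 : Y y' = 0) (h3 : Y z = 0) (h4 : Y w = 0)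
    (h5 : Y' y = 0) (h6 : Y' y' = 1) (h7 : Y' z = 0)
    (hi : i * (y' - y) = 1) (hp : p * (y - z) = 1) (hq : q * (w - y') = 1)
    (ha : a = (p - i) * (D y - quad k₁ k₂ k₃ y) + quad' k₁ k₂ y)
    (ha' : a' = (i - q) * (D y' - quad k₁ k₂ k₃ y') + quad' k₁ k₂ y') :
    D (2 * i) + 2 * i * a + Y a + 2 * Y a' = 0 ∧
    ⁅D, ⁅Y, ⁅Y, Y'⁆⁆ - (2 * i) • ⁅Y, Y'⁆⁆ =
      -(2 * a + a') • (⁅Y, ⁅Y, Y'⁆⁆ - (2 * i) • ⁅Y, Y'⁆) := by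
  have hDi := D.map_inv_sub hi
  have hYi : Y i = i ^ 2 := by rw [Y.map_inv_sub hi, h1, h2]; ring
  have hY'i : Y' i = -i ^ 2 := by rw [Y'.map_inv_sub hi, h5, h6]; ring
  have hYp : Y p = -p ^ 2 := by rw [Y.map_inv_sub hp, h1, h3]; ring
  have hY'p : Y' p = 0 := by rw [Y'.map_inv_sub hp, h5, h7]; ring
  have hYq : Y q = 0 := by rw [Y.map_inv_sub hq, h2, h4]; ring
  -- With e = v_x - r(v) the eigenvalue reads (p - i)e + r'(v), and e is itself an eigenfunction: Y
  -- e = (p - i)e.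
  set e := D y - quad k₁ k₂ k₃ y with he
  set e' := D y' - quad k₁ k₂ k₃ y' with he'
  have hYe : Y e = (p - i) * e := by
    rw [he, map_sub, map_of_eigen hY h1, map_quad, h1, ha]; ring
  have hY'e : Y' e = 0 := by rw [he, map_sub, map_of_eigen_zero hY' h5, map_quad, h5]; ring
  have hYe' : Y e' = 0 := by rw [he', map_sub, map_of_eigen_zero hY h2, map_quad, h2]; ring
  have hYa : Y a = -2 * p * i * e + 2 * algebraMap ℂ A k₁ := by
    simp only [ha, map_add, leibniz, map_sub, hYe, hYp, hYi, map_quad', h1, smul_eq_mul]; ring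
  have hY'a : Y' a = i ^ 2 * e := by
    simp only [ha, map_add, leibniz, map_sub, hY'e, hY'p, hY'i, map_quad', h5, smul_eq_mul]; ring
  have hYa' : Y a' = i ^ 2 * e' := by
    simp only [ha', map_add, leibniz, map_sub, hYe', hYq, hYi, map_quad', h2, smul_eq_mul]; ring
  have hk : ∀ X : Derivation ℂ A A, X (2 * algebraMap ℂ A k₁) = 0 := fun X => by
    simp [leibniz]
  -- The cancellation rests on the exact second-order Taylor formula `quad_sub` for r between y and
  -- y'.
  have c1 : D (2 * i) + 2 * i * a + Y a + 2 * Y a' = 0 := by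
    rw [hYa, hYa', D.leibniz, hDi, map_two, ha, he', he, quad_sub y y']
    simp only [smul_eq_mul]
    linear_combination (-(2 * i * quad' k₁ k₂ y +
      2 * algebraMap ℂ A k₁ * (1 + i * (y' - y)))) * hi
  refine ⟨c1, ?_⟩
  have c2 : 2 * Y (Y' a) - Y' (Y a) - 2 * i * Y' a = 0 := by
    rw [hY'a, hYa]
    simp only [map_add, leibniz, leibniz_pow, hYe, hYi, hY'e, hY'i, hY'p, hk, map_two, map_neg,
      smul_eq_mul, nsmul_eq_mul]
    push_cast
    ring
  have c3 : Y (Y a') - 2 * i * Y a' = 0 := by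
    rw [hYa']
    simp only [leibniz, leibniz_pow, hYe', hYi, smul_eq_mul, nsmul_eq_mul]
    push_cast
    ring
  rw [lie_lie_lie_sub_of_eigen hY hY', c1, c2, c3]
  simp

variable {Y₀ Y₁ Y₂ : Derivation ℂ A A} {a₀ a₁ a₂ i₁ i₂ e t ν : A}

/-- The commutator `R = Z₈ - ν Z₅` is an eigenvector of total differentiation. -/
lemma lie_std_triple (hY₀ : ⁅D, Y₀⁆ = -a₀ • Y₀) (hY₁ : ⁅D, Y₁⁆ = -a₁ • Y₁)
    (hY₂ : ⁅D, Y₂⁆ = -a₂ • Y₂) (h20 : ⁅Y₂, Y₀⁆ = 0) (h2a0 : Y₂ a₀ = 0) (h0a2 : Y₀ a₂ = 0)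
    (h21a0 : Y₂ (Y₁ a₀) = 0) (h01a2 : Y₀ (Y₁ a₂) = 0)
    (hp : ⁅Y₁, ⁅Y₁, Y₀⁆⁆ = (-(2 * i₁)) • ⁅Y₁, Y₀⁆) (hq : ⁅Y₁, ⁅Y₁, Y₂⁆⁆ = (2 * i₂) • ⁅Y₁, Y₂⁆)
    (ha₁ : a₁ = (i₁ - i₂) * e + quad' k₁ k₂ t)
    (h0i1 : Y₀ i₁ = i₁ ^ 2) (h1i1 : Y₁ i₁ = -i₁ ^ 2) (h2i1 : Y₂ i₁ = 0)
    (h0i2 : Y₀ i₂ = 0) (h1i2 : Y₁ i₂ = i₂ ^ 2) (h2i2 : Y₂ i₂ = -i₂ ^ 2)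
    (h0e : Y₀ e = 0) (h1e : Y₁ e = (i₁ - i₂) * e) (h2e : Y₂ e = 0)
    (h0t : Y₀ t = 0) (h1t : Y₁ t = 1) (h2t : Y₂ t = 0) (hν : ν = i₂ - i₁)
    (c : D ν + ν * a₁ + Y₁ (a₀ + a₁ + a₂) = 0) :
    ⁅D, ⁅Y₁, ⁅Y₂, ⁅Y₁, Y₀⁆⁆⁆ - ν • ⁅Y₂, ⁅Y₁, Y₀⁆⁆⁆ =
      -(a₀ + 2 * a₁ + a₂) • (⁅Y₁, ⁅Y₂, ⁅Y₁, Y₀⁆⁆⁆ - ν • ⁅Y₂, ⁅Y₁, Y₀⁆⁆) := by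
  have h0a1 : Y₀ a₁ = i₁ ^ 2 * e := by
    simp only [ha₁, map_add, leibniz, map_sub, h0e, h0i1, h0i2, map_quad', h0t, smul_eq_mul]; ring
  have h2a1 : Y₂ a₁ = i₂ ^ 2 * e := by
    simp only [ha₁, map_add, leibniz, map_sub, h2e, h2i1, h2i2, map_quad', h2t, smul_eq_mul]; ring
  have h1a1 : Y₁ a₁ = -2 * i₁ * i₂ * e + 2 * algebraMap ℂ A k₁ := by
    simp only [ha₁, map_add, leibniz, map_sub, h1e, h1i1, h1i2, map_quad', h1t, smul_eq_mul]; ring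
  have h20a1 : Y₂ (i₁ ^ 2 * e) = 0 := by
    simp only [leibniz, leibniz_pow, h2i1, h2e, smul_eq_mul, smul_zero, mul_zero, add_zero]
  have h10a1 : Y₁ (i₁ ^ 2 * e) = -(i₁ + i₂) * (i₁ ^ 2 * e) := by
    simp only [leibniz, leibniz_pow, h1i1, h1e, smul_eq_mul, nsmul_eq_mul]
    push_cast
    ring
  have h12a1 : Y₁ (i₂ ^ 2 * e) = (i₁ + i₂) * (i₂ ^ 2 * e) := by
    simp only [leibniz, leibniz_pow, h1i2, h1e, smul_eq_mul, nsmul_eq_mul]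
    push_cast
    ring
  have h02a1 : Y₀ (i₂ ^ 2 * e) = 0 := by
    simp only [leibniz, leibniz_pow, h0i2, h0e, smul_eq_mul, smul_zero, mul_zero, add_zero]
  have hk : ∀ X : Derivation ℂ A A, X (2 * algebraMap ℂ A k₁) = 0 := fun X => by
    simp [leibniz]
  have h3a2 : ⁅Y₁, Y₀⁆ a₂ = 0 := by simp [commutator_apply, h0a2, h01a2]
  -- This is the coefficient of Y₁ itself in [D, [Y₁, Z₅]].
  have h5a1 : ⁅Y₂, ⁅Y₁, Y₀⁆⁆ a₁ = 0 := by
    simp only [commutator_apply, h0a1, h1a1, h2a1, h10a1, h12a1, h02a1, map_add, hk, map_sub,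
      map_zero]
    simp only [leibniz, leibniz_pow, h0i1, h2i1, h0i2, h2i2, h0e, h2e, smul_eq_mul,
      nsmul_eq_mul, map_neg, map_add, map_two, map_zero]
    push_cast
    ring
  have h3 : ⁅D, ⁅Y₁, Y₀⁆⁆ = -(a₁ + a₀) • ⁅Y₁, Y₀⁆ + Y₀ a₁ • Y₁ - Y₁ a₀ • Y₀ := by
    rw [lie_lie_of_eigen hY₁ hY₀]
  have h5 : ⁅D, ⁅Y₂, ⁅Y₁, Y₀⁆⁆⁆ = -(a₀ + a₁ + a₂) • ⁅Y₂, ⁅Y₁, Y₀⁆⁆ - (i₂ ^ 2 * e) • ⁅Y₁, Y₀⁆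
      + (i₁ ^ 2 * e) • ⁅Y₂, Y₁⁆ := by
    rw [leibniz_lie, hY₂, h3, smul_lie', lie_sub, lie_add, lie_smul', lie_smul', lie_smul', map_neg, h3a2,
      h20, h0a1, h20a1, h21a0, map_neg, map_add, h2a1, h2a0]
    ext F
    simp
    ring
  have hq' : ⁅Y₁, ⁅Y₂, Y₁⁆⁆ = (2 * i₂) • ⁅Y₂, Y₁⁆ := by
    rw [← lie_skew Y₂ Y₁, lie_neg, hq, smul_neg]
  have c' : D ν = -(ν * a₁) - Y₁ (a₀ + a₁ + a₂) := by linear_combination c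
  -- The terms with [Y₁, Y₀] carry the factor i₁ - i₂ + ν and those with [Y₂, Y₁] the factor i₂ - i₁
  -- - ν, so both disappear for ν = i₂ - i₁; the hypothesis `c` removes the terms with Z₅.
  rw [lie_sub, leibniz_lie D Y₁, lie_smul', h5, hY₁, smul_lie', map_neg, h5a1, lie_add, lie_sub, lie_smul',
    lie_smul', lie_smul', hp, hq', map_neg, h12a1, h10a1, c', hν]
  ext F
  simp
  ring

end Derivation
end

/-! ### Rescaling of vector fields by functions of one u_n -/

noncomputable section

open TopologicalSpace (Opens)

namespace AnaFun

variable {U : Opens DynPoint}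

/-- A function of the single variable `u_i`. -/
def site {h : ℂ → ℂ} {i : ℤ} (hh : ∀ q ∈ U, AnalyticAt ℂ h (q (.jet i 0))) : AnaFun U :=
  of (fun q => h (q (.jet i 0))) fun p hp =>
    LocAnalyticAt.of_analyticAt_one (.jet i 0) (hh p hp)

lemma site_apply {h : ℂ → ℂ} {i : ℤ} (hh : ∀ q ∈ U, AnalyticAt ℂ h (q (.jet i 0))) (q : U) :
    (site hh).1 q = h (q.1 (.jet i 0)) := rfl

lemma vf_site {h : ℂ → ℂ} {i : ℤ} (hh : ∀ q ∈ U, AnalyticAt ℂ h (q (.jet i 0)))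
    (Z : DynVar → AnaFun U) :
    vf Z (site hh) = Z (.jet i 0) * site fun q hq => (hh q hq).deriv := by
  rw [vf_eq_sum Z {.jet i 0}, Finset.sum_singleton]
  · congr 1
    refine eq_iff.2 fun q => ?_
    rw [site, pd_of_apply, pderivAt]
    simp [site_apply]
  · intro c hc
    have : DynVar.jet i 0 ≠ c := by simpa [eq_comm] using hc
    exact pd_of_eq_zero _ fun q t => by rw [Function.update_of_ne this]

lemma IsVF.apply_site {X : VF U} (hX : IsVF X) {h : ℂ → ℂ} {i : ℤ}
    (hh : ∀ q ∈ U, AnalyticAt ℂ h (q (.jet i 0))) :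
    X (site hh) = X (coord (.jet i 0)) * site fun q hq => (hh q hq).deriv := by
  conv_lhs => rw [hX]
  exact vf_site hh _

/-- The derivation has no components at the variables `u_n` and `u_{n,y}`. -/
def IsVertical (X : VF U) : Prop :=
  (∀ n, X (coord (.jet n 0)) = 0) ∧ ∀ n, X (coord (.vel n)) = 0

/-- The derivation has constant components at the variables `u_n` and none at the `u_{n,y}`. -/
def IsBaseConst (X : VF U) : Prop :=
  (∀ n, ∃ a : ℂ, X (coord (.jet n 0)) = algebraMap ℂ _ a) ∧ ∀ n, X (coord (.vel n)) = 0

lemma IsVertical.isBaseConst {X : VF U} (hX : IsVertical X) : IsBaseConst X :=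
  ⟨fun n => ⟨0, by rw [hX.1, map_zero]⟩, hX.2⟩

/-- Derivations kill constants. Iterated brackets of the Y_n are thereby vertical, as
`IsVF.eq_zero_of_lie_jetD` requires. -/
lemma IsBaseConst.lie {X Y : VF U} (hX : IsBaseConst X) (hY : IsBaseConst Y) :
    IsVertical ⁅X, Y⁆ := by
  refine ⟨fun n => ?_, fun n => ?_⟩
  · obtain ⟨a, ha⟩ := hX.1 n
    obtain ⟨b, hb⟩ := hY.1 n
    simp [Derivation.commutator_apply, ha, hb]
  · simp [Derivation.commutator_apply, hX.2, hY.2]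

lemma IsVertical.sub {X Y : VF U} (hX : IsVertical X) (hY : IsVertical Y) : IsVertical (X - Y) :=
  ⟨fun n => by simp [hX.1, hY.1], fun n => by simp [hX.2, hY.2]⟩

lemma IsVertical.smul (a : AnaFun U) {X : VF U} (hX : IsVertical X) : IsVertical (a • X) :=
  ⟨fun n => by simp [hX.1], fun n => by simp [hX.2]⟩

/-- Dividing by the invertible factor keeps an eigenvector of ad D an eigenvector; only the
eigenvalue changes. -/
lemma IsVF.eq_zero_of_lie_jetD_smul {R : VF U} (hR : IsVF R) (hv : IsVertical R) {F d a : AnaFun U}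
    (hd : d * F = 1) (h : ⁅jetD U, F • R⁆ = a • F • R) : R = 0 := by
  have h1 : R = d • F • R := by rw [smul_smul, hd, one_smul]
  refine hR.eq_zero_of_lie_jetD (a := (d * a + jetD U d) * F) ?_ hv.1 hv.2
  conv_lhs => rw [h1, Derivation.lie_smul', h]
  simp only [smul_smul, ← add_smul]
  congr 1
  ring

lemma lie_smul_smul {Y Y' : VF U} {f f' : AnaFun U} (h1 : Y f' = 0) (h2 : Y' f = 0) :
    ⁅f • Y, f' • Y'⁆ = (f * f') • ⁅Y, Y'⁆ := by
  rw [Derivation.smul_lie', Derivation.lie_smul', Derivation.smul_apply, h1, h2]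
  simp [smul_smul]

/-- Passage from rescaled vector fields to the original ones. -/
lemma lie_lie_eq_of_rescaled {Y Y' : VF U} (hY : IsVF Y) (hY' : IsVF Y') (hc : IsBaseConst Y)
    (hc' : IsBaseConst Y') {f f' d d' l a : AnaFun U} (h1 : Y f' = 0) (h2 : Y' f = 0)
    (h3 : ⁅Y, Y'⁆ f = 0) (hd : d * f = 1) (hd' : d' * f' = 1)
    (h : ⁅jetD U, ⁅f • Y, ⁅f • Y, f' • Y'⁆⁆ - l • ⁅f • Y, f' • Y'⁆⁆ =
      a • (⁅f • Y, ⁅f • Y, f' • Y'⁆⁆ - l • ⁅f • Y, f' • Y'⁆)) :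
    ⁅f • Y, ⁅f • Y, f' • Y'⁆⁆ = l • ⁅f • Y, f' • Y'⁆ ∧
      ⁅Y, ⁅Y, Y'⁆⁆ = (d * (l - Y f)) • ⁅Y, Y'⁆ := by
  have hW := hc.lie hc'
  -- Rescaling multiplies the double bracket by f²f' and adds Y f to the factor; `h3` ensures that
  -- [Y, Y'] does not differentiate f.
  have key : ⁅f • Y, ⁅f • Y, f' • Y'⁆⁆ - l • ⁅f • Y, f' • Y'⁆ =
      (f * f * f') • (⁅Y, ⁅Y, Y'⁆⁆ - (d * (l - Y f)) • ⁅Y, Y'⁆) := by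
    rw [lie_smul_smul h1 h2, Derivation.lie_smul', Derivation.smul_lie']
    ext1 F
    simp only [Derivation.add_apply, Derivation.sub_apply, Derivation.smul_apply, smul_eq_mul,
      Derivation.leibniz, h1, h3]
    linear_combination (f * f' * (l - Y f) * ⁅Y, Y'⁆ F) * hd
  have h0 : ⁅Y, ⁅Y, Y'⁆⁆ - (d * (l - Y f)) • ⁅Y, Y'⁆ = 0 := by
    refine IsVF.eq_zero_of_lie_jetD_smul ((hY.lie (hY.lie hY')).sub ((hY.lie hY').smul _))
      ((hc.lie hW.isBaseConst).sub (hW.smul _)) (F := f * f * f') (d := d * d * d') (a := a) ?_ ?_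
    · linear_combination d * f * d * f * hd' + d * f * hd + hd
    · rw [← key, h]
  rw [h0, smul_zero, sub_eq_zero] at key
  exact ⟨key, sub_eq_zero.1 h0⟩

/-- Passage from rescaled vector fields to the original ones. -/
lemma lie_triple_eq_of_rescaled {Y₀ Y₁ Y₂ : VF U} (hY₀ : IsVF Y₀) (hY₁ : IsVF Y₁) (hY₂ : IsVF Y₂)
    (hc₀ : IsBaseConst Y₀) (hc₁ : IsBaseConst Y₁) (hc₂ : IsBaseConst Y₂)
    {f₀ f₁ f₂ d₀ d₁ d₂ ν a : AnaFun U} (h10 : Y₁ f₀ = 0) (h01 : Y₀ f₁ = 0) (h20 : Y₂ f₀ = 0)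
    (h21 : Y₂ f₁ = 0) (h12 : Y₁ f₂ = 0) (h02 : Y₀ f₂ = 0)
    (hZ : ⁅Y₂, ⁅Y₁, Y₀⁆⁆ f₁ = 0) (hd₀ : d₀ * f₀ = 1) (hd₁ : d₁ * f₁ = 1) (hd₂ : d₂ * f₂ = 1)
    (h : ⁅jetD U, ⁅f₁ • Y₁, ⁅f₂ • Y₂, ⁅f₁ • Y₁, f₀ • Y₀⁆⁆⁆ -
        ν • ⁅f₂ • Y₂, ⁅f₁ • Y₁, f₀ • Y₀⁆⁆⁆ =
      a • (⁅f₁ • Y₁, ⁅f₂ • Y₂, ⁅f₁ • Y₁, f₀ • Y₀⁆⁆⁆ - ν • ⁅f₂ • Y₂, ⁅f₁ • Y₁, f₀ • Y₀⁆⁆)) :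
    ⁅Y₁, ⁅Y₂, ⁅Y₁, Y₀⁆⁆⁆ = (d₁ * (ν - Y₁ f₁)) • ⁅Y₂, ⁅Y₁, Y₀⁆⁆ := by
  have h3 := hc₁.lie hc₀
  have h5 := hc₂.lie h3.isBaseConst
  have h8 := hc₁.lie h5.isBaseConst
  have v5 := hY₂.lie (hY₁.lie hY₀)
  have h3f : ⁅Y₁, Y₀⁆ f₂ = 0 := by simp [Derivation.commutator_apply, h12, h02]
  have h5' : ⁅f₂ • Y₂, ⁅f₁ • Y₁, f₀ • Y₀⁆⁆ = (f₂ * (f₁ * f₀)) • ⁅Y₂, ⁅Y₁, Y₀⁆⁆ := by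
    rw [lie_smul_smul h10 h01, lie_smul_smul _ h3f]
    simp [h20, h21]
  have key : ⁅f₁ • Y₁, ⁅f₂ • Y₂, ⁅f₁ • Y₁, f₀ • Y₀⁆⁆⁆ - ν • ⁅f₂ • Y₂, ⁅f₁ • Y₁, f₀ • Y₀⁆⁆ =
      (f₁ * f₂ * (f₁ * f₀)) • (⁅Y₁, ⁅Y₂, ⁅Y₁, Y₀⁆⁆⁆ - (d₁ * (ν - Y₁ f₁)) • ⁅Y₂, ⁅Y₁, Y₀⁆⁆) := by
    rw [h5', Derivation.lie_smul', Derivation.smul_lie', hZ]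
    ext1 F
    simp only [Derivation.add_apply, Derivation.sub_apply, Derivation.smul_apply, smul_eq_mul,
      Derivation.leibniz, h12, h10]
    linear_combination (f₂ * f₁ * f₀ * (ν - Y₁ f₁) * ⁅Y₂, ⁅Y₁, Y₀⁆⁆ F) * hd₁
  refine sub_eq_zero.1 (IsVF.eq_zero_of_lie_jetD_smul ((hY₁.lie v5).sub (v5.smul _))
    (h8.sub (h5.smul _)) (F := f₁ * f₂ * (f₁ * f₀)) (d := d₁ * d₂ * (d₁ * d₀)) (a := a) ?_ ?_)
  · linear_combination d₁ * f₁ * d₁ * f₁ * d₂ * f₂ * hd₀ + d₁ * f₁ * d₁ * f₁ * hd₂ +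
      d₁ * f₁ * hd₁ + hd₁
  · rw [← key, h]

end AnaFun
end

/-! ### The bracket identities in adapted coordinates -/

noncomputable section

open TopologicalSpace (Opens)

lemma AnalyticIn.inv {S : Finset DynVar} {F : DynPoint → ℂ} {p : DynPoint}
    (hF : AnalyticIn S F p) (h0 : F p ≠ 0) : AnalyticIn S (fun q => (F q)⁻¹) p := by
  obtain ⟨h, hh, he⟩ := hF
  refine ⟨fun x => (h x)⁻¹, hh.inv ?_, he.mono fun q hq => congrArg _ hq⟩
  exact fun h => h0 (he.self_of_nhds.trans h)

lemma LocAnalyticAt.inv {F : DynPoint → ℂ} {p : DynPoint} (hF : LocAnalyticAt F p)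
    (h0 : F p ≠ 0) : LocAnalyticAt (fun q => (F q)⁻¹) p :=
  let ⟨S, hS⟩ := locAnalyticAt_iff.1 hF
  ⟨S, hS.inv h0⟩

namespace AnaFun

variable {U : Opens DynPoint}

lemma exists_mul_eq_one (F : AnaFun U) (hF : ∀ q, F.1 q ≠ 0) : ∃ G : AnaFun U, G * F = 1 := by
  refine ⟨of (fun q => (F.ext q)⁻¹) fun p hp => (F.locAnalyticAt_ext hp).inv ?_, ?_⟩
  · rw [F.ext_apply ⟨p, hp⟩]
    exact hF _
  · refine eq_iff.2 fun q => ?_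
    rw [mul_apply, of_apply, ext_apply, one_apply, inv_mul_cancel₀ (hF q)]

end AnaFun

namespace Derivation

variable {A : Type*} [CommRing A] [Algebra ℂ A] {D Y₀ Y₁ Y₂ : Derivation ℂ A A}
  {a₀ a₁ a₂ vm v₀ v₁ v₂ v₃ i₀ i₁ i₂ i₃ : A} {k₁ k₂ k₃ : ℂ}

/-- The standard chain satisfies the hypotheses of `lie_std_triple`. -/
lemma lie_std_triple_of_chart (hY₀ : ⁅D, Y₀⁆ = -a₀ • Y₀) (hY₁ : ⁅D, Y₁⁆ = -a₁ • Y₁)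
    (hY₂ : ⁅D, Y₂⁆ = -a₂ • Y₂)
    (h20' : ∀ a : A, ⁅D, ⁅Y₂, Y₀⁆⁆ = a • ⁅Y₂, Y₀⁆ → ⁅Y₂, Y₀⁆ = 0)
    (y00 : Y₀ v₀ = 1) (y01 : Y₀ v₁ = 0) (y02 : Y₀ v₂ = 0) (y03 : Y₀ v₃ = 0)
    (y10 : Y₁ v₀ = 0) (y11 : Y₁ v₁ = 1) (y12 : Y₁ v₂ = 0) (y1m : Y₁ vm = 0) (y13 : Y₁ v₃ = 0)
    (y20 : Y₂ v₀ = 0) (y21 : Y₂ v₁ = 0) (y22 : Y₂ v₂ = 1) (y2m : Y₂ vm = 0)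
    (e0 : i₀ * (v₀ - vm) = 1) (e1 : i₁ * (v₁ - v₀) = 1) (e2 : i₂ * (v₂ - v₁) = 1)
    (e3 : i₃ * (v₃ - v₂) = 1)
    (ha₀ : a₀ = (i₀ - i₁) * (D v₀ - quad k₁ k₂ k₃ v₀) + quad' k₁ k₂ v₀)
    (ha₁ : a₁ = (i₁ - i₂) * (D v₁ - quad k₁ k₂ k₃ v₁) + quad' k₁ k₂ v₁)
    (ha₂ : a₂ = (i₂ - i₃) * (D v₂ - quad k₁ k₂ k₃ v₂) + quad' k₁ k₂ v₂)
    (hp : ⁅Y₁, ⁅Y₁, Y₀⁆⁆ = (-(2 * i₁)) • ⁅Y₁, Y₀⁆) (hq : ⁅Y₁, ⁅Y₁, Y₂⁆⁆ = (2 * i₂) • ⁅Y₁, Y₂⁆)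
    (c12 : D (2 * i₂) + 2 * i₂ * a₁ + Y₁ a₁ + 2 * Y₁ a₂ = 0)
    (c10 : D (2 * -i₁) + 2 * -i₁ * a₁ + Y₁ a₁ + 2 * Y₁ a₀ = 0) :
    ⁅D, ⁅Y₁, ⁅Y₂, ⁅Y₁, Y₀⁆⁆⁆ - (i₂ - i₁) • ⁅Y₂, ⁅Y₁, Y₀⁆⁆⁆ =
      -(a₀ + 2 * a₁ + a₂) •
        (⁅Y₁, ⁅Y₂, ⁅Y₁, Y₀⁆⁆⁆ - (i₂ - i₁) • ⁅Y₂, ⁅Y₁, Y₀⁆⁆) := by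
  have h0i1 : Y₀ i₁ = i₁ ^ 2 := by rw [Y₀.map_inv_sub e1, y01, y00]; ring
  have h1i1 : Y₁ i₁ = -i₁ ^ 2 := by rw [Y₁.map_inv_sub e1, y11, y10]; ring
  have h2i1 : Y₂ i₁ = 0 := by rw [Y₂.map_inv_sub e1, y21, y20]; ring
  have h0i2 : Y₀ i₂ = 0 := by rw [Y₀.map_inv_sub e2, y02, y01]; ring
  have h1i2 : Y₁ i₂ = i₂ ^ 2 := by rw [Y₁.map_inv_sub e2, y12, y11]; ring
  have h2i2 : Y₂ i₂ = -i₂ ^ 2 := by rw [Y₂.map_inv_sub e2, y22, y21]; ring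
  have h1i0 : Y₁ i₀ = 0 := by rw [Y₁.map_inv_sub e0, y10, y1m]; ring
  have h2i0 : Y₂ i₀ = 0 := by rw [Y₂.map_inv_sub e0, y20, y2m]; ring
  have h0i3 : Y₀ i₃ = 0 := by rw [Y₀.map_inv_sub e3, y03, y02]; ring
  have h1i3 : Y₁ i₃ = 0 := by rw [Y₁.map_inv_sub e3, y13, y12]; ring
  have ne : ∀ {X : Derivation ℂ A A} {a v : A}, ⁅D, X⁆ = -a • X → X v = 0 →
      X (D v - quad k₁ k₂ k₃ v) = 0 := fun hX hv => by
    rw [map_sub, map_of_eigen_zero hX hv, map_quad, hv, mul_zero, sub_zero]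
  have se : Y₁ (D v₁ - quad k₁ k₂ k₃ v₁) = (i₁ - i₂) * (D v₁ - quad k₁ k₂ k₃ v₁) := by
    rw [map_sub, map_of_eigen hY₁ y11, map_quad, y11, ha₁]; ring
  have h1a0 : Y₁ a₀ = i₁ ^ 2 * (D v₀ - quad k₁ k₂ k₃ v₀) := by
    simp only [ha₀, map_add, leibniz, map_sub _ i₀, ne hY₁ y10, h1i0, h1i1, map_quad',
      y10, smul_eq_mul]
    ring
  have h1a2 : Y₁ a₂ = i₂ ^ 2 * (D v₂ - quad k₁ k₂ k₃ v₂) := by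
    simp only [ha₂, map_add, leibniz, map_sub _ i₂, ne hY₁ y12, h1i2, h1i3, map_quad',
      y12, smul_eq_mul]
    ring
  have h2a0 : Y₂ a₀ = 0 := by
    simp only [ha₀, map_add, leibniz, map_sub _ i₀, ne hY₂ y20, h2i0, h2i1, map_quad',
      y20, smul_eq_mul]
    ring
  have h0a2 : Y₀ a₂ = 0 := by
    simp only [ha₂, map_add, leibniz, map_sub _ i₂, ne hY₀ y02, h0i2, h0i3, map_quad',
      y02, smul_eq_mul]
    ring
  -- Sites 0 and 2 are not neighbours, so a₂ and a₀ do not see each other's field and the bracket is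
  -- an eigenvector.
  have h20 : ⁅Y₂, Y₀⁆ = 0 := by
    refine h20' (-(a₂ + a₀)) ?_
    rw [lie_lie_of_eigen hY₂ hY₀, h2a0, h0a2]
    simp
  refine lie_std_triple hY₀ hY₁ hY₂ h20 h2a0 h0a2 ?_ ?_ hp hq ha₁ h0i1 h1i1 h2i1 h0i2 h1i2 h2i2
    (ne hY₀ y01) se (ne hY₂ y21) y01 y11 y21 rfl ?_
  · rw [h1a0, leibniz, ne hY₂ y20, leibniz_pow, h2i1]
    simp
  · rw [h1a2, leibniz, ne hY₀ y02, leibniz_pow, h0i2]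
    simp
  -- The factor i₂ - i₁ is half the sum of the factors 2i₂ and -2i₁ for the pairs (Y₁, Y₂) and (Y₁,
  -- Y₀), and the condition to be proved is half the sum of theirs.
  · have h : (2 : A) * (D (i₂ - i₁) + (i₂ - i₁) * a₁ + Y₁ (a₀ + a₁ + a₂)) = 0 := by
      simp only [leibniz, map_two, map_neg, smul_eq_mul] at c12 c10
      simp only [map_add, map_sub]
      linear_combination c12 + c10
    have h2 : algebraMap ℂ A (1 / 2) * 2 = 1 := by
      rw [← map_ofNat (algebraMap ℂ A) 2, ← map_mul]
      simp
    linear_combination algebraMap ℂ A (1 / 2) * h -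
      (D (i₂ - i₁) + (i₂ - i₁) * a₁ + Y₁ (a₀ + a₁ + a₂)) * h2

end Derivation

namespace QLChain

open AnaFun

variable {C : QLChain} {U : Opens DynPoint}

lemma isBaseConst_yVF {n : ℤ} (hU : C.Over n U) : IsBaseConst (yVF hU) := by
  refine ⟨fun m => ⟨if m = n then 1 else 0, ?_⟩, yVF_vel hU⟩
  rw [yVF_jet_zero]
  split_ifs <;> simp

lemma yVF_site_self {i : ℤ} (hU : C.Over i U) {h : ℂ → ℂ}
    (hh : ∀ q ∈ U, AnalyticAt ℂ h (q (.jet i 0))) :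
    yVF hU (site hh) = site fun q hq => (hh q hq).deriv := by
  rw [(isVF_yVF hU).apply_site, yVF_jet_zero, if_pos rfl, one_mul]

lemma yVF_site_of_ne {i j : ℤ} (hij : j ≠ i) (hU : C.Over i U) {h : ℂ → ℂ}
    (hh : ∀ q ∈ U, AnalyticAt ℂ h (q (.jet j 0))) : yVF hU (site hh) = 0 := by
  rw [(isVF_yVF hU).apply_site, yVF_jet_zero, if_neg hij, zero_mul]

/-- A factor f shifts the eigenvalue by the logarithmic derivative D f / f; in new coordinates this
absorbs the second derivative produced by the substitution. -/
lemma lie_jetD_smul_yVF {i : ℤ} (hU : C.Over i U) {d f : AnaFun U} (hd : d * f = 1) :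
    ⁅jetD U, f • yVF hU⁆ = -(slope hU - d * jetD U f) • f • yVF hU := by
  rw [Derivation.lie_smul', lie_jetD_yVF]
  ext1 F
  simp only [Derivation.add_apply, Derivation.smul_apply, smul_eq_mul]
  linear_combination -(jetD U f * yVF hU F) * hd

lemma deriv_rPoly (k₁ k₂ k₃ t : ℂ) : deriv (rPoly k₁ k₂ k₃) t = k₁ * t + k₂ := by
  have h : HasDerivAt (fun s => k₁ / 2 * s ^ 2 + k₂ * s + k₃) (k₁ / 2 * (2 * t) + k₂) t := by
    simpa using (((hasDerivAt_pow 2 t).const_mul (k₁ / 2)).fun_add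
      ((hasDerivAt_id' t).const_mul k₂)).add_const k₃
  change deriv (fun s => k₁ / 2 * s ^ 2 + k₂ * s + k₃) t = _
  rw [h.deriv]
  ring

@[simp] lemma _root_.AnaFun.algebraMap_apply (a : ℂ) (q : U) :
    (algebraMap ℂ (AnaFun U) a).1 q = a := rfl

@[simp] lemma _root_.AnaFun.two_apply (q : U) : (2 : AnaFun U).1 q = 2 := rfl

@[simp] lemma _root_.AnaFun.sq_apply (F : AnaFun U) (q : U) : (F ^ 2).1 q = F.1 q ^ 2 := rfl

/-- In adapted coordinates the coefficient `A_n` has the standard form. -/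
lemma slope_sub_eq {i j k : ℤ} (hU : C.Over i U)
    {Vi Vj Vk φ : ℂ → ℂ} (hVi : ∀ q ∈ U, AnalyticAt ℂ Vi (q (.jet i 0)))
    (hVj : ∀ q ∈ U, AnalyticAt ℂ Vj (q (.jet j 0)))
    (hVk : ∀ q ∈ U, AnalyticAt ℂ Vk (q (.jet k 0)))
    (hφ : ∀ q ∈ U, AnalyticAt ℂ φ (q (.jet i 0))) {k₁ k₂ k₃ : ℂ}
    (hα : ∀ q ∈ U, C.α (triple (DynPoint.base q) i) = deriv Vi (q (.jet i 0)) *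
      (deriv φ (q (.jet i 0)) + alphaStd (Vj (q (.jet j 0)), Vi (q (.jet i 0)), Vk (q (.jet k 0)))))
    (hγ : ∀ q ∈ U, C.γ (triple (DynPoint.base q) i) =
      gammaStd k₁ k₂ k₃ (Vj (q (.jet j 0)), Vi (q (.jet i 0)), Vk (q (.jet k 0))))
    {p ι : AnaFun U} (hp : p * (site hVi - site hVk) = 1) (hι : ι * (site hVj - site hVi) = 1) :
    slope hU - (site fun q hq => (hVi q hq).deriv) * jetD U (site hφ) =
      (p - ι) * (jetD U (site hVi) - Derivation.quad (k₁ / 2) k₂ k₃ (site hVi)) +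
        Derivation.quad' (k₁ / 2) k₂ (site hVi) := by
  refine eq_iff.2 fun q => ?_
  have h1 : p.1 q = 1 / (Vi (q.1 (.jet i 0)) - Vk (q.1 (.jet k 0))) :=
    eq_one_div_of_mul_eq_one_left (eq_iff.1 hp q)
  have h2 : ι.1 q = 1 / (Vj (q.1 (.jet j 0)) - Vi (q.1 (.jet i 0))) :=
    eq_one_div_of_mul_eq_one_left (eq_iff.1 hι q)
  simp only [slope, isVF_jetD.apply_site, jetD_jet, Derivation.quad, Derivation.quad', add_apply,
    sub_apply, mul_apply, coef_apply, coord_apply, site_apply, AnaFun.algebraMap_apply,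
    AnaFun.two_apply, AnaFun.sq_apply, h1, h2, hα q q.2, hγ q q.2, gammaStd, deriv_rPoly, rPoly,
    alphaStd, zero_add]
  ring

variable {V φ : ℤ → ℂ → ℂ} {k₁ k₂ k₃ : ℂ}

/-- Both expansions, for a chain that has the standard form in suitable coordinates. -/
lemma lie_identities_of_chart (h0 : C.Over 0 U) (h1 : C.Over 1 U) (h2 : C.Over 2 U)
    (hV : ∀ i : ℤ, -1 ≤ i → i ≤ 3 → ∀ q ∈ U, AnalyticAt ℂ (V i) (q (.jet i 0)))
    (hφ : ∀ i : ℤ, 0 ≤ i → i ≤ 2 → ∀ q ∈ U, AnalyticAt ℂ (φ i) (q (.jet i 0)))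
    (hd : ∀ i : ℤ, 0 ≤ i → i ≤ 2 → ∀ q ∈ U,
      deriv (V i) (q (.jet i 0)) * φ i (q (.jet i 0)) = 1)
    (hne : ∀ i : ℤ, 0 ≤ i → i ≤ 3 → ∀ q ∈ U, V i (q (.jet i 0)) ≠ V (i - 1) (q (.jet (i - 1) 0)))
    (hα : ∀ i : ℤ, 0 ≤ i → i ≤ 2 → ∀ q ∈ U, C.α (triple (DynPoint.base q) i) =
      deriv (V i) (q (.jet i 0)) * (deriv (φ i) (q (.jet i 0)) +
        alphaStd (V (i + 1) (q (.jet (i + 1) 0)), V i (q (.jet i 0)),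
          V (i - 1) (q (.jet (i - 1) 0)))))
    (hγ : ∀ i : ℤ, 0 ≤ i → i ≤ 2 → ∀ q ∈ U, C.γ (triple (DynPoint.base q) i) =
      gammaStd k₁ k₂ k₃ (V (i + 1) (q (.jet (i + 1) 0)), V i (q (.jet i 0)),
          V (i - 1) (q (.jet (i - 1) 0)))) :
    (∃ l : AnaFun U, ⁅yVF h0, ⁅yVF h0, yVF h1⁆⁆ = l • ⁅yVF h0, yVF h1⁆) ∧
    ∃ l : AnaFun U, ⁅yVF h1, ⁅yVF h2, ⁅yVF h1, yVF h0⁆⁆⁆ = l • ⁅yVF h2, ⁅yVF h1, yVF h0⁆⁆ := by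
  have hVm := hV (-1) (by norm_num) (by norm_num)
  have hV0 := hV 0 (by norm_num) (by norm_num)
  have hV1 := hV 1 (by norm_num) (by norm_num)
  have hV2 := hV 2 (by norm_num) (by norm_num)
  have hV3 := hV 3 (by norm_num) (by norm_num)
  have hφ0 := hφ 0 (by norm_num) (by norm_num)
  have hφ1 := hφ 1 (by norm_num) (by norm_num)
  have hφ2 := hφ 2 (by norm_num) (by norm_num)
  obtain ⟨ι0, e0⟩ := exists_mul_eq_one (site hV0 - site hVm) fun q => by
    simpa [sub_eq_zero, site_apply] using hne 0 (by norm_num) (by norm_num) q q.2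
  obtain ⟨ι1, e1⟩ := exists_mul_eq_one (site hV1 - site hV0) fun q => by
    simpa [sub_eq_zero, site_apply] using hne 1 (by norm_num) (by norm_num) q q.2
  obtain ⟨ι2, e2⟩ := exists_mul_eq_one (site hV2 - site hV1) fun q => by
    simpa [sub_eq_zero, site_apply] using hne 2 (by norm_num) (by norm_num) q q.2
  obtain ⟨ι3, e3⟩ := exists_mul_eq_one (site hV3 - site hV2) fun q => by
    simpa [sub_eq_zero, site_apply] using hne 3 (by norm_num) (by norm_num) q q.2
  have s0 := slope_sub_eq h0 hV0 hV1 hVm hφ0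
    (fun q hq => hα 0 (by norm_num) (by norm_num) q hq)
    (fun q hq => hγ 0 (by norm_num) (by norm_num) q hq) e0 e1
  have s1 := slope_sub_eq h1 hV1 hV2 hV0 hφ1
    (fun q hq => hα 1 (by norm_num) (by norm_num) q hq)
    (fun q hq => hγ 1 (by norm_num) (by norm_num) q hq) e1 e2
  have s2 := slope_sub_eq h2 hV2 hV3 hV1 hφ2
    (fun q hq => hα 2 (by norm_num) (by norm_num) q hq)
    (fun q hq => hγ 2 (by norm_num) (by norm_num) q hq) e2 e3
  have d0 : (site fun q hq => (hV0 q hq).deriv) * site hφ0 = 1 :=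
    eq_iff.2 fun q => hd 0 (by norm_num) (by norm_num) q q.2
  have d1 : (site fun q hq => (hV1 q hq).deriv) * site hφ1 = 1 :=
    eq_iff.2 fun q => hd 1 (by norm_num) (by norm_num) q q.2
  have d2 : (site fun q hq => (hV2 q hq).deriv) * site hφ2 = 1 :=
    eq_iff.2 fun q => hd 2 (by norm_num) (by norm_num) q q.2
  have E0 := lie_jetD_smul_yVF h0 d0
  have E1 := lie_jetD_smul_yVF h1 d1
  have E2 := lie_jetD_smul_yVF h2 d2
  rw [s0] at E0
  rw [s1] at E1
  rw [s2] at E2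
  -- Since φ = 1/V', the rescaled field acts on the base as ∂/∂v.
  have y00 : (site hφ0 • yVF h0) (site hV0) = 1 := by
    rw [Derivation.smul_apply, yVF_site_self, smul_eq_mul, mul_comm, d0]
  have y11 : (site hφ1 • yVF h1) (site hV1) = 1 := by
    rw [Derivation.smul_apply, yVF_site_self, smul_eq_mul, mul_comm, d1]
  have y22 : (site hφ2 • yVF h2) (site hV2) = 1 := by
    rw [Derivation.smul_apply, yVF_site_self, smul_eq_mul, mul_comm, d2]
  have yne : ∀ {i j : ℤ} (_ : j ≠ i) (hU : C.Over i U) {f h : ℂ → ℂ}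
      (hf : ∀ q ∈ U, AnalyticAt ℂ f (q (.jet i 0))) (hh : ∀ q ∈ U, AnalyticAt ℂ h (q (.jet j 0))),
      (site hf • yVF hU) (site hh) = 0 := fun hij hU _ _ _ _ => by
    rw [Derivation.smul_apply, yVF_site_of_ne hij, smul_zero]
  have y0m := yne (by norm_num) h0 hφ0 hVm
  have y01 := yne (by norm_num) h0 hφ0 hV1
  have y02 := yne (by norm_num) h0 hφ0 hV2
  have y03 := yne (by norm_num) h0 hφ0 hV3
  have y1m := yne (by norm_num) h1 hφ1 hVm
  have y10 := yne (by norm_num) h1 hφ1 hV0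
  have y12 := yne (by norm_num) h1 hφ1 hV2
  have y13 := yne (by norm_num) h1 hφ1 hV3
  have y2m := yne (by norm_num) h2 hφ2 hVm
  have y20 := yne (by norm_num) h2 hφ2 hV0
  have y21 := yne (by norm_num) h2 hφ2 hV1
  have z01 : yVF h0 (site hφ1) = 0 := yVF_site_of_ne (by norm_num) _ _
  have z02 : yVF h0 (site hφ2) = 0 := yVF_site_of_ne (by norm_num) _ _
  have z10 : yVF h1 (site hφ0) = 0 := yVF_site_of_ne (by norm_num) _ _
  have z12 : yVF h1 (site hφ2) = 0 := yVF_site_of_ne (by norm_num) _ _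
  have z20 : yVF h2 (site hφ0) = 0 := yVF_site_of_ne (by norm_num) _ _
  have z21 : yVF h2 (site hφ1) = 0 := yVF_site_of_ne (by norm_num) _ _
  have B0 := isBaseConst_yVF h0
  have B1 := isBaseConst_yVF h1
  have B2 := isBaseConst_yVF h2
  have kill : ∀ {X : VF U} (_ : IsVF X) (_ : IsVertical X) {i : ℤ} {f : ℂ → ℂ}
      (hf : ∀ q ∈ U, AnalyticAt ℂ f (q (.jet i 0))), X (site hf) = 0 := fun hX hv _ _ hf => by
    rw [hX.apply_site, hv.1, zero_mul]
  have V0 := isVF_yVF h0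
  have V1 := isVF_yVF h1
  have V2 := isVF_yVF h2
  obtain ⟨-, p01⟩ := Derivation.lie_std_pair E0 E1 y00 y01 y0m y02 y10 y11 y1m e1 e0 e2 rfl rfl
  obtain ⟨c12, p12⟩ := Derivation.lie_std_pair E1 E2 y11 y12 y10 y13 y21 y22 y20 e2 e1 e3 rfl rfl
  -- The pair (Y₁, Y₀) comes from the same lemma by reversing the lattice: `alphaStd` is symmetric
  -- in u_{n+1} and u_{n-1}, and the reversal changes the sign of the inverse differences.
  obtain ⟨c10, p10⟩ := Derivation.lie_std_pair (i := -ι1) (p := -ι2) (q := -ι0) E1 E0 y11 y10 y12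
    y1m y01 y00 y02 (by linear_combination e1) (by linear_combination e2)
    (by linear_combination e0) (by ring) (by ring)
  refine ⟨⟨_, (lie_lie_eq_of_rescaled V0 V1 B0 B1 z01 z10 (kill (V0.lie V1) (B0.lie B1) _)
    d0 d1 p01).2⟩, ?_⟩
  have q12 := (lie_lie_eq_of_rescaled V1 V2 B1 B2 z12 z21 (kill (V1.lie V2) (B1.lie B2) _)
    d1 d2 p12).1
  have q10 := (lie_lie_eq_of_rescaled V1 V0 B1 B0 z10 z01 (kill (V1.lie V0) (B1.lie B0) _)
    d1 d0 p10).1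
  rw [mul_neg] at q10
  refine ⟨_, lie_triple_eq_of_rescaled V0 V1 V2 B0 B1 B2 z10 z01 z20 z21 z12 z02
    (kill (V2.lie (V1.lie V0)) (B2.lie (B1.lie B0).isBaseConst) _) d0 d1 d2
    (Derivation.lie_std_triple_of_chart E0 E1 E2 ?_ y00 y01 y02 y03 y10 y11 y12 y1m y13
      y20 y21 y22 y2m e0 e1 e2 e3 rfl rfl rfl q10 q12 c12 c10)⟩
  -- The bracket of the fields at sites 2 and 0 is an invertible multiple of the vertical field [Y₂,
  -- Y₀], so it vanishes as soon as it is an eigenvector.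
  intro a h
  rw [lie_smul_smul z20 z02] at h ⊢
  rw [IsVF.eq_zero_of_lie_jetD_smul (V2.lie V0) (B2.lie B0)
    (d := (site fun q hq => (hV2 q hq).deriv) * (site fun q hq => (hV0 q hq).deriv))
    (by linear_combination (site fun q hq => (hV2 q hq).deriv) * site hφ2 * d0 + d2) h, smul_zero]

end QLChain
end

/-! ### Sufficiency: expansions from the standard form -/

noncomputable section

open TopologicalSpace (Opens)

lemma AnalyticAt.exists_local_inverse {g : ℂ → ℂ} {v : ℂ} (hg : AnalyticAt ℂ g v)
    (hg' : deriv g v ≠ 0) : ∃ V : ℂ → ℂ, AnalyticAt ℂ V (g v) ∧ V (g v) = v ∧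
      (∀ᶠ x in 𝓝 (g v), g (V x) = x) ∧ deriv V (g v) ≠ 0 := by
  refine ⟨_, hg.analyticAt_localInverse hg', HasStrictFDerivAt.localInverse_apply_image _,
    HasStrictDerivAt.eventually_right_inverse .., ?_⟩
  rw [(hg.hasStrictDerivAt.to_localInverse hg').hasDerivAt.deriv]
  exact inv_ne_zero hg'

lemma AnalyticAt.eventually_deriv_mul_deriv {g V : ℂ → ℂ} {u : ℂ} (hV : AnalyticAt ℂ V u)
    (hg : AnalyticAt ℂ g (V u)) (h : ∀ᶠ x in 𝓝 u, g (V x) = x) :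
    ∀ᶠ x in 𝓝 u, deriv V x * deriv g (V x) = 1 := by
  have h2 : ∀ᶠ x in 𝓝 u, AnalyticAt ℂ g (V x) :=
    hV.continuousAt.eventually hg.eventually_analyticAt
  filter_upwards [h.eventually_nhds, hV.eventually_analyticAt, h2] with x hx hVx hgx
  have h3 := hgx.differentiableAt.hasDerivAt.comp x hVx.differentiableAt.hasDerivAt
  have h4 : g ∘ V =ᶠ[𝓝 x] id := hx
  have h5 := h3.deriv
  rw [h4.deriv_eq, deriv_id] at h5
  rw [mul_comm, ← h5]

namespace QLChain

open AnaFun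

variable {C : QLChain} {U : Opens DynPoint}

lemma represents_W_zero (h0 : C.Over 0 U) (h1 : C.Over 1 U) :
    Represents ⁅yVF h0, yVF h1⁆ (C.W 0) := (represents_yVF h0).comm (represents_yVF h1)

lemma represents_W_one (h0 : C.Over 0 U) (h1 : C.Over 1 U) :
    Represents ⁅yVF h0, ⁅yVF h0, yVF h1⁆⁆ (C.W 1) :=
  (represents_yVF h0).comm (represents_W_zero h0 h1)

lemma represents_Z_five (h0 : C.Over 0 U) (h1 : C.Over 1 U) (h2 : C.Over 2 U) :
    Represents ⁅yVF h2, ⁅yVF h1, yVF h0⁆⁆ (C.Z 5) := by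
  rw [Z]
  exact (represents_yVF h2).comm ((represents_yVF h1).comm (represents_yVF h0))

lemma represents_Z_eight (h0 : C.Over 0 U) (h1 : C.Over 1 U) (h2 : C.Over 2 U) :
    Represents ⁅yVF h1, ⁅yVF h2, ⁅yVF h1, yVF h0⁆⁆⁆ (C.Z 8) := by
  rw [Z]
  exact (represents_yVF h1).comm (represents_Z_five h0 h1 h2)

lemma continuousAt_triple (n : ℤ) (p : DynPoint) :
    ContinuousAt (fun q : DynPoint => triple (DynPoint.base q) n) p :=
  (continuous_apply _).continuousAt.prodMk
    ((continuous_apply _).continuousAt.prodMk (continuous_apply _).continuousAt)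

lemma eventually_over {p : DynPoint} {n : ℤ} (h : triple p.base n ∈ C.D) :
    ∀ᶠ q in 𝓝 p, triple (DynPoint.base q) n ∈ C.D :=
  (continuousAt_triple n p).eventually (C.isOpen_D.mem_nhds h)

/-- A chain that is related to a standard one by a point transformation admits both expansions. -/
theorem expandsAt_of_transformsTo {p : DynPoint} (hp : C.InDomain p.base) {g : ℤ → ℂ → ℂ}
    {v : ℤ → ℂ} {b d : ℤ → ℂ × ℂ × ℂ → ℂ} {k₁ k₂ k₃ : ℂ} (hg : IsPointTransformation g v p.base)
    (hv : ∀ n, v (n + 1) ≠ v n)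
    (hT : C.TransformsTo g v (fun _ => alphaStd) b (fun _ => gammaStd k₁ k₂ k₃) d) :
    ExpandsAt (C.W 1) ![C.W 0, C.Yop 1, C.Yop 0] p ∧
      ExpandsAt (C.Z 8) (fun i : Fin 8 => C.Z i) p := by
  choose V hVa hVv hgV hVd using fun n => (hg n).1.exists_local_inverse (hg n).2.1
  simp only [(hg _).2.2] at hVa hVv hgV
  have hcoord : ∀ n, ContinuousAt (fun q : DynPoint => q (.jet n 0)) p := fun n =>
    (continuous_apply _).continuousAt
  have hVc : ∀ n, ContinuousAt (fun q : DynPoint => V n (q (.jet n 0))) p := fun n =>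
    ContinuousAt.comp' (f := fun q : DynPoint => q (.jet n 0)) (hVa n).continuousAt (hcoord n)
  have hVp : ∀ n, V n (p (.jet n 0)) = v n := hVv
  have c1 : ∀ n, ∀ᶠ q in 𝓝 p, AnalyticAt ℂ (V n) (q (.jet n 0)) := fun n =>
    (hcoord n).eventually (hVa n).eventually_analyticAt
  have c2 : ∀ n, ∀ᶠ q in 𝓝 p, AnalyticAt ℂ (deriv (g n)) (V n (q (.jet n 0))) := fun n =>
    (hVc n).eventually (by simp only [hVp]; exact (hg n).1.deriv.eventually_analyticAt)
  have c3 : ∀ n, ∀ᶠ q in 𝓝 p,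
      deriv (V n) (q (.jet n 0)) * deriv (g n) (V n (q (.jet n 0))) = 1 := fun n =>
    (hcoord n).eventually ((hVa n).eventually_deriv_mul_deriv (by rw [hVv]; exact (hg n).1) (hgV n))
  have c4 : ∀ n, ∀ᶠ q in 𝓝 p, V n (q (.jet n 0)) ≠ V (n - 1) (q (.jet (n - 1) 0)) := fun n => by
    have h1 : v n ≠ v (n - 1) := by simpa using hv (n - 1)
    refine ((hVc n).sub (hVc (n - 1))).eventually_ne (y := 0) ?_ |>.mono fun q hq => sub_ne_zero.1 hq
    simpa [hVp, sub_ne_zero] using h1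
  have c5 : ∀ n, ∀ᶠ q in 𝓝 p, g n (V n (q (.jet n 0))) = q (.jet n 0) := fun n =>
    (hcoord n).eventually (hgV n)
  have c6 : ∀ n, ∀ᶠ q in 𝓝 p, ∀ ξ η : ℂ,
      C.rhs (triple (DynPoint.base q) n)
        (deriv (g n) (V n (q (.jet n 0))) * ξ) (deriv (g n) (V n (q (.jet n 0))) * η) =
      deriv (deriv (g n)) (V n (q (.jet n 0))) * ξ * η +
        deriv (g n) (V n (q (.jet n 0))) * (alphaStd (V (n + 1) (q (.jet (n + 1) 0)),
          V n (q (.jet n 0)), V (n - 1) (q (.jet (n - 1) 0))) * ξ * η +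
        b n (V (n + 1) (q (.jet (n + 1) 0)),
          V n (q (.jet n 0)), V (n - 1) (q (.jet (n - 1) 0))) * ξ +
        gammaStd k₁ k₂ k₃ (V (n + 1) (q (.jet (n + 1) 0)),
          V n (q (.jet n 0)), V (n - 1) (q (.jet (n - 1) 0))) * η +
        d n (V (n + 1) (q (.jet (n + 1) 0)),
          V n (q (.jet n 0)), V (n - 1) (q (.jet (n - 1) 0)))) := fun n => by
    have h1 : ContinuousAt (fun q : DynPoint => (V (n + 1) (q (.jet (n + 1) 0)),
          V n (q (.jet n 0)), V (n - 1) (q (.jet (n - 1) 0)))) p :=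
      (hVc _).prodMk ((hVc _).prodMk (hVc _))
    have h2 := h1.eventually (by simp only [hVp]; exact hT n)
    filter_upwards [h2, c5 (n + 1), c5 n, c5 (n - 1)] with q hq h3 h4 h5
    simp only [h3, h4, h5] at hq
    exact hq
  -- Only u_{-1}, …, u_3 enter A_0, A_1, A_2. Restricting to finitely many sites is essential:
  -- conditions at all sites need not hold on a neighbourhood in the product topology.
  have hI : ∀ {P : ℤ → DynPoint → Prop}, (∀ n, ∀ᶠ q in 𝓝 p, P n q) →
      ∀ᶠ q in 𝓝 p, ∀ n ∈ Set.Icc (-1 : ℤ) 3, P n q := fun h =>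
    (Set.finite_Icc (-1 : ℤ) 3).eventually_all |>.2 fun n _ => h n
  obtain ⟨T, hT1, hT2, hT3⟩ := eventually_nhds_iff.1 <| (hI fun n => eventually_over (hp n)).and <|
    (hI c1).and <| (hI c2).and <| (hI c3).and <| (hI c4).and (hI c6)
  let U : Opens DynPoint := ⟨T, hT2⟩
  have o0 : C.Over 0 U := fun q hq => (hT1 q hq).1 0 (by simp)
  have o1 : C.Over 1 U := fun q hq => (hT1 q hq).1 1 (by simp)
  have o2 : C.Over 2 U := fun q hq => (hT1 q hq).1 2 (by simp)
  have key : ∀ i : ℤ, 0 ≤ i → i ≤ 2 → ∀ q ∈ U,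
      (C.α (triple (DynPoint.base q) i) = deriv (V i) (q (.jet i 0)) *
        (deriv (fun x => deriv (g i) (V i x)) (q (.jet i 0)) +
        alphaStd (V (i + 1) (q (.jet (i + 1) 0)), V i (q (.jet i 0)),
          V (i - 1) (q (.jet (i - 1) 0))))) ∧
      C.γ (triple (DynPoint.base q) i) =
      gammaStd k₁ k₂ k₃ (V (i + 1) (q (.jet (i + 1) 0)), V i (q (.jet i 0)),
          V (i - 1) (q (.jet (i - 1) 0))) := by
    intro i hi hi' q hq
    have hmem : i ∈ Set.Icc (-1 : ℤ) 3 := ⟨by linarith, by linarith⟩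
    obtain ⟨-, a1, a2, a3, -, a6⟩ := hT1 q hq
    have b1 := a1 i hmem
    have b2 := a2 i hmem
    have b3 := a3 i hmem
    have b6 := a6 i hmem
    have b4 : deriv (fun x => deriv (g i) (V i x)) (q (.jet i 0)) =
        deriv (deriv (g i)) (V i (q (.jet i 0))) * deriv (V i) (q (.jet i 0)) :=
      (b2.differentiableAt.hasDerivAt.comp _ b1.differentiableAt.hasDerivAt).deriv
    rw [b4]
    -- Both sides are polynomials in ξ and η; their values at 0 and 1 isolate the coefficients of ξη
    -- and of η.
    have e11 := b6 1 1
    have e10 := b6 1 0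
    have e01 := b6 0 1
    have e00 := b6 0 0
    simp only [rhs] at e11 e10 e01 e00
    set G := deriv (g i) (V i (q (.jet i 0)))
    set V' := deriv (V i) (q (.jet i 0))
    constructor
    · linear_combination V' ^ 2 * (e11 - e10 - e01 + e00) -
        (C.α (triple (DynPoint.base q) i) * (V' * G + 1) - V' * alphaStd (V (i + 1) (q (.jet (i + 1) 0)),
          V i (q (.jet i 0)), V (i - 1) (q (.jet (i - 1) 0)))) * b3
    · linear_combination V' * (e01 - e00) - (C.γ (triple (DynPoint.base q) i) -
        gammaStd k₁ k₂ k₃ (V (i + 1) (q (.jet (i + 1) 0)), V i (q (.jet i 0)),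
          V (i - 1) (q (.jet (i - 1) 0)))) * b3
  obtain ⟨⟨l, hl⟩, ⟨m, hm⟩⟩ := lie_identities_of_chart (V := V)
    (φ := fun i x => deriv (g i) (V i x)) o0 o1 o2
    (fun i h1 h2 q hq => (hT1 q hq).2.1 i ⟨h1, h2⟩)
    (fun i h1 h2 q hq => AnalyticAt.fun_comp (g := deriv (g i))
      ((hT1 q hq).2.2.1 i ⟨by linarith, by linarith⟩) ((hT1 q hq).2.1 i ⟨by linarith, by linarith⟩))
    (fun i h1 h2 q hq => (hT1 q hq).2.2.2.1 i ⟨by linarith, by linarith⟩)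
    (fun i h1 h2 q hq => (hT1 q hq).2.2.2.2.1 i ⟨by linarith, by linarith⟩)
    (fun i h1 h2 q hq => (key i h1 h2 q hq).1) (fun i h1 h2 q hq => (key i h1 h2 q hq).2)
  have hpU : p ∈ U := hT3
  constructor
  -- W_2 is a multiple of W_1 alone.
  · refine ⟨![l.ext, 0, 0], fun i => ?_, ?_⟩
    · fin_cases i
      · exact l.locAnalyticAt_ext hpU
      · exact LocAnalyticAt.const 0
      · exact LocAnalyticAt.const 0
    · filter_upwards [U.isOpen.mem_nhds hpU] with q hq c
      lift q to U using hq
      simp only [Fin.sum_univ_three, Matrix.cons_val_zero, Matrix.cons_val_one, Matrix.cons_val,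
        Pi.zero_apply, zero_mul, add_zero, ext_apply]
      rw [(represents_W_one o0 o1).2, (represents_W_zero o0 o1).2, hl]
      rfl
  -- Z_8 is a multiple of Z_5 alone.
  · refine ⟨fun i => if i = 5 then m.ext else 0, fun i => ?_, ?_⟩
    · dsimp only
      split_ifs
      · exact m.locAnalyticAt_ext hpU
      · exact LocAnalyticAt.const 0
    · filter_upwards [U.isOpen.mem_nhds hpU] with q hq c
      lift q to U using hq
      rw [Finset.sum_eq_single 5 (fun i _ hi => by simp [hi]) (by simp)]
      have h5 := (represents_Z_five o0 o1 o2).2 c q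
      rw [if_pos rfl, ext_apply, (represents_Z_eight o0 o1 o2).2, hm]
      exact congrArg (m.1 q * ·) h5.symm

end QLChain
end

/-! ### Necessity: relations forced by W_2 = λ W_1 -/

noncomputable section

open TopologicalSpace (Opens)

/-- A polydisc in finitely many of the dynamical variables. -/
def polydisc (p : DynPoint) (S : Finset DynVar) (ε : ℝ) : Opens DynPoint :=
  ⟨{q | ∀ c ∈ S, q c ∈ Metric.ball (p c) ε}, by
    have : {q : DynPoint | ∀ c ∈ S, q c ∈ Metric.ball (p c) ε} =
        ⋂ c ∈ S, (fun q : DynPoint => q c) ⁻¹' Metric.ball (p c) ε := by ext; simp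
    rw [this]
    exact isOpen_biInter_finset fun c _ => Metric.isOpen_ball.preimage (continuous_apply c)⟩

lemma exists_polydisc_of_eventually {p : DynPoint} {P : DynPoint → Prop} (h : ∀ᶠ q in 𝓝 p, P q) :
    ∃ S ε, 0 < ε ∧ ∀ q ∈ polydisc p S ε, P q := by
  rw [nhds_pi, Filter.Eventually, Filter.mem_pi] at h
  obtain ⟨I, hI, t, ht, hsub⟩ := h
  have : ∀ c, ∃ ε > 0, Metric.ball (p c) ε ⊆ t c := fun c => Metric.mem_nhds_iff.1 (ht c)
  choose ε hε hball using this
  by_cases hne : hI.toFinset.Nonempty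
  · refine ⟨hI.toFinset, hI.toFinset.inf' hne ε, (Finset.lt_inf'_iff hne).2 fun c _ => hε c, ?_⟩
    intro q hq
    refine hsub fun c hc => hball c ?_
    exact Metric.ball_subset_ball (Finset.inf'_le _ (hI.mem_toFinset.2 hc))
      (hq c (hI.mem_toFinset.2 hc))
  · refine ⟨∅, 1, one_pos, fun q _ => hsub fun c hc => ?_⟩
    exact absurd ⟨c, hI.mem_toFinset.2 hc⟩ hne

namespace AnaFun

variable {p : DynPoint} {S : Finset DynVar} {ε : ℝ}

/-- A coordinate slice of a polydisc is a disc or the whole plane, hence connected; on a general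
open set a vanishing derivative would give only local constancy. -/
lemma ext_update_of_pd_eq_zero {F : AnaFun (polydisc p S ε)} {c : DynVar} (hF : pd c F = 0)
    {q : DynPoint} (hq : q ∈ polydisc p S ε) {t : ℂ}
    (ht : Function.update q c t ∈ polydisc p S ε) : F.ext (Function.update q c t) = F.ext q := by
  set s : Set ℂ := {r | c ∈ S → r ∈ Metric.ball (p c) ε} with hs
  have hs' : ∀ r, r ∈ s → Function.update q c r ∈ polydisc p S ε := by
    intro r hr d hd
    by_cases h : d = c
    · subst h; simpa using hr hd
    · simpa [h] using hq d hd
  have hopen : IsOpen s := by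
    by_cases h : c ∈ S
    · simpa only [hs, h, true_imp_iff, Set.ofPred_mem_eq] using Metric.isOpen_ball (x := p c) (ε := ε)
    · simp [hs, h]
  have hconn : IsPreconnected s := by
    by_cases h : c ∈ S
    · simpa only [hs, h, true_imp_iff, Set.ofPred_mem_eq] using (convex_ball (p c) ε).isPreconnected
    · simpa [hs, h] using isPreconnected_univ
  have hder : ∀ r ∈ s, HasDerivAt (fun x => F.ext (Function.update q c x)) 0 r := by
    intro r hr
    have h1 := (F.locAnalyticAt_ext (hs' r hr)).hasDerivAt_slice c
    have h2 := pd_apply c F ⟨_, hs' r hr⟩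
    rw [hF, zero_apply] at h2
    simpa [← h2] using h1
  have hconst := hopen.is_const_of_deriv_eq_zero hconn
    (fun r hr => (hder r hr).differentiableAt.differentiableWithinAt) (fun r hr => (hder r hr).deriv)
    (show t ∈ s from fun hc => by simpa using ht c hc) (show q c ∈ s from fun hc => hq c hc)
  simpa using hconst

end AnaFun

/-- Partial derivative with respect to the first of two variables. -/
def d₁ (L : ℂ × ℂ → ℂ) (z : ℂ × ℂ) : ℂ := deriv (fun a => L (a, z.2)) z.1

/-- Partial derivative with respect to the second of two variables. -/
def d₂ (L : ℂ × ℂ → ℂ) (z : ℂ × ℂ) : ℂ := deriv (fun a => L (z.1, a)) z.2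

namespace QLChain

open AnaFun

variable {C : QLChain} {U : Opens DynPoint}

section YCoef

variable {n m : ℤ} {h : ℂ × ℂ × ℂ → ℂ} (hh : AnalyticOnNhd ℂ h C.D)

lemma yVF_coef_self (hn hn' : C.Over n U) : yVF hn (coef hh hn') = coef hh.dY hn' := by
  rw [yVF, vf_coef]
  simp [yComp]

lemma yVF_coef_succ (hm : C.Over m U) (hn : C.Over n U) (hmn : m = n + 1) :
    yVF hm (coef hh hn) = coef hh.dX hn := by
  subst hmn
  rw [yVF, vf_coef]
  have h1 : n - 1 ≠ n + 1 := by omega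
  simp [yComp, h1]

lemma yVF_coef_pred (hm : C.Over m U) (hn : C.Over n U) (hmn : m = n - 1) :
    yVF hm (coef hh hn) = coef hh.dZ hn := by
  subst hmn
  rw [yVF, vf_coef]
  have h1 : n ≠ n - 1 := by omega
  have h2 : n + 1 ≠ n - 1 := by omega
  simp [yComp, h1, h2]

end YCoef

/-- A function of three variables that does not vanish identically on the domain of the chain
does not vanish near any point. -/
lemma not_eventually_zero {h : ℂ × ℂ × ℂ → ℂ} (hh : AnalyticOnNhd ℂ h C.D)
    (hz : ∃ z ∈ C.D, h z ≠ 0) {z : ℂ × ℂ × ℂ} (hzD : z ∈ C.D) : ¬ ∀ᶠ y in 𝓝 z, h y = 0 := by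
  intro hev
  obtain ⟨w, hw, hne⟩ := hz
  exact hne (hh.eqOn_zero_of_preconnected_of_eventuallyEq_zero C.isConnected_D.isPreconnected
    hzD hev hw)

/-- Where `F` is nonzero the other factor vanishes nearby; its derivative in u_{n,x} is `h`, which
would then vanish near a triple of D and, by the identity theorem, everywhere. This is where
nondegeneracy enters. -/
lemma coef_cancel {n : ℤ} (hn : C.Over n U) {h k : ℂ × ℂ × ℂ → ℂ} (hh : AnalyticOnNhd ℂ h C.D)
    (hk : AnalyticOnNhd ℂ k C.D) (hz : ∃ z ∈ C.D, h z ≠ 0) {F : AnaFun U}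
    (hF : F * (coef hh hn * coord (.jet n 1) + coef hk hn) = 0) : F = 0 := by
  refine eq_iff.2 fun q => ?_
  by_contra hne
  have h1 : ∀ᶠ r in 𝓝 q.1, F.ext r ≠ 0 := by
    refine (F.locAnalyticAt_ext q.2).continuousAt.eventually_ne ?_
    rwa [ext_apply]
  set b := coef hh hn * coord (.jet n 1) + coef hk hn with hb
  have h2 : ∀ᶠ r in 𝓝 q.1, b.ext r = 0 := by
    filter_upwards [h1, U.isOpen.mem_nhds q.2] with r hr hrU
    lift r to U using hrU
    rw [ext_apply] at hr ⊢
    exact (mul_eq_zero.1 (eq_iff.1 hF r)).resolve_left hr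
  have h3 : pd (.jet n 1) b = coef hh hn := by
    simp [hb, pd_coord, pd_coef_of_ne]
  have h4 : ∀ᶠ r in 𝓝 q.1, h (triple (DynPoint.base r) n) = 0 := by
    filter_upwards [h2.eventually_nhds, U.isOpen.mem_nhds q.2] with r hr hrU
    lift r to U using hrU
    rw [← coef_apply hh hn, ← h3, pd_apply, pderivAt_congr (G := fun _ => 0) hr]
    simp [pderivAt]
  refine not_eventually_zero hh hz (hn q q.2) ?_
  have h5 : n - 1 ≠ n + 1 := by omega
  have h6 : n ≠ n - 1 := by omega
  have hc : Continuous fun z : ℂ × ℂ × ℂ => Function.update (Function.update (Function.update q.1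
      (.jet (n + 1) 0) z.1) (.jet n 0) z.2.1) (.jet (n - 1) 0) z.2.2 := by fun_prop
  have h7 := hc.tendsto (triple (DynPoint.base q.1) n)
  have h8 : (fun z : ℂ × ℂ × ℂ => Function.update (Function.update (Function.update q.1
      (.jet (n + 1) 0) z.1) (.jet n 0) z.2.1) (.jet (n - 1) 0) z.2.2)
      (triple (DynPoint.base q.1) n) = q.1 := by
    simp [triple, DynPoint.base]
  dsimp only at h8
  rw [h8] at h7
  filter_upwards [h7.eventually h4] with z hz
  simpa [triple, DynPoint.base, Function.update_apply, h5, h6, h5.symm, h6.symm] using hz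

/-- The relations between the coefficients of the chain and the coefficient of the first
expansion. -/
lemma relations_of_lie (hC : C.Nondegenerate) (h0 : C.Over 0 U) (h1 : C.Over 1 U) {l : AnaFun U}
    (hl : ⁅yVF h0, ⁅yVF h0, yVF h1⁆⁆ = l • ⁅yVF h0, yVF h1⁆) :
    (∀ c, c ≠ .jet 0 0 → c ≠ .jet 1 0 → pd c l = 0) ∧
    pd (.jet 1 0) l + 2 * coef C.analytic_α.dZ h1 = 0 ∧
    pd (.jet 0 0) l + l * coef C.analytic_α h0 + coef C.analytic_α.dY h0 +
      coef C.analytic_α h0 ^ 2 = 0 ∧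
    l * coef C.analytic_γ h0 + coef C.analytic_γ.dY h0 +
      coef C.analytic_α h0 * coef C.analytic_γ h0 + 2 * coef C.analytic_γ.dZ h1 = 0 ∧
    coef C.analytic_α.dZ.dZ h1 = l * coef C.analytic_α.dZ h1 ∧
    coef C.analytic_γ.dZ.dZ h1 = l * coef C.analytic_γ.dZ h1 := by
  have hk := Derivation.lie_lie_lie_sub_of_eigen (lie_jetD_yVF h0) (lie_jetD_yVF h1) l
  rw [sub_eq_zero.2 hl, lie_zero, smul_zero, zero_sub] at hk
  -- [Y_0, Y_1] has no component at u_0 or u_1, so these isolate the coefficients of Y_0 and Y_1;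
  -- the component at u_{1,x} gives the coefficient of [Y_0, Y_1].
  have e00 := congrArg (fun X => X (coord (.jet 0 0))) hk
  have e10 := congrArg (fun X => X (coord (.jet 1 0))) hk
  have e11 := congrArg (fun X => X (coord (.jet 1 1))) hk
  simp only [Derivation.zero_apply, Derivation.add_apply, Derivation.sub_apply,
    Derivation.smul_apply, Derivation.neg_apply, Derivation.commutator_apply, yVF_jet_zero,
    yVF_jet_one, smul_eq_mul, if_true, one_ne_zero, zero_ne_one, if_false, map_zero,
    Derivation.map_one_eq_zero, mul_zero, mul_one, sub_zero, add_zero, zero_add, neg_zero,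
    zero_sub] at e00 e10 e11
  have hb : yVF h0 (slope h1) =
      coef C.analytic_α.dZ h1 * coord (.jet 1 1) + coef C.analytic_γ.dZ h1 := by
    simp [slope, yVF_coef_pred _ h0 h1, yVF_jet_one, mul_comm]
  have ha : yVF h1 (slope h0) =
      coef C.analytic_α.dX h0 * coord (.jet 0 1) + coef C.analytic_γ.dX h0 := by
    simp [slope, yVF_coef_succ _ h1 h0, yVF_jet_one, mul_comm]
  have hYb : yVF h0 (coef C.analytic_α.dZ h1 * coord (.jet 1 1) + coef C.analytic_γ.dZ h1) =
      coef C.analytic_α.dZ.dZ h1 * coord (.jet 1 1) + coef C.analytic_γ.dZ.dZ h1 := by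
    simp [yVF_coef_pred _ h0 h1, yVF_jet_one, mul_comm]
  have hYA : yVF h0 (slope h0) = coef C.analytic_α.dY h0 * coord (.jet 0 1) +
      coef C.analytic_α h0 * slope h0 + coef C.analytic_γ.dY h0 := by
    simp [slope, yVF_coef_self, yVF_jet_one]
    ring
  rw [hb, hYb] at e10
  have f1 : coef C.analytic_α.dZ.dZ h1 * coord (.jet 1 1) + coef C.analytic_γ.dZ.dZ h1 =
      l * (coef C.analytic_α.dZ h1 * coord (.jet 1 1) + coef C.analytic_γ.dZ h1) := by
    linear_combination e10
  have f2 : jetD U l + l * slope h0 + yVF h0 (slope h0) + 2 * yVF h0 (slope h1) = 0 := by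
    rw [hb, hYb] at e11
    refine coef_cancel h1 C.analytic_α.dZ C.analytic_γ.dZ hC.2 ?_
    rw [hb]
    linear_combination e11 - slope h1 * f1
  -- The component at u_1 shows that l depends on u_0, u_1, u_2, u_{1,x} only, and below the
  -- component at u_0 restricts it to u_{-1}, u_0, u_1, u_{0,x}. What is common to both is u_0, u_1.
  have g1 : ∀ c, c ≠ .jet 0 0 → c ≠ .jet 1 0 → c ≠ .jet 2 0 → c ≠ .jet 1 1 → pd c l = 0 := by
    intro c c0 c1 c2 c3
    refine coef_cancel h1 C.analytic_α.dZ C.analytic_γ.dZ hC.2 ?_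
    have := congrArg (pd c) f1
    simp [pd_coef_of_ne, c0, c1, c2, c3, pd_coord] at this
    linear_combination -this
  have g2 : ∀ c, c ≠ .jet (-1) 0 → c ≠ .jet 0 0 → c ≠ .jet 1 0 → c ≠ .jet 0 1 → pd c l = 0 := by
    intro c c0 c1 c2 c3
    refine coef_cancel h0 C.analytic_α.dX C.analytic_γ.dX hC.1 ?_
    rw [ha, hYA] at e00
    have h2 : yVF h0 (coef C.analytic_α.dX h0 * coord (.jet 0 1) + coef C.analytic_γ.dX h0) =
      coef C.analytic_α.dX.dY h0 * coord (.jet 0 1) + coef C.analytic_α.dX h0 * slope h0 +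
        coef C.analytic_γ.dX.dY h0 := by
      simp [yVF_coef_self, yVF_jet_one]
      ring
    rw [h2, map_add, map_add, Derivation.leibniz, Derivation.leibniz, ha] at e00
    simp only [yVF_coef_succ _ h1 h0 (zero_add (1 : ℤ)).symm, yVF_jet_one, zero_ne_one,
      if_false] at e00
    have := congrArg (pd c) e00
    simp [pd_coef_of_ne, c0, c1, c2, c3, pd_coord, slope] at this
    linear_combination this
  have g : ∀ c, c ≠ .jet 0 0 → c ≠ .jet 1 0 → pd c l = 0 := by
    intro c c0 c1
    by_cases c2 : c = .jet 2 0 ∨ c = .jet 1 1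
    · rcases c2 with rfl | rfl <;> exact g2 _ (by simp) (by simp) (by simp) (by simp)
    · exact g1 c c0 c1 (fun h => c2 (Or.inl h)) (fun h => c2 (Or.inr h))
  have hD : jetD U l = coord (.jet 0 1) * pd (.jet 0 0) l + coord (.jet 1 1) * pd (.jet 1 0) l := by
    rw [jetD, vf_eq_sum _ {.jet 0 0, .jet 1 0}]
    · rw [Finset.sum_insert (by simp), Finset.sum_singleton]
      rfl
    · intro c hc
      simp only [Finset.mem_insert, Finset.mem_singleton, not_or] at hc
      exact g c hc.1 hc.2
  -- The relation is now affine in u_{0,x} and u_{1,x}, with coefficients free of both, and splits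
  -- into three.
  rw [hD, hYA, hb, slope] at f2
  have t1 : pd (.jet 1 0) l + 2 * coef C.analytic_α.dZ h1 = 0 := by
    have := congrArg (pd (.jet 1 1)) f2
    simpa [pd_coef_of_ne, pd_coord, g, pd_comm (.jet 1 1)] using this
  have t2 : pd (.jet 0 0) l + l * coef C.analytic_α h0 + coef C.analytic_α.dY h0 +
      coef C.analytic_α h0 ^ 2 = 0 := by
    have := congrArg (pd (.jet 0 1)) f2
    simp [pd_coef_of_ne, pd_coord, g, pd_comm (.jet 0 1)] at this
    linear_combination this
  have t4 : coef C.analytic_α.dZ.dZ h1 = l * coef C.analytic_α.dZ h1 := by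
    have := congrArg (pd (.jet 1 1)) f1
    simpa [pd_coef_of_ne, pd_coord, g] using this
  exact ⟨g, t1, t2, by linear_combination f2 - coord (.jet 0 1) * t2 - coord (.jet 1 1) * t1, t4,
    by linear_combination f1 - coord (.jet 1 1) * t4⟩

end QLChain
end

/-! ### The relations as differential equations in the u_n -/

noncomputable section

open TopologicalSpace (Opens)

lemma LocAnalyticAt.analyticAt_update₂ {F : DynPoint → ℂ} {p : DynPoint} (hF : LocAnalyticAt F p)
    {a b : DynVar} (hab : a ≠ b) : AnalyticAt ℂ
      (fun z : ℂ × ℂ => F (Function.update (Function.update p a z.1) b z.2)) (p a, p b) := by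
  obtain ⟨S, h, hh, he⟩ := hF
  have hc : Continuous fun z : ℂ × ℂ => Function.update (Function.update p a z.1) b z.2 := by
    fun_prop
  have h0 := hc.tendsto (p a, p b)
  simp only [Function.update_eq_self] at h0
  have h1 : AnalyticAt ℂ (fun (z : ℂ × ℂ) (c : S) =>
      Function.update (Function.update p a z.1) b z.2 c) (p a, p b) := by
    refine AnalyticAt.pi fun c => ?_
    by_cases hb : (c : DynVar) = b
    · simpa [hb] using analyticAt_snd
    · by_cases ha : (c : DynVar) = a
      · simpa [ha, hab] using analyticAt_fst
      · simpa [ha, hb] using analyticAt_const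
  have h2 : AnalyticAt ℂ h
      ((fun (z : ℂ × ℂ) (c : S) => Function.update (Function.update p a z.1) b z.2 c)
        (p a, p b)) := by
    simpa using hh
  exact (AnalyticAt.fun_comp h2 h1).congr ((h0.eventually he).mono fun z hz => hz.symm)

namespace QLChain

open AnaFun

variable {C : QLChain} {U : Opens DynPoint}

/-- In the first expansion the coefficients of `Y_1` and `Y_0` vanish. -/
lemma lie_lie_eq_of_expansion (h0 : C.Over 0 U) (h1 : C.Over 1 U) {a : Fin 3 → DynPoint → ℂ}
    (ha : ∀ i, ∀ q ∈ U, LocAnalyticAt (a i) q)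
    (hexp : ∀ q ∈ U, ∀ c, C.W 1 c q = ∑ i, a i q * (![C.W 0, C.Yop 1, C.Yop 0] i) c q) :
    ⁅yVF h0, ⁅yVF h0, yVF h1⁆⁆ = of (a 0) (ha 0) • ⁅yVF h0, yVF h1⁆ := by
  have h : ∀ c, ⁅yVF h0, ⁅yVF h0, yVF h1⁆⁆ (coord c) =
      of (a 0) (ha 0) * ⁅yVF h0, yVF h1⁆ (coord c) + of (a 1) (ha 1) * yVF h1 (coord c) +
        of (a 2) (ha 2) * yVF h0 (coord c) := by
    refine fun c => eq_iff.2 fun q => ?_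
    have := hexp q q.2 c
    rw [(represents_W_one h0 h1).2, Fin.sum_univ_three] at this
    simp only [Matrix.cons_val_zero, Matrix.cons_val_one, Matrix.cons_val,
      (represents_W_zero h0 h1).2, (represents_yVF h0).2, (represents_yVF h1).2] at this
    exact this
  -- The base components of W_2 and W_1 vanish, so those at u_1 and u_0 are just the coefficients of
  -- Y_1 and Y_0.
  have e1 := h (.jet 1 0)
  have e0 := h (.jet 0 0)
  simp only [Derivation.commutator_apply, yVF_jet_zero, if_true, one_ne_zero, zero_ne_one,
    if_false, map_zero, Derivation.map_one_eq_zero, mul_zero, mul_one, sub_zero, add_zero,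
    zero_add] at e0 e1
  refine ((isVF_yVF h0).lie ((isVF_yVF h0).lie (isVF_yVF h1))).ext
    (((isVF_yVF h0).lie (isVF_yVF h1)).smul _) fun c => ?_
  rw [h c, ← e0, ← e1]
  simp

/-- The differential equations that the first expansion at the site `k` imposes on the
coefficients of the chain. -/
theorem exists_relations (hC : C.Nondegenerate) (hF : C.FirstExpansion) {u : ℤ → ℂ}
    (hu : C.InDomain u) (k : ℤ) : ∃ L : ℂ × ℂ → ℂ, AnalyticAt ℂ L (u k, u (k + 1)) ∧
      ∀ᶠ q : ℂ × ℂ × ℂ × ℂ in 𝓝 (u (k + 1 + 1), u (k + 1), u k, u (k - 1)),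
        d₂ L (q.2.2.1, q.2.1) = -2 * dZ C.α (q.1, q.2.1, q.2.2.1) ∧
        dZ (dZ C.α) (q.1, q.2.1, q.2.2.1) =
          L (q.2.2.1, q.2.1) * dZ C.α (q.1, q.2.1, q.2.2.1) ∧
        dZ (dZ C.γ) (q.1, q.2.1, q.2.2.1) =
          L (q.2.2.1, q.2.1) * dZ C.γ (q.1, q.2.1, q.2.2.1) ∧
        d₁ L (q.2.2.1, q.2.1) + L (q.2.2.1, q.2.1) * C.α q.2 + dY C.α q.2 + C.α q.2 ^ 2 = 0 ∧
        L (q.2.2.1, q.2.1) * C.γ q.2 + dY C.γ q.2 + C.α q.2 * C.γ q.2 +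
          2 * dZ C.γ (q.1, q.2.1, q.2.2.1) = 0 := by
  -- The coefficients do not depend on n, so the expansion for sites 0 and 1 at a shifted point
  -- yields the relations at site `k`. The higher jets and the velocities are irrelevant and set to
  -- 0.
  let p : DynPoint := fun | .jet m 0 => u (k + m) | _ => 0
  have hp : C.InDomain p.base := fun n => by
    simpa [triple, DynPoint.base, p, add_assoc, add_sub_assoc] using hu (k + n)
  obtain ⟨a, ha, hexp⟩ := hF p hp
  have hev := (eventually_all.2 fun i => (ha i).eventually).and <| hexp.and <|
    (eventually_over (hp 0)).and (eventually_over (hp 1))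
  obtain ⟨S, ε, hε, hU⟩ := exists_polydisc_of_eventually hev
  set U := polydisc p S ε
  have hpU : p ∈ U := fun c _ => Metric.mem_ball_self hε
  have h0 : C.Over 0 U := fun q hq => (hU q hq).2.2.1
  have h1 : C.Over 1 U := fun q hq => (hU q hq).2.2.2
  have hl := lie_lie_eq_of_expansion h0 h1 (fun i q hq => (hU q hq).1 i) fun q hq => (hU q hq).2.1
  set l : AnaFun U := of (a 0) fun q hq => (hU q hq).1 0
  obtain ⟨r1, r2, r3, r4, r5, r6⟩ := relations_of_lie hC h0 h1 hl
  let Ψ : ℂ × ℂ → DynPoint := fun z => Function.update (Function.update p (.jet 0 0) z.1)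
    (.jet 1 0) z.2
  have hL := (l.locAnalyticAt_ext hpU).analyticAt_update₂ (a := .jet 0 0) (b := .jet 1 0) (by simp)
  have e0 : p (.jet 0 0) = u k := by simp [p]
  have e1 : p (.jet 1 0) = u (k + 1) := by simp [p]
  have e2 : p (.jet 2 0) = u (k + 1 + 1) := by simp [p, add_assoc]
  have em : p (.jet (-1) 0) = u (k - 1) := by simp [p, sub_eq_add_neg]
  rw [e0, e1] at hL
  refine ⟨fun z => l.ext (Ψ z), hL, ?_⟩
  -- The variables u_2 and u_{-1} are moved one after the other, staying in the polydisc, so that l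
  -- and its derivatives keep the values they have with these two frozen.
  let Φ₂ : ℂ × ℂ × ℂ × ℂ → DynPoint := fun q => Ψ (q.2.2.1, q.2.1)
  let Φ₃ : ℂ × ℂ × ℂ × ℂ → DynPoint := fun q => Function.update (Φ₂ q) (.jet 2 0) q.1
  let Φ : ℂ × ℂ × ℂ × ℂ → DynPoint := fun q => Function.update (Φ₃ q) (.jet (-1) 0) q.2.2.2
  have c2 : Continuous Φ₂ := by fun_prop
  have c3 : Continuous Φ₃ := by fun_prop
  have c4 : Continuous Φ := by fun_prop
  have b2 : Φ₂ (u (k + 1 + 1), u (k + 1), u k, u (k - 1)) = p := by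
    simp [Φ₂, Ψ, ← e0, ← e1]
  have b3 : Φ₃ (u (k + 1 + 1), u (k + 1), u k, u (k - 1)) = p := by
    simp only [Φ₃, b2]
    rw [← e2, Function.update_eq_self]
  have b4 : Φ (u (k + 1 + 1), u (k + 1), u k, u (k - 1)) = p := by
    simp only [Φ, b3]
    rw [← em, Function.update_eq_self]
  filter_upwards [(c2.tendsto' _ _ b2).eventually (U.isOpen.mem_nhds hpU),
    (c3.tendsto' _ _ b3).eventually (U.isOpen.mem_nhds hpU),
    (c4.tendsto' _ _ b4).eventually (U.isOpen.mem_nhds hpU)] with q m2 m3 m4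
  have key : ∀ F : AnaFun U, (∀ c, c ≠ .jet 0 0 → c ≠ .jet 1 0 → pd c F = 0) →
      F.1 ⟨Φ q, m4⟩ = F.ext (Φ₂ q) := by
    intro F hF
    rw [← ext_apply]
    exact (ext_update_of_pd_eq_zero (hF _ (by simp) (by simp)) m3 m4).trans
      (ext_update_of_pd_eq_zero (hF _ (by simp) (by simp)) m2 m3)
  have t0 : triple (DynPoint.base (Φ q)) 0 = q.2 := by
    simp [triple, DynPoint.base, Φ, Φ₃, Φ₂, Ψ]
  have t1 : triple (DynPoint.base (Φ q)) 1 = (q.1, q.2.1, q.2.2.1) := by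
    simp [triple, DynPoint.base, Φ, Φ₃, Φ₂, Ψ]
  have k0 := key l r1
  have k1 := key (pd (.jet 1 0) l) fun c h h' => by rw [pd_comm, r1 c h h', map_zero]
  have k2 := key (pd (.jet 0 0) l) fun c h h' => by rw [pd_comm, r1 c h h', map_zero]
  have d2 : d₂ (fun z => l.ext (Ψ z)) (q.2.2.1, q.2.1) = (pd (.jet 1 0) l).ext (Φ₂ q) := by
    rw [ext_apply _ ⟨_, m2⟩, pd_apply]
    simp [d₂, pderivAt, Ψ]
  have d1 : d₁ (fun z => l.ext (Ψ z)) (q.2.2.1, q.2.1) = (pd (.jet 0 0) l).ext (Φ₂ q) := by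
    rw [ext_apply _ ⟨_, m2⟩, pd_apply]
    have : ∀ t, Function.update (Ψ (q.2.2.1, q.2.1)) (.jet 0 0) t = Ψ (t, q.2.1) := fun t => by
      simp only [Ψ]
      rw [Function.update_comm (by simp), Function.update_idem]
    have hy : Φ₂ q (.jet 0 0) = q.2.2.1 := by simp [Φ₂, Ψ]
    change deriv (fun a => l.ext (Ψ (a, q.2.1))) q.2.2.1 =
      deriv (fun t => l.ext (Function.update (Ψ (q.2.2.1, q.2.1)) (.jet 0 0) t)) (Φ₂ q (.jet 0 0))
    simp only [hy, this]
  rw [d1, d2, ← k1, ← k2]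
  have s2 := eq_iff.1 r2 ⟨Φ q, m4⟩
  have s3 := eq_iff.1 r3 ⟨Φ q, m4⟩
  have s4 := eq_iff.1 r4 ⟨Φ q, m4⟩
  have s5 := eq_iff.1 r5 ⟨Φ q, m4⟩
  have s6 := eq_iff.1 r6 ⟨Φ q, m4⟩
  simp only [AnaFun.add_apply, mul_apply, AnaFun.zero_apply, sq_apply, two_apply,
    coef_apply, t0, t1, k0]
    at s2 s3 s4 s5 s6
  refine ⟨?_, s5, s6, s3, s4⟩
  linear_combination s2

end QLChain
end

noncomputable section

open Metric

/-! ### Calculus on discs -/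

lemma eq_of_hasDerivAt_zero {f : ℂ → ℂ} {a : ℂ} {r : ℝ} (h : ∀ x ∈ ball a r, HasDerivAt f 0 x)
    {x y : ℂ} (hx : x ∈ ball a r) (hy : y ∈ ball a r) : f x = f y :=
  isOpen_ball.is_const_of_deriv_eq_zero (convex_ball a r).isPreconnected
    (fun z hz => (h z hz).differentiableAt.differentiableWithinAt) (fun z hz => (h z hz).deriv) hx hy

/-- A solution of a homogeneous linear differential equation on a disc that vanishes at a point
vanishes identically. -/
lemma eq_zero_of_hasDerivAt_mul {f c : ℂ → ℂ} {a : ℂ} {r : ℝ}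
    (hf : ∀ x ∈ ball a r, HasDerivAt f (c x * f x) x) (hc : DifferentiableOn ℂ c (ball a r))
    {y : ℂ} (hy : y ∈ ball a r) (h0 : f y = 0) : ∀ x ∈ ball a r, f x = 0 := by
  obtain ⟨P, hP⟩ := hc.isExactOn_ball
  intro x hx
  have h1 : ∀ z ∈ ball a r, HasDerivAt (fun z => f z * Complex.exp (-P z)) 0 z := by
    intro z hz
    refine ((hf z hz).mul (hP z hz).neg.cexp).congr_deriv ?_
    ring
  have h2 := eq_of_hasDerivAt_zero h1 hx hy
  simpa [h0] using h2

section Partial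

variable {h : ℂ × ℂ × ℂ → ℂ} {z : ℂ × ℂ × ℂ} {L : ℂ × ℂ → ℂ} {q : ℂ × ℂ}

lemma AnalyticAt.hasDerivAt_d₁' (hL : AnalyticAt ℂ L q) :
    HasDerivAt (fun t => L (t, q.2)) (fderiv ℂ L q (1, 0)) q.1 :=
  (hL.differentiableAt.hasFDerivAt (x := q)).comp_hasDerivAt q.1
    ((hasDerivAt_id _).prodMk (hasDerivAt_const _ _))

lemma AnalyticAt.hasDerivAt_d₂' (hL : AnalyticAt ℂ L q) :
    HasDerivAt (fun t => L (q.1, t)) (fderiv ℂ L q (0, 1)) q.2 :=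
  (hL.differentiableAt.hasFDerivAt (x := q)).comp_hasDerivAt q.2
    ((hasDerivAt_const _ _).prodMk (hasDerivAt_id _))

lemma AnalyticAt.hasDerivAt_d₁ (hL : AnalyticAt ℂ L q) :
    HasDerivAt (fun t => L (t, q.2)) (d₁ L q) q.1 :=
  hL.hasDerivAt_d₁'.differentiableAt.hasDerivAt

lemma AnalyticAt.hasDerivAt_d₂ (hL : AnalyticAt ℂ L q) :
    HasDerivAt (fun t => L (q.1, t)) (d₂ L q) q.2 :=
  hL.hasDerivAt_d₂'.differentiableAt.hasDerivAt

lemma AnalyticAt.d₂ (hL : AnalyticAt ℂ L q) : AnalyticAt ℂ (d₂ L) q :=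
  (hL.fderiv_apply_const (0, 1)).congr
    (hL.eventually_analyticAt.mono fun _ hy => hy.hasDerivAt_d₂'.deriv.symm)

/-- Symmetry of mixed partial derivatives. -/
lemma AnalyticAt.dZ_dY_comm (hh : AnalyticAt ℂ h z) :
    _root_.dZ (_root_.dY h) z = _root_.dY (_root_.dZ h) z := by
  have hev := hh.eventually_analyticAt
  have h1 : _root_.dY h =ᶠ[𝓝 z] fun y => fderiv ℂ h y (0, 1, 0) :=
    hev.mono fun _ hy => hy.hasDerivAt_dY'.deriv
  have h2 : _root_.dZ h =ᶠ[𝓝 z] fun y => fderiv ℂ h y (0, 0, 1) :=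
    hev.mono fun _ hy => hy.hasDerivAt_dZ'.deriv
  have key : ∀ v, fderiv ℂ (fun y => fderiv ℂ h y v) z = (fderiv ℂ (fderiv ℂ h) z).flip v := by
    intro v
    have := (hh.fderiv.differentiableAt.hasFDerivAt).clm_apply (hasFDerivAt_const v z)
    rw [this.fderiv]
    ext <;> simp
  have e1 : _root_.dZ (_root_.dY h) z = fderiv ℂ (fderiv ℂ h) z (0, 0, 1) (0, 1, 0) := by
    rw [_root_.dZ, hh.dY.hasDerivAt_dZ'.deriv, h1.fderiv_eq, key]
    rfl
  have e2 : _root_.dY (_root_.dZ h) z = fderiv ℂ (fderiv ℂ h) z (0, 1, 0) (0, 0, 1) := by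
    rw [_root_.dY, hh.dZ.hasDerivAt_dY'.deriv, h2.fderiv_eq, key]
    rfl
  rw [e1, e2]
  exact (hh.contDiffAt.isSymmSndFDerivAt (n := ⊤) (by simp)) _ _

end Partial

/-- Site n is a slot of only four conditions, with indices n, n - 1, n - 2, n - 3, so a minimum of
four radii suffices although there are infinitely many conditions. -/
lemma exists_radii (u : ℤ → ℂ) {P : ℤ → ℂ × ℂ × ℂ × ℂ → Prop}
    (h : ∀ n, ∀ᶠ q in 𝓝 (u (n + 1 + 1 + 1), u (n + 1 + 1), u (n + 1), u n), P n q) :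
    ∃ r : ℤ → ℝ, (∀ n, 0 < r n) ∧ ∀ n, ∀ w ∈ ball (u (n + 1 + 1 + 1)) (r (n + 1 + 1 + 1)),
      ∀ x ∈ ball (u (n + 1 + 1)) (r (n + 1 + 1)), ∀ y ∈ ball (u (n + 1)) (r (n + 1)),
      ∀ z ∈ ball (u n) (r n), P n (w, x, y, z) := by
  choose ε hε hP using fun n => Metric.eventually_nhds_iff_ball.1 (h n)
  refine ⟨fun n => min (min (ε n) (ε (n - 1))) (min (ε (n - 1 - 1)) (ε (n - 1 - 1 - 1))),
    fun n => by simp [hε], fun n w hw x hx y hy z hz => hP n _ ?_⟩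
  simp only [add_sub_cancel_right, mem_ball, lt_min_iff] at hw hx hy hz
  simp only [mem_ball, Prod.dist_eq, max_lt_iff]
  tauto

/-- The differential equations imposed by the first expansion, on discs around the members of
the sequence `u`. -/
structure LocalRelations (C : QLChain) (u : ℤ → ℂ) (L : ℤ → ℂ × ℂ → ℂ) (B : ℤ → Set ℂ) :
    Prop where
  ball : ∀ n, ∃ r > 0, B n = Metric.ball (u n) r
  mem_D : ∀ {n x y z}, x ∈ B (n + 1 + 1) → y ∈ B (n + 1) → z ∈ B n → (x, y, z) ∈ C.D
  analyticAt : ∀ {n s t}, s ∈ B n → t ∈ B (n + 1) → AnalyticAt ℂ (L n) (s, t)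
  d₂_eq : ∀ {n x y z}, x ∈ B (n + 1 + 1) → y ∈ B (n + 1) → z ∈ B n →
    d₂ (L n) (z, y) = -2 * dZ C.α (x, y, z)
  dZ_dZ_α : ∀ {n x y z}, x ∈ B (n + 1 + 1) → y ∈ B (n + 1) → z ∈ B n →
    dZ (dZ C.α) (x, y, z) = L n (z, y) * dZ C.α (x, y, z)
  dZ_dZ_γ : ∀ {n x y z}, x ∈ B (n + 1 + 1) → y ∈ B (n + 1) → z ∈ B n →
    dZ (dZ C.γ) (x, y, z) = L n (z, y) * dZ C.γ (x, y, z)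
  d₁_eq : ∀ {n x y z}, x ∈ B (n + 1 + 1) → y ∈ B (n + 1) → z ∈ B n →
    d₁ (L (n + 1)) (y, x) + L (n + 1) (y, x) * C.α (x, y, z) + dY C.α (x, y, z) +
      C.α (x, y, z) ^ 2 = 0
  γ_eq : ∀ {n w x y z}, w ∈ B (n + 1 + 1 + 1) → x ∈ B (n + 1 + 1) → y ∈ B (n + 1) → z ∈ B n →
    L (n + 1) (y, x) * C.γ (x, y, z) + dY C.γ (x, y, z) + C.α (x, y, z) * C.γ (x, y, z) +
      2 * dZ C.γ (w, x, y) = 0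

theorem exists_localRelations {C : QLChain} (hC : C.Nondegenerate) (hF : C.FirstExpansion)
    {u : ℤ → ℂ} (hu : C.InDomain u) : ∃ L B, LocalRelations C u L B := by
  choose L hL hrel using C.exists_relations hC hF hu
  have hu' : ∀ n, (u (n + 1 + 1), u (n + 1), u n) ∈ C.D := fun n => by
    simpa [triple] using hu (n + 1)
  have hD : ∀ n, ∀ᶠ q : ℂ × ℂ × ℂ × ℂ in 𝓝 (u (n + 1 + 1 + 1), u (n + 1 + 1), u (n + 1), u n),
      q.2 ∈ C.D := fun n =>
    (continuous_snd.tendsto _).eventually (C.isOpen_D.mem_nhds (hu' n))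
  have hA : ∀ n, ∀ᶠ q : ℂ × ℂ × ℂ × ℂ in 𝓝 (u (n + 1 + 1 + 1), u (n + 1 + 1), u (n + 1), u n),
      AnalyticAt ℂ (L n) (q.2.2.2, q.2.2.1) := fun n => by
    have hc : Continuous fun q : ℂ × ℂ × ℂ × ℂ => (q.2.2.2, q.2.2.1) := by fun_prop
    exact (hc.tendsto _).eventually (hL n).eventually_analyticAt
  have h1 : ∀ n, ∀ᶠ q : ℂ × ℂ × ℂ × ℂ in 𝓝 (u (n + 1 + 1 + 1), u (n + 1 + 1), u (n + 1), u n),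
      d₂ (L n) (q.2.2.2, q.2.2.1) = -2 * dZ C.α q.2 ∧
      dZ (dZ C.α) q.2 = L n (q.2.2.2, q.2.2.1) * dZ C.α q.2 ∧
      dZ (dZ C.γ) q.2 = L n (q.2.2.2, q.2.2.1) * dZ C.γ q.2 := fun n => by
    -- The three relations extracted here do not involve the last slot of `hrel n`, which is frozen
    -- at u_{n-1}.
    have hc : Continuous fun q : ℂ × ℂ × ℂ × ℂ => (q.2.1, q.2.2.1, q.2.2.2, u (n - 1)) := by
      fun_prop
    filter_upwards [(hc.tendsto (u (n + 1 + 1 + 1), u (n + 1 + 1), u (n + 1), u n)).eventually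
      (hrel n)] with q hq
    exact ⟨hq.1, hq.2.1, hq.2.2.1⟩
  have h2 := fun n => by
    simpa only [add_sub_cancel_right] using hrel (n + 1)
  obtain ⟨r, hr, hP⟩ := exists_radii u fun n =>
    (hD n).and <| (hA n).and <| (h1 n).and (h2 n)
  have hm : ∀ n, u n ∈ Metric.ball (u n) (r n) := fun n => mem_ball_self (hr n)
  refine ⟨L, fun n => Metric.ball (u n) (r n), fun n => ⟨r n, hr n, rfl⟩,
    fun hx hy hz => (hP _ _ (hm _) _ hx _ hy _ hz).1,
    fun hs ht => (hP _ _ (hm _) _ (hm _) _ ht _ hs).2.1,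
    fun hx hy hz => (hP _ _ (hm _) _ hx _ hy _ hz).2.2.1.1,
    fun hx hy hz => (hP _ _ (hm _) _ hx _ hy _ hz).2.2.1.2.1,
    fun hx hy hz => (hP _ _ (hm _) _ hx _ hy _ hz).2.2.1.2.2,
    fun hx hy hz => (hP _ _ (hm _) _ hx _ hy _ hz).2.2.2.2.2.2.1,
    fun hw hx hy hz => (hP _ _ hw _ hx _ hy _ hz).2.2.2.2.2.2.2⟩
end

/-! ### Separation of variables in α and Schwarzian derivatives -/

noncomputable section

/-- The logarithmic derivative of `∂L/∂t` with respect to `t`. -/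
def logD₂ (L : ℂ × ℂ → ℂ) (q : ℂ × ℂ) : ℂ := d₂ (d₂ L) q / d₂ L q

namespace LocalRelations

variable {C : QLChain} {u : ℤ → ℂ} {L : ℤ → ℂ × ℂ → ℂ} {B : ℤ → Set ℂ}
  (R : LocalRelations C u L B)
include R

lemma center_mem (n : ℤ) : u n ∈ B n := by
  obtain ⟨r, hr, h⟩ := R.ball n
  rw [h]
  exact Metric.mem_ball_self hr

lemma mem_nhds {n : ℤ} {x : ℂ} (hx : x ∈ B n) : B n ∈ 𝓝 x := by
  obtain ⟨r, hr, h⟩ := R.ball n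
  rw [h] at hx ⊢
  exact Metric.isOpen_ball.mem_nhds hx

lemma const_of_hasDerivAt {n : ℤ} {f : ℂ → ℂ} (h : ∀ x ∈ B n, HasDerivAt f 0 x)
    {x y : ℂ} (hx : x ∈ B n) (hy : y ∈ B n) : f x = f y := by
  obtain ⟨r, hr, hB⟩ := R.ball n
  rw [hB] at h hx hy
  exact eq_of_hasDerivAt_zero h hx hy

lemma zero_of_hasDerivAt {n : ℤ} {f c : ℂ → ℂ} (hf : ∀ x ∈ B n, HasDerivAt f (c x * f x) x)
    (hc : ∀ x ∈ B n, DifferentiableAt ℂ c x) {y : ℂ} (hy : y ∈ B n) (h0 : f y = 0) :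
    ∀ x ∈ B n, f x = 0 := by
  obtain ⟨r, hr, hB⟩ := R.ball n
  rw [hB] at hf hc hy ⊢
  exact eq_zero_of_hasDerivAt_mul hf (fun x hx => (hc x hx).differentiableWithinAt) hy h0

lemma unique_deriv {n : ℤ} {f g : ℂ → ℂ} (h : ∀ x ∈ B n, f x = g x) {x f' g' : ℂ} (hx : x ∈ B n)
    (hf : HasDerivAt f f' x) (hg : HasDerivAt g g' x) : f' = g' :=
  hf.unique (hg.congr_of_eventuallyEq (by filter_upwards [R.mem_nhds hx] using h))

variable {n : ℤ} {x y z : ℂ}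

lemma analyticAt_α (hx : x ∈ B (n + 1 + 1)) (hy : y ∈ B (n + 1)) (hz : z ∈ B n) :
    AnalyticAt ℂ C.α (x, y, z) := C.analytic_α _ (R.mem_D hx hy hz)

lemma analyticAt_γ (hx : x ∈ B (n + 1 + 1)) (hy : y ∈ B (n + 1)) (hz : z ∈ B n) :
    AnalyticAt ℂ C.γ (x, y, z) := C.analytic_γ _ (R.mem_D hx hy hz)

/-- Obtained by differentiating the Riccati relation `d₁_eq` in z, on which L (n + 1) (y, x) does
not depend. -/
lemma dY_dZ_α (hx : x ∈ B (n + 1 + 1)) (hy : y ∈ B (n + 1)) (hz : z ∈ B n) :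
    dY (dZ C.α) (x, y, z) = -(L (n + 1) (y, x) + 2 * C.α (x, y, z)) * dZ C.α (x, y, z) := by
  have hα := R.analyticAt_α hx hy hz
  have h1 := R.unique_deriv (fun t ht => R.d₁_eq hx hy ht) hz
    ((((hα.hasDerivAt_dZ.const_mul (L (n + 1) (y, x))).const_add (d₁ (L (n + 1)) (y, x))).add
      hα.dY.hasDerivAt_dZ).add (hα.hasDerivAt_dZ.pow 2)) (hasDerivAt_const _ _)
  rw [← hα.dZ_dY_comm]
  simp only [Nat.cast_ofNat] at h1
  linear_combination h1

/-- As a function of y, and as a function of z, ∂α/∂z solves a homogeneous linear equation, and by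
`d₂_eq` it does not depend on x. A single zero would therefore spread to an open set, contrary to
nondegeneracy. -/
lemma dZ_α_ne_zero (hC : C.Nondegenerate) (hx : x ∈ B (n + 1 + 1)) (hy : y ∈ B (n + 1))
    (hz : z ∈ B n) : dZ C.α (x, y, z) ≠ 0 := by
  intro h0
  have h1 : ∀ y' ∈ B (n + 1), dZ C.α (x, y', z) = 0 := by
    refine R.zero_of_hasDerivAt (f := fun y' => dZ C.α (x, y', z))
      (c := fun y' => -(L (n + 1) (y', x) + 2 * C.α (x, y', z))) (fun y' hy' => ?_)
      (fun y' hy' => ?_) hy h0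
    · rw [← R.dY_dZ_α hx hy' hz]
      exact (R.analyticAt_α hx hy' hz).dZ.hasDerivAt_dY
    · exact ((R.analyticAt hy' hx).hasDerivAt_d₁.differentiableAt.add
        ((R.analyticAt_α hx hy' hz).hasDerivAt_dY.differentiableAt.const_mul 2)).neg
  have h2 : ∀ y' ∈ B (n + 1), ∀ z' ∈ B n, dZ C.α (x, y', z') = 0 := by
    intro y' hy'
    refine R.zero_of_hasDerivAt (f := fun z' => dZ C.α (x, y', z'))
      (c := fun z' => L n (z', y')) (fun z' hz' => ?_) (fun z' hz' => ?_) hz (h1 y' hy')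
    · rw [← R.dZ_dZ_α hx hy' hz']
      exact (R.analyticAt_α hx hy' hz').dZ.hasDerivAt_dZ
    · exact (R.analyticAt hz' hy').hasDerivAt_d₁.differentiableAt
  refine C.not_eventually_zero C.analytic_α.dZ hC.2 (R.mem_D hx hy hz) ?_
  filter_upwards [prod_mem_nhds (R.mem_nhds hx) (prod_mem_nhds (R.mem_nhds hy) (R.mem_nhds hz))]
    with q hq
  have e1 := R.d₂_eq hq.1 hq.2.1 hq.2.2
  have e2 := R.d₂_eq hx hq.2.1 hq.2.2
  have e3 := h2 _ hq.2.1 _ hq.2.2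
  rw [e2, e3] at e1
  simpa using e1.symm

lemma d₂_ne_zero (hC : C.Nondegenerate) {s t : ℂ} (hs : s ∈ B n) (ht : t ∈ B (n + 1)) :
    d₂ (L n) (s, t) ≠ 0 := by
  rw [R.d₂_eq (R.center_mem _) ht hs]
  exact mul_ne_zero (by norm_num) (R.dZ_α_ne_zero hC (R.center_mem _) ht hs)

lemma logD₂_eq (hC : C.Nondegenerate) (hx : x ∈ B (n + 1 + 1)) (hy : y ∈ B (n + 1))
    (hz : z ∈ B n) : logD₂ (L n) (z, y) = -(L (n + 1) (y, x) + 2 * C.α (x, y, z)) := by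
  have h1 := R.unique_deriv (fun t ht => R.d₂_eq hx ht hz) hy
    (R.analyticAt hz hy).d₂.hasDerivAt_d₂
    ((R.analyticAt_α hx hy hz).dZ.hasDerivAt_dY.const_mul (-2))
  rw [logD₂, div_eq_iff (R.d₂_ne_zero hC hz hy), h1, R.d₂_eq hx hy hz, R.dY_dZ_α hx hy hz]
  ring

/-- Comparing the y-derivative of `d₂_eq` with `dY_dZ_α` separates α into a function of (y, x) and a
function of (z, y), both determined by the L's. -/
lemma α_eq (hC : C.Nondegenerate) (hx : x ∈ B (n + 1 + 1)) (hy : y ∈ B (n + 1))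
    (hz : z ∈ B n) : C.α (x, y, z) = -(L (n + 1) (y, x) + logD₂ (L n) (z, y)) / 2 := by
  rw [R.logD₂_eq hC hx hy hz]
  ring

lemma analyticAt_logD₂ (hC : C.Nondegenerate) {s t : ℂ} (hs : s ∈ B n) (ht : t ∈ B (n + 1)) :
    AnalyticAt ℂ (logD₂ (L n)) (s, t) :=
  (R.analyticAt hs ht).d₂.d₂.div (R.analyticAt hs ht).d₂ (R.d₂_ne_zero hC hs ht)

/-- The Schwarzian derivatives of `L n` and `L (n + 1)` in `u (n + 1)` agree. -/
lemma schwarzian_eq (hC : C.Nondegenerate) (hx : x ∈ B (n + 1 + 1)) (hy : y ∈ B (n + 1))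
    (hz : z ∈ B n) : d₁ (L (n + 1)) (y, x) - L (n + 1) (y, x) ^ 2 / 2 =
      d₂ (logD₂ (L n)) (z, y) - logD₂ (L n) (z, y) ^ 2 / 2 := by
  have h1 := R.unique_deriv (fun t ht => R.α_eq hC hx ht hz) hy
    (R.analyticAt_α hx hy hz).hasDerivAt_dY
    (((R.analyticAt hy hx).hasDerivAt_d₁.add
      (R.analyticAt_logD₂ hC hz hy).hasDerivAt_d₂).neg.div_const 2)
  -- With the separated form of α inserted, the mixed products of L and `logD₂` cancel.
  have h2 := R.d₁_eq hx hy hz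
  rw [h1, R.α_eq hC hx hy hz] at h2
  linear_combination 2 * h2

/-! ### The coefficient `γ` -/

/-- In `γ_eq` the slot w occurs in a single term, the derivative of γ. -/
lemma dZ_γ_congr {x' : ℂ} (hx : x ∈ B (n + 1)) (hx' : x' ∈ B (n + 1)) (hy : y ∈ B n)
    (hz : z ∈ B (n - 1)) : dZ C.γ (x, y, z) = dZ C.γ (x', y, z) := by
  obtain ⟨m, rfl⟩ : ∃ m, n = m + 1 + 1 := ⟨n - 1 - 1, by ring⟩
  simp only [add_sub_cancel_right] at hz
  have h1 := R.γ_eq hx hy hz (R.center_mem m)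
  have h2 := R.γ_eq hx' hy hz (R.center_mem m)
  linear_combination (h1 - h2) / 2

/-- The ratio of the derivatives of `γ` and `α` with respect to `u (n - 1)` depends on `u n`
only. -/
lemma exists_ratio (hC : C.Nondegenerate) (n : ℤ) : ∃ h : ℂ → ℂ, ∀ y ∈ B n, AnalyticAt ℂ h y ∧
    ∀ x ∈ B (n + 1), ∀ z ∈ B (n - 1), dZ C.γ (x, y, z) = h y * dZ C.α (x, y, z) := by
  obtain ⟨m, rfl⟩ : ∃ m, n = m + 1 := ⟨n - 1, by ring⟩
  simp only [add_sub_cancel_right]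
  have cx := R.center_mem (m + 1 + 1)
  have cz := R.center_mem m
  refine ⟨fun y => dZ C.γ (u (m + 1 + 1), y, u m) / dZ C.α (u (m + 1 + 1), y, u m),
    fun y hy => ⟨?_, fun x hx z hz => ?_⟩⟩
  · have hc : AnalyticAt ℂ (fun y : ℂ => (u (m + 1 + 1), y, u m)) y :=
      analyticAt_const.prod (analyticAt_id.prod analyticAt_const)
    exact ((R.analyticAt_γ cx hy cz).dZ.comp_of_eq hc rfl).div
      ((R.analyticAt_α cx hy cz).dZ.comp_of_eq hc rfl) (R.dZ_α_ne_zero hC cx hy cz)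
  -- The quotient is constant in z because numerator and denominator solve the same linear equation
  -- ∂w/∂z = L w; neither of them depends on x.
  · have h1 : ∀ z ∈ B m, HasDerivAt (fun z => dZ C.γ (x, y, z) / dZ C.α (x, y, z)) 0 z := by
      intro z hz
      refine ((R.analyticAt_γ hx hy hz).dZ.hasDerivAt_dZ.div
        (R.analyticAt_α hx hy hz).dZ.hasDerivAt_dZ (R.dZ_α_ne_zero hC hx hy hz)).congr_deriv ?_
      rw [R.dZ_dZ_γ hx hy hz, R.dZ_dZ_α hx hy hz]
      ring
    have h2 := R.const_of_hasDerivAt h1 hz cz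
    have h3 : dZ C.α (x, y, u m) = dZ C.α (u (m + 1 + 1), y, u m) := by
      linear_combination (R.d₂_eq hx hy cz - R.d₂_eq cx hy cz) / 2
    have h4 : dZ C.γ (x, y, u m) = dZ C.γ (u (m + 1 + 1), y, u m) :=
      R.dZ_γ_congr (n := m + 1) hx cx hy (by simpa using cz)
    beta_reduce
    rw [← h3, ← h4, ← h2, div_mul_cancel₀ _ (R.dZ_α_ne_zero hC hx hy hz)]

variable {h : ℤ → ℂ → ℂ} (hh : ∀ n, ∀ y ∈ B n, AnalyticAt ℂ (h n) y ∧
    ∀ x ∈ B (n + 1), ∀ z ∈ B (n - 1), dZ C.γ (x, y, z) = h n y * dZ C.α (x, y, z))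
include hh

/-- Differentiate `γ_eq` in z, whose last term is free of z; every remaining term then has the
nonzero factor ∂α/∂z. -/
lemma γ_eq_of_ratio (hC : C.Nondegenerate) (hx : x ∈ B (n + 1 + 1)) (hy : y ∈ B (n + 1))
    (hz : z ∈ B n) :
    C.γ (x, y, z) = C.α (x, y, z) * h (n + 1) y - deriv (h (n + 1)) y := by
  have e : ∀ y' ∈ B (n + 1), dZ C.γ (x, y', z) = h (n + 1) y' * dZ C.α (x, y', z) :=
    fun y' hy' => (hh (n + 1) y' hy').2 x hx z (by simpa using hz)
  have hα := R.analyticAt_α hx hy hz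
  have hγ := R.analyticAt_γ hx hy hz
  have h1 := R.unique_deriv e hy hγ.dZ.hasDerivAt_dY
    ((hh (n + 1) y hy).1.differentiableAt.hasDerivAt.mul hα.dZ.hasDerivAt_dY)
  have h2 := R.unique_deriv (fun t ht => R.γ_eq (R.center_mem _) hx hy ht) hz
    ((((hγ.hasDerivAt_dZ.const_mul (L (n + 1) (y, x))).add hγ.dY.hasDerivAt_dZ).add
      (hα.hasDerivAt_dZ.mul hγ.hasDerivAt_dZ)).add_const _) (hasDerivAt_const _ _)
  rw [hγ.dZ_dY_comm, h1, R.dY_dZ_α hx hy hz, e y hy] at h2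
  refine mul_left_cancel₀ (R.dZ_α_ne_zero hC hx hy hz) ?_
  linear_combination h2

/-- Inserting γ = αh - h' into `γ_eq` and subtracting h times the Riccati relation removes α,
leaving a relation between neighbouring h's and one L. -/
lemma ratio_relation (hC : C.Nondegenerate) {s t : ℂ} (hs : s ∈ B n) (ht : t ∈ B (n + 1)) :
    h (n + 1) t * d₂ (L n) (s, t) =
      -(d₁ (L n) (s, t) * h n s + L n (s, t) * deriv (h n) s + deriv (deriv (h n)) s) := by
  obtain ⟨m, rfl⟩ : ∃ m, n = m + 1 := ⟨n - 1, by ring⟩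
  have cw := R.center_mem (m + 1 + 1 + 1)
  have cz := R.center_mem m
  have hα := R.analyticAt_α ht hs cz
  have h1 := R.unique_deriv (fun y hy => R.γ_eq_of_ratio hh hC ht hy cz) hs
    (R.analyticAt_γ ht hs cz).hasDerivAt_dY
    ((hα.hasDerivAt_dY.mul (hh (m + 1) s hs).1.differentiableAt.hasDerivAt).sub
      (hh (m + 1) s hs).1.deriv.differentiableAt.hasDerivAt)
  have h2 := R.γ_eq cw ht hs cz
  have h3 := R.d₁_eq ht hs cz
  have h4 := R.d₂_eq cw ht hs
  rw [(hh (m + 1 + 1) t ht).2 _ cw s (by simpa using hs), h1, R.γ_eq_of_ratio hh hC ht hs cz] at h2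
  rw [h4]
  linear_combination -h2 + h (m + 1) s * h3

end LocalRelations
end

/-! ### The form of α and γ in adapted coordinates -/

noncomputable section

/-- The logarithmic derivative of the derivative of `V`. -/
def preSchwarzian (V : ℂ → ℂ) (s : ℂ) : ℂ := deriv (deriv V) s / deriv V s

lemma AnalyticAt.preSchwarzian {V : ℂ → ℂ} {s : ℂ} (hV : AnalyticAt ℂ V s) (h : deriv V s ≠ 0) :
    AnalyticAt ℂ (preSchwarzian V) s := hV.deriv.deriv.div hV.deriv h

lemma AnalyticAt.hasDerivAt {V : ℂ → ℂ} {s : ℂ} (hV : AnalyticAt ℂ V s) :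
    HasDerivAt V (_root_.deriv V s) s := hV.differentiableAt.hasDerivAt

lemma AnalyticAt.eventually_regular {V : ℂ → ℂ} {s : ℂ} (hV : AnalyticAt ℂ V s)
    (h : _root_.deriv V s ≠ 0) :
    ∀ᶠ t in 𝓝 s, AnalyticAt ℂ V t ∧ _root_.deriv V t ≠ 0 :=
  hV.eventually_analyticAt.and (hV.deriv.continuousAt.eventually_ne h)

/-- Local coordinates `V n` near `u n` in which the functions `L n` take their standard form. -/
structure IsChartSystem (L : ℤ → ℂ × ℂ → ℂ) (u : ℤ → ℂ) (V : ℤ → ℂ → ℂ) : Prop where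
  analyticAt : ∀ n, AnalyticAt ℂ (V n) (u n)
  deriv_ne_zero : ∀ n, deriv (V n) (u n) ≠ 0
  ne : ∀ n, V n (u n) ≠ V (n + 1) (u (n + 1))
  eq : ∀ n, ∀ᶠ q in 𝓝 (u n, u (n + 1)), L n q =
    preSchwarzian (V n) q.1 - 2 * deriv (V n) q.1 / (V n q.1 - V (n + 1) q.2)

lemma quadratic_eq_zero_of_eventually {X : ℂ → ℂ} {a c₀ c₁ c₂ : ℂ} (hX : AnalyticAt ℂ X a)
    (hX' : deriv X a ≠ 0) (h : ∀ᶠ t in 𝓝 a, c₀ + c₁ * X t + c₂ * X t ^ 2 = 0) :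
    c₀ = 0 ∧ c₁ = 0 ∧ c₂ = 0 := by
  have h1 : ∀ᶠ t in 𝓝 a, c₁ + 2 * c₂ * X t = 0 := by
    filter_upwards [h.eventually_nhds, hX.eventually_regular hX'] with t ht ht'
    have e1 := (((ht'.1.hasDerivAt.const_mul c₁).const_add c₀).add
      ((ht'.1.hasDerivAt.pow 2).const_mul c₂)).unique
      ((hasDerivAt_const t (0 : ℂ)).congr_of_eventuallyEq ht)
    refine mul_right_cancel₀ ht'.2 ?_
    simp only [Nat.cast_ofNat] at e1
    linear_combination e1
  have e2 := ((hX.hasDerivAt.const_mul (2 * c₂)).const_add c₁).unique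
      ((hasDerivAt_const a (0 : ℂ)).congr_of_eventuallyEq h1)
  have h2 : c₂ = 0 := by simpa [hX'] using e2
  have h3 : c₁ = 0 := by simpa [h2] using h1.self_of_nhds
  exact ⟨by simpa [h2, h3] using h.self_of_nhds, h3, h2⟩

namespace IsChartSystem

variable {L : ℤ → ℂ × ℂ → ℂ} {u : ℤ → ℂ} {V : ℤ → ℂ → ℂ} (hV : IsChartSystem L u V)
include hV

lemma eventually_regular (n : ℤ) :
    ∀ᶠ s in 𝓝 (u n), AnalyticAt ℂ (V n) s ∧ deriv (V n) s ≠ 0 :=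
  (hV.analyticAt n).eventually_regular (hV.deriv_ne_zero n)

lemma eventually_ne (n : ℤ) : ∀ᶠ q in 𝓝 (u n, u (n + 1)), V n q.1 - V (n + 1) q.2 ≠ 0 := by
  have h1 : ContinuousAt (fun q : ℂ × ℂ => V n q.1) (u n, u (n + 1)) :=
    ContinuousAt.comp' (g := V n) (hV.analyticAt n).continuousAt continuousAt_fst
  have h2 : ContinuousAt (fun q : ℂ × ℂ => V (n + 1) q.2) (u n, u (n + 1)) :=
    ContinuousAt.comp' (g := V (n + 1)) (hV.analyticAt (n + 1)).continuousAt continuousAt_snd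
  exact (h1.sub h2).eventually_ne (sub_ne_zero.2 (hV.ne n))

lemma eventually_good (n : ℤ) : ∀ᶠ q in 𝓝 (u n, u (n + 1)),
    (AnalyticAt ℂ (V n) q.1 ∧ deriv (V n) q.1 ≠ 0) ∧
    (AnalyticAt ℂ (V (n + 1)) q.2 ∧ deriv (V (n + 1)) q.2 ≠ 0) ∧
    V n q.1 - V (n + 1) q.2 ≠ 0 ∧
    L n q = preSchwarzian (V n) q.1 - 2 * deriv (V n) q.1 / (V n q.1 - V (n + 1) q.2) :=
  (continuousAt_fst.eventually (hV.eventually_regular n)).and <|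
    (continuousAt_snd.eventually (hV.eventually_regular (n + 1))).and <|
      (hV.eventually_ne n).and (hV.eq n)

lemma eventually_d₁_eq (n : ℤ) : ∀ᶠ q in 𝓝 (u n, u (n + 1)), d₁ (L n) q =
    deriv (preSchwarzian (V n)) q.1 - 2 * deriv (deriv (V n)) q.1 / (V n q.1 - V (n + 1) q.2) +
      2 * deriv (V n) q.1 ^ 2 / (V n q.1 - V (n + 1) q.2) ^ 2 := by
  filter_upwards [(hV.eventually_good n).eventually_nhds] with q hq
  obtain ⟨⟨a1, a2⟩, -, a3, -⟩ := hq.self_of_nhds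
  have h1 : Tendsto (fun t => (t, q.2)) (𝓝 q.1) (𝓝 q) :=
    (Continuous.prodMk_left q.2).tendsto q.1
  have h2 := ((a1.preSchwarzian a2).hasDerivAt.sub ((a1.deriv.hasDerivAt.const_mul 2).div
    (a1.hasDerivAt.sub_const (V (n + 1) q.2)) a3)).congr_of_eventuallyEq
    ((h1.eventually hq).mono fun t ht => ht.2.2.2)
  rw [d₁, h2.deriv]
  field_simp
  ring

lemma eventually_d₂_eq (n : ℤ) : ∀ᶠ q in 𝓝 (u n, u (n + 1)), d₂ (L n) q =
    -2 * deriv (V n) q.1 * deriv (V (n + 1)) q.2 / (V n q.1 - V (n + 1) q.2) ^ 2 := by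
  filter_upwards [(hV.eventually_good n).eventually_nhds] with q hq
  obtain ⟨-, ⟨a1, a2⟩, a3, -⟩ := hq.self_of_nhds
  have h1 : Tendsto (fun t => (q.1, t)) (𝓝 q.2) (𝓝 q) :=
    (Continuous.prodMk_right q.1).tendsto q.2
  have h2 := (((hasDerivAt_const q.2 (2 * deriv (V n) q.1)).div
    (a1.hasDerivAt.const_sub (V n q.1)) a3).const_sub
      (preSchwarzian (V n) q.1)).congr_of_eventuallyEq
    ((h1.eventually hq).mono fun t ht => ht.2.2.2)
  rw [d₂, h2.deriv]
  field_simp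
  ring

lemma eventually_logD₂_eq (n : ℤ) : ∀ᶠ q in 𝓝 (u n, u (n + 1)), logD₂ (L n) q =
    preSchwarzian (V (n + 1)) q.2 +
      2 * deriv (V (n + 1)) q.2 / (V n q.1 - V (n + 1) q.2) := by
  filter_upwards [((hV.eventually_good n).and (hV.eventually_d₂_eq n)).eventually_nhds] with q hq
  obtain ⟨⟨⟨-, a0⟩, ⟨a1, a2⟩, a3, -⟩, a4⟩ := hq.self_of_nhds
  have h1 : Tendsto (fun t => (q.1, t)) (𝓝 q.2) (𝓝 q) :=
    (Continuous.prodMk_right q.1).tendsto q.2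
  have h2 := ((a1.deriv.hasDerivAt.const_mul (-2 * deriv (V n) q.1)).div
    ((a1.hasDerivAt.const_sub (V n q.1)).pow 2) (pow_ne_zero 2 a3)).congr_of_eventuallyEq
    ((h1.eventually hq).mono fun t ht => ht.2)
  rw [logD₂, a4, d₂, h2.deriv, preSchwarzian]
  simp only [Pi.pow_apply]
  field_simp
  ring

variable {C : QLChain} {B : ℤ → Set ℂ} (R : LocalRelations C u L B) (hC : C.Nondegenerate)
include R hC

/-- The two summands in `α_eq` contribute the same `preSchwarzian` term, and their poles in V are
the two fractions of `alphaStd`. -/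
lemma eventually_α_eq (n : ℤ) : ∀ᶠ q in 𝓝 (u (n + 1 + 1), u (n + 1), u n), C.α q =
    -preSchwarzian (V (n + 1)) q.2.1 + deriv (V (n + 1)) q.2.1 *
      alphaStd (V (n + 1 + 1) q.1, V (n + 1) q.2.1, V n q.2.2) := by
  have c1 : Tendsto (fun q : ℂ × ℂ × ℂ => (q.2.2, q.2.1)) (𝓝 (u (n + 1 + 1), u (n + 1), u n))
      (𝓝 (u n, u (n + 1))) := by
    refine Continuous.tendsto' ?_ _ _ rfl; fun_prop
  have c2 : Tendsto (fun q : ℂ × ℂ × ℂ => (q.2.1, q.1)) (𝓝 (u (n + 1 + 1), u (n + 1), u n))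
      (𝓝 (u (n + 1), u (n + 1 + 1))) := by
    refine Continuous.tendsto' ?_ _ _ rfl; fun_prop
  filter_upwards [c1.eventually (hV.eventually_logD₂_eq n), c2.eventually (hV.eq (n + 1)),
    prod_mem_nhds (R.mem_nhds (R.center_mem (n + 1 + 1))) (prod_mem_nhds
      (R.mem_nhds (R.center_mem (n + 1))) (R.mem_nhds (R.center_mem n)))] with q h1 h2 h3
  have h4 := R.α_eq hC h3.1 h3.2.1 h3.2.2
  rw [h1, h2] at h4
  refine h4.trans ?_
  simp only [alphaStd]
  rw [← neg_sub (V (n + 1) q.2.1) (V (n + 1 + 1) q.1), ← neg_sub (V n q.2.2) (V (n + 1) q.2.1),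
    div_neg, div_neg]
  ring

variable {h : ℤ → ℂ → ℂ} (hh : ∀ n, ∀ y ∈ B n, AnalyticAt ℂ (h n) y ∧
    ∀ x ∈ B (n + 1), ∀ z ∈ B (n - 1), dZ C.γ (x, y, z) = h n y * dZ C.α (x, y, z))
include hh

/-- This is `ratio_relation` with s frozen at u_n: once the denominators of L are cleared, the
right-hand side is a quadratic polynomial in V_{n+1}(t). -/
lemma ratio_mul_deriv_eq (n : ℤ) : ∀ᶠ t in 𝓝 (u (n + 1)),
    h (n + 1) t * deriv (V (n + 1)) t * (2 * deriv (V n) (u n)) =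
      (deriv (preSchwarzian (V n)) (u n) * h n (u n) +
        preSchwarzian (V n) (u n) * deriv (h n) (u n) + deriv (deriv (h n)) (u n)) *
          (V n (u n) - V (n + 1) t) ^ 2 -
      2 * (deriv (deriv (V n)) (u n) * h n (u n) + deriv (V n) (u n) * deriv (h n) (u n)) *
          (V n (u n) - V (n + 1) t) +
      2 * deriv (V n) (u n) ^ 2 * h n (u n) := by
  have c : Tendsto (fun t => (u n, t)) (𝓝 (u (n + 1))) (𝓝 (u n, u (n + 1))) :=
    (Continuous.prodMk_right (u n)).tendsto (u (n + 1))
  filter_upwards [c.eventually (hV.eventually_good n), c.eventually (hV.eventually_d₁_eq n),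
    c.eventually (hV.eventually_d₂_eq n), R.mem_nhds (R.center_mem (n + 1))] with t h1 h2 h3 h4
  have h5 := R.ratio_relation hh hC (R.center_mem n) h4
  rw [h2, h3, h1.2.2.2] at h5
  have h6 := h1.2.2.1
  beta_reduce at h6
  field_simp at h5
  linear_combination -h5

lemma exists_quadratic (n : ℤ) : ∃ c : ℂ × ℂ × ℂ, ∀ᶠ t in 𝓝 (u n),
    h n t * deriv (V n) t = c.1 + c.2.1 * V n t + c.2.2 * V n t ^ 2 := by
  obtain ⟨m, rfl⟩ : ∃ m, n = m + 1 := ⟨n - 1, by ring⟩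
  have h1 := hV.ratio_mul_deriv_eq R hC hh m
  have h2 := hV.deriv_ne_zero m
  set a := deriv (preSchwarzian (V m)) (u m) * h m (u m) +
    preSchwarzian (V m) (u m) * deriv (h m) (u m) + deriv (deriv (h m)) (u m)
  set b := 2 * (deriv (deriv (V m)) (u m) * h m (u m) + deriv (V m) (u m) * deriv (h m) (u m))
  set v := V m (u m)
  set v' := deriv (V m) (u m)
  refine ⟨((a * v ^ 2 - b * v + 2 * v' ^ 2 * h m (u m)) / (2 * v'), (-2 * a * v + b) / (2 * v'),
    a / (2 * v')), h1.mono fun t ht => ?_⟩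
  field_simp
  linear_combination ht

omit hC in
lemma eventually_ratio_eq {n : ℤ} {c : ℂ × ℂ × ℂ} (hc : ∀ᶠ t in 𝓝 (u n),
    h n t * deriv (V n) t = c.1 + c.2.1 * V n t + c.2.2 * V n t ^ 2) :
    ∀ᶠ t in 𝓝 (u n), deriv (h n) t =
      c.2.1 + 2 * c.2.2 * V n t - preSchwarzian (V n) t * h n t := by
  filter_upwards [hc.eventually_nhds, hV.eventually_regular n, R.mem_nhds (R.center_mem n)]
    with t h1 h2 h3
  have h4 := ((hh n t h3).1.hasDerivAt.mul h2.1.deriv.hasDerivAt).unique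
    ((((h2.1.hasDerivAt.const_mul c.2.1).const_add c.1).add
      ((h2.1.hasDerivAt.pow 2).const_mul c.2.2)).congr_of_eventuallyEq h1)
  have h5 := h2.2
  simp only [Nat.cast_ofNat] at h4
  rw [preSchwarzian]
  field_simp
  linear_combination h4

/-- The right-hand side of `ratio_mul_deriv_eq` is built from the 2-jet of h_n at u_n. If h_n V_n'
is a quadratic polynomial in V_n, that expression is its Taylor expansion at V_n(u_n), so the same
polynomial reappears at the next site. -/
lemma eventually_succ {n : ℤ} {c : ℂ × ℂ × ℂ} (hc : ∀ᶠ t in 𝓝 (u n),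
    h n t * deriv (V n) t = c.1 + c.2.1 * V n t + c.2.2 * V n t ^ 2) :
    ∀ᶠ t in 𝓝 (u (n + 1)), h (n + 1) t * deriv (V (n + 1)) t =
      c.1 + c.2.1 * V (n + 1) t + c.2.2 * V (n + 1) t ^ 2 := by
  have h1 := hV.eventually_ratio_eq R hh hc
  have a1 := hV.analyticAt n
  have a2 := hV.deriv_ne_zero n
  have h2 := ((((a1.hasDerivAt.const_mul (2 * c.2.2)).const_add c.2.1).sub
    ((a1.preSchwarzian a2).hasDerivAt.mul
      (hh n _ (R.center_mem n)).1.hasDerivAt)).congr_of_eventuallyEq h1).deriv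
  have h3 := h1.self_of_nhds
  have h4 := hc.self_of_nhds
  have h6 : preSchwarzian (V n) (u n) * deriv (V n) (u n) = deriv (deriv (V n)) (u n) :=
    div_mul_cancel₀ _ a2
  filter_upwards [hV.ratio_mul_deriv_eq R hC hh n] with t h5
  refine mul_right_cancel₀ (mul_ne_zero two_ne_zero a2) ?_
  rw [h5, h2, h3, ← h6]
  linear_combination 2 * deriv (V n) (u n) * h4

/-- In a system of charts, the coefficient `γ` of the chain is the standard one, with the same
constants at all sites. -/
theorem exists_γ_eq : ∃ k₁ k₂ k₃ : ℂ, ∀ n, ∀ᶠ q in 𝓝 (u (n + 1 + 1), u (n + 1), u n), C.γ q =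
    gammaStd k₁ k₂ k₃ (V (n + 1 + 1) q.1, V (n + 1) q.2.1, V n q.2.2) := by
  choose c hc using hV.exists_quadratic R hC hh
  -- V_{n+1} is a local coordinate, so the quadratic polynomial at a site is unique and the
  -- coefficients of neighbouring sites agree.
  have hper : Function.Periodic c 1 := by
    intro n
    obtain ⟨e0, e1, e2⟩ := quadratic_eq_zero_of_eventually (hV.analyticAt (n + 1))
      (hV.deriv_ne_zero (n + 1)) (c₀ := (c (n + 1)).1 - (c n).1)
      (c₁ := (c (n + 1)).2.1 - (c n).2.1) (c₂ := (c (n + 1)).2.2 - (c n).2.2) (by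
        filter_upwards [hV.eventually_succ R hC hh (hc n), hc (n + 1)] with t h1 h2
        linear_combination h1 - h2)
    exact Prod.ext (sub_eq_zero.1 e0) (Prod.ext (sub_eq_zero.1 e1) (sub_eq_zero.1 e2))
  have hconst : ∀ n, c n = c 0 := fun n => by simpa using hper.int_mul_eq n
  simp only [hconst] at hc
  -- In γ = αh - h' the `preSchwarzian` terms cancel, leaving r' - r α with r(V) = -(c₀ + c₁V +
  -- c₂V²).
  refine ⟨-2 * (c 0).2.2, -(c 0).2.1, -(c 0).1, fun n => ?_⟩
  have hy : Tendsto (fun q : ℂ × ℂ × ℂ => q.2.1) (𝓝 (u (n + 1 + 1), u (n + 1), u n))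
      (𝓝 (u (n + 1))) := by
    refine Continuous.tendsto' ?_ _ _ rfl; fun_prop
  filter_upwards [hV.eventually_α_eq R hC n, hy.eventually (hc (n + 1)),
    hy.eventually (hV.eventually_ratio_eq R hh (hc (n + 1))),
    prod_mem_nhds (R.mem_nhds (R.center_mem (n + 1 + 1))) (prod_mem_nhds
      (R.mem_nhds (R.center_mem (n + 1))) (R.mem_nhds (R.center_mem n)))] with q h1 h2 h3 h4
  have h5 := R.γ_eq_of_ratio hh hC h4.1 h4.2.1 h4.2.2
  rw [h3] at h5
  refine h5.trans ?_
  rw [h1, gammaStd, QLChain.deriv_rPoly, rPoly]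
  linear_combination
    alphaStd (V (n + 1 + 1) q.1, V (n + 1) q.2.1, V n q.2.2) * h2

end IsChartSystem
end

/-! ### Construction of adapted coordinates -/

noncomputable section

/-- The recursion is the orbit of (0, 1) under a permutation of ℤ × G, whose integer powers treat
both directions at once. -/
lemma exists_int_products {G : Type*} [Group G] (K : ℤ → G) :
    ∃ N : ℤ → G, ∀ n, N (n + 1) = N n * K n := by
  let σ : Equiv.Perm (ℤ × G) :=
    { toFun := fun p => (p.1 + 1, p.2 * K p.1)
      invFun := fun p => (p.1 - 1, p.2 * (K (p.1 - 1))⁻¹)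
      left_inv := fun p => by simp
      right_inv := fun p => by simp }
  have hs : ∀ n : ℤ, (σ ^ (n + 1)) (0, 1) = σ ((σ ^ n) (0, 1)) := fun n => by
    rw [add_comm, zpow_add, zpow_one, Equiv.Perm.mul_apply]
  have h1 : ∀ n : ℤ, ((σ ^ n) (0, 1)).1 = n := by
    intro n
    induction n using Int.induction_on with
    | zero => simp
    | succ n ih =>
      rw [hs]
      exact congrArg (· + 1) ih
    | pred n ih =>
      have h2 := hs (-n - 1)
      rw [sub_add_cancel] at h2
      rw [h2] at ih
      simp only [σ, Equiv.coe_fn_mk] at ih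
      linear_combination ih
  refine ⟨fun n => ((σ ^ n) (0, 1)).2, fun n => ?_⟩
  beta_reduce
  rw [hs]
  simp only [σ, Equiv.coe_fn_mk]
  exact congrArg (fun m => _ * K m) (h1 n)

/-- Products of invertible matrices, normalised so that the denominators of the associated
fractional linear maps do not vanish at given points. -/
lemma exists_matrix_products {K : ℤ → Matrix (Fin 2) (Fin 2) ℂ} (hK : ∀ n, (K n).det ≠ 0)
    (x : ℤ → ℂ) : ∃ M : ℤ → Matrix (Fin 2) (Fin 2) ℂ, (∀ n, (M n).det ≠ 0) ∧
      (∀ n, M (n + 1) = M n * K n) ∧ ∀ n, M n 1 0 * x n + M n 1 1 ≠ 0 := by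
  obtain ⟨N, hN⟩ := exists_int_products fun n => Matrix.GeneralLinearGroup.mkOfDetNeZero (K n) (hK n)
  have hdet : ∀ n, (N n).1.det ≠ 0 := fun n => (Matrix.GeneralLinearGroup.det (N n)).ne_zero
  -- For each n at most one c is bad, because N n is invertible; hence countably many are bad in all
  -- and a good c exists.
  have hsub : ∀ n, {c : ℂ | ((N n).1 0 0 * x n + (N n).1 0 1) +
      c * ((N n).1 1 0 * x n + (N n).1 1 1) = 0}.Subsingleton := by
    intro n c hc c' hc'
    by_contra hne
    rw [Set.mem_ofPred_eq] at hc hc'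
    have h1 : (N n).1 1 0 * x n + (N n).1 1 1 = 0 := by
      refine (mul_eq_zero.1 ?_).resolve_left (sub_ne_zero.2 hne)
      linear_combination hc - hc'
    have h2 : (N n).1 0 0 * x n + (N n).1 0 1 = 0 := by
      linear_combination hc - c * h1
    refine hdet n ?_
    rw [Matrix.det_fin_two]
    linear_combination (N n).1 0 0 * h1 - (N n).1 1 0 * h2
  obtain ⟨c, hc⟩ : ∃ c : ℂ, ∀ n, ((N n).1 0 0 * x n + (N n).1 0 1) +
      c * ((N n).1 1 0 * x n + (N n).1 1 1) ≠ 0 := by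
    by_contra! hcon
    refine not_countable_complex ((Set.countable_iUnion fun n =>
      (hsub n).countable).mono fun c _ => ?_)
    exact Set.mem_iUnion.2 (hcon c)
  -- A common left factor respects the recursion, which multiplies on the right. This one turns the
  -- lower row into the upper one plus c times the lower one.
  refine ⟨fun n => !![0, 1; 1, c] * (N n).1, fun n => ?_, fun n => ?_, fun n => ?_⟩
  · rw [Matrix.det_mul]
    refine mul_ne_zero ?_ (hdet n)
    simp [Matrix.det_fin_two]
  · beta_reduce
    rw [hN n, mul_assoc]
    rfl
  · simp only [Matrix.mul_apply, Fin.sum_univ_two]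
    simp only [Matrix.of_apply, Matrix.cons_val', Matrix.cons_val_zero, Matrix.cons_val_one,
      Matrix.cons_val_fin_one]
    intro h
    exact hc n (by linear_combination h)

section Moebius

variable {τ V : ℂ → ℂ} {t a b c d : ℂ} (hτ : AnalyticAt ℂ τ t) (hQ : c * τ t + d ≠ 0)
  (hV : ∀ s, V s = (a * τ s + b) / (c * τ s + d))
include hτ hQ hV

lemma analyticAt_moebius : AnalyticAt ℂ V t := by
  rw [funext hV]
  exact ((analyticAt_const.mul hτ).add analyticAt_const).div
    ((analyticAt_const.mul hτ).add analyticAt_const) hQ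

lemma deriv_moebius : deriv V t = (a * d - b * c) * deriv τ t / (c * τ t + d) ^ 2 := by
  rw [funext hV]
  refine ((((hτ.hasDerivAt.const_mul a).add_const b).div
    ((hτ.hasDerivAt.const_mul c).add_const d) hQ).deriv).trans ?_
  field_simp
  ring

omit hV in
lemma eventually_moebius : ∀ᶠ s in 𝓝 t, AnalyticAt ℂ τ s ∧ c * τ s + d ≠ 0 :=
  hτ.eventually_analyticAt.and
    (((hτ.continuousAt.const_mul c).add_const d).eventually_ne hQ)

lemma preSchwarzian_moebius (hdet : a * d - b * c ≠ 0) (hτ' : deriv τ t ≠ 0) :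
    preSchwarzian V t = preSchwarzian τ t - 2 * c * deriv τ t / (c * τ t + d) := by
  have h1 : deriv V =ᶠ[𝓝 t] fun s => (a * d - b * c) * deriv τ s / (c * τ s + d) ^ 2 :=
    (eventually_moebius hτ hQ).mono fun s hs => deriv_moebius hs.1 hs.2 hV
  have h2 := ((hτ.deriv.hasDerivAt.const_mul (a * d - b * c)).div
    (((hτ.hasDerivAt.const_mul c).add_const d).pow 2) (pow_ne_zero 2 hQ)).congr_of_eventuallyEq h1
  rw [preSchwarzian, preSchwarzian, h2.deriv, deriv_moebius hτ hQ hV]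
  simp only [Pi.pow_apply]
  field_simp
  ring

/-- Invariance of the Schwarzian derivative under fractional linear maps. -/
lemma schwarzian_moebius (hdet : a * d - b * c ≠ 0) (hτ' : deriv τ t ≠ 0) :
    deriv (preSchwarzian V) t - preSchwarzian V t ^ 2 / 2 =
      deriv (preSchwarzian τ) t - preSchwarzian τ t ^ 2 / 2 := by
  have h1 : preSchwarzian V =ᶠ[𝓝 t]
      fun s => preSchwarzian τ s - 2 * c * deriv τ s / (c * τ s + d) := by
    filter_upwards [eventually_moebius hτ hQ, hτ.eventually_regular hτ'] with s h h'
    exact preSchwarzian_moebius h.1 h.2 hV hdet h'.2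
  have h2 := ((hτ.preSchwarzian hτ').hasDerivAt.sub ((hτ.deriv.hasDerivAt.const_mul (2 * c)).div
    ((hτ.hasDerivAt.const_mul c).add_const d) hQ)).congr_of_eventuallyEq h1
  have h3 : deriv (deriv τ) t = preSchwarzian τ t * deriv τ t :=
    (div_mul_cancel₀ _ hτ').symm
  rw [h2.deriv, preSchwarzian_moebius hτ hQ hV hdet hτ', h3]
  field_simp
  ring

end Moebius

lemma eventually_eq_of_hasDerivAt_zero {F : ℂ × ℂ → ℂ} {a b : ℂ}
    (h : ∀ᶠ q in 𝓝 (a, b), HasDerivAt (fun s => F (s, q.2)) 0 q.1) :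
    ∀ᶠ q in 𝓝 (a, b), F q = F (a, q.2) := by
  obtain ⟨ε, hε, hF⟩ := Metric.eventually_nhds_iff_ball.1 h
  rw [← ball_prod_same] at hF
  filter_upwards [prod_mem_nhds (Metric.ball_mem_nhds a hε) (Metric.ball_mem_nhds b hε)] with q hq
  exact eq_of_hasDerivAt_zero (f := fun s => F (s, q.2)) (fun s hs => hF (s, q.2) ⟨hs, hq.2⟩)
    hq.1 (Metric.mem_ball_self hε)

/-- A solution `l` of a Riccati equation with parameter, expressed by a chart `V`. -/
lemma riccati_eq {V X : ℂ → ℂ} {l : ℂ × ℂ → ℂ} {a b : ℂ} (hV : AnalyticAt ℂ V a)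
    (hV' : deriv V a ≠ 0) (hl : AnalyticAt ℂ l (a, b)) (hne : preSchwarzian V a - l (a, b) ≠ 0)
    (hS : ∀ᶠ q in 𝓝 (a, b), d₁ l q - l q ^ 2 / 2 =
      deriv (preSchwarzian V) q.1 - preSchwarzian V q.1 ^ 2 / 2)
    (hX : ∀ᶠ t in 𝓝 b, X t = V a - 2 * deriv V a / (preSchwarzian V a - l (a, t))) :
    V a ≠ X b ∧ ∀ᶠ q in 𝓝 (a, b),
      l q = preSchwarzian V q.1 - 2 * deriv V q.1 / (V q.1 - X q.2) := by
  have hG : ∀ᶠ q in 𝓝 (a, b), preSchwarzian V q.1 - l q ≠ 0 := by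
    have h1 : ContinuousAt (fun q : ℂ × ℂ => preSchwarzian V q.1) (a, b) :=
      ContinuousAt.comp' (g := preSchwarzian V) (hV.preSchwarzian hV').continuousAt continuousAt_fst
    exact (h1.sub hl.continuousAt).eventually_ne hne
  have hreg : ∀ᶠ q : ℂ × ℂ in 𝓝 (a, b), AnalyticAt ℂ V q.1 ∧ deriv V q.1 ≠ 0 :=
    (continuous_fst.tendsto (a, b)).eventually (hV.eventually_regular hV')
  -- Solving l = V''/V' - 2V'/(V - X) for X gives this expression, which is a first integral of the
  -- Riccati equation.
  let F : ℂ × ℂ → ℂ := fun q => V q.1 - 2 * deriv V q.1 / (preSchwarzian V q.1 - l q)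
  have hF : ∀ᶠ q in 𝓝 (a, b), HasDerivAt (fun s => F (s, q.2)) 0 q.1 := by
    filter_upwards [hG, hreg, hS, hl.eventually_analyticAt] with q h1 h2 h3 h4
    refine (h2.1.hasDerivAt.sub ((h2.1.deriv.hasDerivAt.const_mul 2).div
      ((h2.1.preSchwarzian h2.2).hasDerivAt.sub h4.hasDerivAt_d₁) h1)).congr_deriv ?_
    have h5 : deriv (deriv V) q.1 = preSchwarzian V q.1 * deriv V q.1 :=
      (div_mul_cancel₀ _ h2.2).symm
    have h6 : deriv (preSchwarzian V) q.1 - d₁ l q =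
        (preSchwarzian V q.1 - l q) * (preSchwarzian V q.1 + l q) / 2 := by
      linear_combination -h3
    simp only [Pi.sub_apply, Prod.mk.eta]
    rw [h5, h6]
    field_simp
    ring
  have hX' : ∀ᶠ q : ℂ × ℂ in 𝓝 (a, b),
      X q.2 = V a - 2 * deriv V a / (preSchwarzian V a - l (a, q.2)) :=
    (continuous_snd.tendsto (a, b)).eventually hX
  have key : ∀ᶠ q in 𝓝 (a, b),
      V q.1 - X q.2 = 2 * deriv V q.1 / (preSchwarzian V q.1 - l q) := by
    filter_upwards [eventually_eq_of_hasDerivAt_zero hF, hX'] with q h1 h2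
    simp only [F] at h1
    rw [h2, ← h1]
    ring
  constructor
  · rw [← sub_ne_zero, key.self_of_nhds]
    exact div_ne_zero (mul_ne_zero two_ne_zero hV') hne
  · filter_upwards [key, hG, hreg] with q h1 h2 h3
    rw [h1]
    have := h3.2
    field_simp
    ring

/-- The left-hand side is the fractional linear map of the next matrix product applied to l; the
right-hand side is the value of X prescribed by `riccati_eq`. Here w stands for τ' and k for the
`preSchwarzian` of the transformed chart. -/
lemma moebius_comp_identity {A B C D Q τ w k l : ℂ} (hQ : C * τ + D = Q) (hQ0 : Q ≠ 0)
    (hG : k - l ≠ 0) :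
    ((A * τ + B) * l + (A * (2 * w - (k + 2 * C * w / Q) * τ) - B * (k + 2 * C * w / Q))) /
      (-Q * (k - l)) = (A * τ + B) / Q - 2 * ((A * D - B * C) * w / Q ^ 2) / (k - l) := by
  obtain rfl : D = Q - C * τ := by rw [← hQ]; ring
  field_simp
  ring

namespace LocalRelations

variable {C : QLChain} {u : ℤ → ℂ} {L : ℤ → ℂ × ℂ → ℂ} {B : ℤ → Set ℂ}
  (R : LocalRelations C u L B) (hC : C.Nondegenerate)
include R hC

/-- Start from the candidates τ_n(t) = L_n(u_n, t) for a coordinate at site n + 1. Solving the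
Riccati equation at the next site in the chart W_n forces W_{n+1} to be a fractional linear function
of τ_{n+1}, so compatible charts are W_n = M_n · τ_n with M_{n+1} = M_n K_n. The remaining freedom,
a common fractional linear map, keeps all denominators nonzero at the given points. -/
theorem exists_isChartSystem : ∃ V, IsChartSystem L u V := by
  let τ : ℤ → ℂ → ℂ := fun n t => L n (u n, t)
  have hτ : ∀ n, ∀ t ∈ B (n + 1), AnalyticAt ℂ (τ n) t := fun n t ht =>
    (R.analyticAt (R.center_mem n) ht).comp_of_eq (analyticAt_const.prod analyticAt_id) rfl
  have hτ' : ∀ n, ∀ t ∈ B (n + 1), deriv (τ n) t ≠ 0 := fun n t ht =>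
    R.d₂_ne_zero hC (R.center_mem n) ht
  -- With τ and κ = τ''/τ' evaluated at u_{n+1}, K_n represents l ↦ τ - 2τ'/(κ - l), the value of X
  -- in the chart τ_n; its determinant is -2τ'.
  obtain ⟨M, hdet, hM, hQ⟩ := exists_matrix_products (K := fun n =>
    !![τ n (u (n + 1)), 2 * deriv (τ n) (u (n + 1)) -
      preSchwarzian (τ n) (u (n + 1)) * τ n (u (n + 1)); 1, -preSchwarzian (τ n) (u (n + 1))])
    (fun n => by
      rw [Matrix.det_fin_two_of]
      have := hτ' n _ (R.center_mem _)
      contrapose! this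
      linear_combination -this / 2) fun n => τ n (u (n + 1))
  simp only [Matrix.det_fin_two] at hdet
  let W : ℤ → ℂ → ℂ := fun n t => (M n 0 0 * τ n t + M n 0 1) / (M n 1 0 * τ n t + M n 1 1)
  have hWa : ∀ n, AnalyticAt ℂ (W n) (u (n + 1)) := fun n =>
    analyticAt_moebius (hτ n _ (R.center_mem _)) (hQ n) fun _ => rfl
  have hW' : ∀ n, deriv (W n) (u (n + 1)) ≠ 0 := fun n => by
    rw [deriv_moebius (hτ n _ (R.center_mem _)) (hQ n) fun _ => rfl]
    exact div_ne_zero (mul_ne_zero (hdet n) (hτ' n _ (R.center_mem _))) (pow_ne_zero 2 (hQ n))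
  have key : ∀ n, W n (u (n + 1)) ≠ W (n + 1) (u (n + 1 + 1)) ∧
      ∀ᶠ q in 𝓝 (u (n + 1), u (n + 1 + 1)), L (n + 1) q =
        preSchwarzian (W n) q.1 - 2 * deriv (W n) q.1 / (W n q.1 - W (n + 1) q.2) := by
    intro n
    have a1 := hτ n _ (R.center_mem _)
    have a2 := hτ' n _ (R.center_mem _)
    have b1 : preSchwarzian (W n) (u (n + 1)) = preSchwarzian (τ n) (u (n + 1)) -
        2 * M n 1 0 * deriv (τ n) (u (n + 1)) / (M n 1 0 * τ n (u (n + 1)) + M n 1 1) :=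
      preSchwarzian_moebius a1 (hQ n) (fun _ => rfl) (hdet n) a2
    have b2 : deriv (W n) (u (n + 1)) = (M n 0 0 * M n 1 1 - M n 0 1 * M n 1 0) *
        deriv (τ n) (u (n + 1)) / (M n 1 0 * τ n (u (n + 1)) + M n 1 1) ^ 2 :=
      deriv_moebius a1 (hQ n) fun _ => rfl
    have q0 := hQ n
    have m00 : M (n + 1) 0 0 = M n 0 0 * τ n (u (n + 1)) + M n 0 1 := by
      rw [hM n, Matrix.mul_apply, Fin.sum_univ_two]; simp
    have m10 : M (n + 1) 1 0 = M n 1 0 * τ n (u (n + 1)) + M n 1 1 := by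
      rw [hM n, Matrix.mul_apply, Fin.sum_univ_two]; simp
    have m01 : M (n + 1) 0 1 = M n 0 0 * (2 * deriv (τ n) (u (n + 1)) -
        preSchwarzian (τ n) (u (n + 1)) * τ n (u (n + 1))) -
        M n 0 1 * preSchwarzian (τ n) (u (n + 1)) := by
      rw [hM n, Matrix.mul_apply, Fin.sum_univ_two]; simp [sub_eq_add_neg]
    have m11 : M (n + 1) 1 1 = M n 1 0 * (2 * deriv (τ n) (u (n + 1)) -
        preSchwarzian (τ n) (u (n + 1)) * τ n (u (n + 1))) -
        M n 1 1 * preSchwarzian (τ n) (u (n + 1)) := by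
      rw [hM n, Matrix.mul_apply, Fin.sum_univ_two]; simp [sub_eq_add_neg]
    -- The normalisation of M (n + 1) is thus precisely what keeps the denominator in `riccati_eq`
    -- away from zero.
    have hG : ∀ t, M (n + 1) 1 0 * τ (n + 1) t + M (n + 1) 1 1 =
        -(M n 1 0 * τ n (u (n + 1)) + M n 1 1) *
          (preSchwarzian (W n) (u (n + 1)) - L (n + 1) (u (n + 1), t)) := by
      intro t
      rw [b1, m10, m11]
      simp only [τ] at q0 ⊢
      field_simp
      ring
    refine riccati_eq (hWa n) (hW' n) (R.analyticAt (R.center_mem _) (R.center_mem _))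
      (fun h0 => hQ (n + 1) (by rw [hG, h0, mul_zero])) ?_ ?_
    · have h1 : ∀ᶠ q : ℂ × ℂ in 𝓝 (u (n + 1), u (n + 1 + 1)), AnalyticAt ℂ (τ n) q.1 ∧
          M n 1 0 * τ n q.1 + M n 1 1 ≠ 0 :=
        continuousAt_fst.eventually (eventually_moebius a1 (hQ n))
      filter_upwards [h1, prod_mem_nhds (R.mem_nhds (R.center_mem (n + 1)))
        (R.mem_nhds (R.center_mem (n + 1 + 1)))] with q h2 h3
      rw [schwarzian_moebius h2.1 h2.2 (V := W n) (fun _ => rfl) (hdet n) (hτ' n _ h3.1)]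
      exact R.schwarzian_eq hC h3.2 h3.1 (R.center_mem n)
    · filter_upwards [(eventually_moebius (hτ (n + 1) _ (R.center_mem _)) (hQ (n + 1)))] with t ht
      have h4 := ht.2
      rw [hG t] at h4
      have h5 := right_ne_zero_of_mul h4
      have h6 : W (n + 1) t = (M (n + 1) 0 0 * τ (n + 1) t + M (n + 1) 0 1) /
          (M (n + 1) 1 0 * τ (n + 1) t + M (n + 1) 1 1) := rfl
      have h7 : preSchwarzian (τ n) (u (n + 1)) = preSchwarzian (W n) (u (n + 1)) +
        2 * M n 1 0 * deriv (τ n) (u (n + 1)) / (M n 1 0 * τ n (u (n + 1)) + M n 1 1) := by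
        rw [b1]; ring
      have h8 : W n (u (n + 1)) = (M n 0 0 * τ n (u (n + 1)) + M n 0 1) /
        (M n 1 0 * τ n (u (n + 1)) + M n 1 1) := rfl
      have h9 : L (n + 1) (u (n + 1), t) = τ (n + 1) t := rfl
      rw [h6, hG t, m00, m01, h7, b2, h8]
      rw [h9] at h5 ⊢
      exact moebius_comp_identity rfl q0 h5
  -- W_n is a function of u_{n+1}, hence the shift.
  refine ⟨fun n => W (n - 1), fun n => ?_, fun n => ?_, fun n => ?_, fun n => ?_⟩
  all_goals
    obtain ⟨m, rfl⟩ : ∃ m, n = m + 1 := ⟨n - 1, by ring⟩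
    simp only [add_sub_cancel_right]
  · exact hWa m
  · exact hW' m
  · exact (key m).1
  · exact (key m).2

end LocalRelations
end

/-! ### The point transformation, and chains with standard α -/

noncomputable section

/-- Second order differentiation of the identity `V (G x) = x`. -/
lemma deriv_deriv_local_inverse {V G : ℂ → ℂ} {v : ℂ} (hG : AnalyticAt ℂ G v)
    (hV : AnalyticAt ℂ V (G v)) (h : ∀ᶠ x in 𝓝 v, V (G x) = x) : ∀ᶠ x in 𝓝 v,
      deriv G x * deriv V (G x) = 1 ∧
      deriv (deriv G) x = -preSchwarzian V (G x) * deriv G x ^ 2 := by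
  have h1 := hG.eventually_deriv_mul_deriv hV h
  filter_upwards [h1.eventually_nhds, hG.eventually_analyticAt,
    hG.continuousAt.eventually hV.eventually_analyticAt] with x hx hGx hVx
  have hx0 := hx.self_of_nhds
  refine ⟨hx0, ?_⟩
  have h2 := (hGx.deriv.hasDerivAt.mul (hVx.deriv.hasDerivAt.comp x hGx.hasDerivAt)).unique
    ((hasDerivAt_const x (1 : ℂ)).congr_of_eventuallyEq hx)
  have h3 := right_ne_zero_of_mul (hx0.trans_ne one_ne_zero)
  simp only [Function.comp_apply] at h2
  rw [preSchwarzian]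
  field_simp
  linear_combination h2

/-- A function with a simple pole is not continuous. -/
lemma not_continuousAt_of_simple_pole {f : ℂ → ℂ} {a c : ℂ} (hf : ContinuousAt f a)
    (h : ∀ᶠ t in 𝓝 a, f t = c - 1 / (t - a)) : False := by
  have h1 : Tendsto (fun t => (t - a) * (f t - c)) (𝓝[≠] a) (𝓝 ((a - a) * (f a - c))) :=
    ((continuousAt_id.sub continuousAt_const).mul (hf.sub continuousAt_const)).mono_left
      nhdsWithin_le_nhds
  have h2 : (fun t => (t - a) * (f t - c)) =ᶠ[𝓝[≠] a] fun _ => -1 := by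
    filter_upwards [nhdsWithin_le_nhds h, self_mem_nhdsWithin] with t ht ht'
    have : t - a ≠ 0 := sub_ne_zero.2 ht'
    rw [ht]
    field_simp
    ring
  have h3 := tendsto_nhds_unique (h1.congr' h2) tendsto_const_nhds
  simp at h3

lemma analyticAt_alphaStd {z : ℂ × ℂ × ℂ} (h1 : z.1 ≠ z.2.1) (h2 : z.2.1 ≠ z.2.2) :
    AnalyticAt ℂ alphaStd z := by
  have a2 : AnalyticAt ℂ (fun z : ℂ × ℂ × ℂ => z.2.1) z := analyticAt_fst.comp analyticAt_snd
  have a3 : AnalyticAt ℂ (fun z : ℂ × ℂ × ℂ => z.2.2) z := analyticAt_snd.comp analyticAt_snd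
  exact (analyticAt_const.div (a2.sub a3) (sub_ne_zero.2 h2)).sub
    (analyticAt_const.div (analyticAt_fst.sub a2) (sub_ne_zero.2 h1))

lemma analyticAt_gammaStd (k₁ k₂ k₃ : ℂ) {z : ℂ × ℂ × ℂ} (h1 : z.1 ≠ z.2.1) (h2 : z.2.1 ≠ z.2.2) :
    AnalyticAt ℂ (gammaStd k₁ k₂ k₃) z := by
  have a2 : AnalyticAt ℂ (fun z : ℂ × ℂ × ℂ => z.2.1) z := analyticAt_fst.comp analyticAt_snd
  have e : gammaStd k₁ k₂ k₃ = fun z => (k₁ * z.2.1 + k₂) -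
      (k₁ / 2 * z.2.1 ^ 2 + k₂ * z.2.1 + k₃) * alphaStd z := by
    funext z
    rw [gammaStd, QLChain.deriv_rPoly, rPoly]
  rw [e]
  exact ((analyticAt_const.mul a2).add analyticAt_const).sub
    ((((analyticAt_const.mul (a2.pow 2)).add (analyticAt_const.mul a2)).add analyticAt_const).mul
      (analyticAt_alphaStd h1 h2))

namespace QLChain

variable {C : QLChain}

/-- A chain that admits the first expansion is related to a standard one by a point
transformation. -/
theorem exists_transformsTo (hC : C.Nondegenerate) (hF : C.FirstExpansion) {u : ℤ → ℂ}
    (hu : C.InDomain u) :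
    ∃ (g : ℤ → ℂ → ℂ) (v : ℤ → ℂ) (b d : ℤ → ℂ × ℂ × ℂ → ℂ) (k₁ k₂ k₃ : ℂ),
      IsPointTransformation g v u ∧ (∀ n : ℤ, v (n + 1) ≠ v n) ∧
      C.TransformsTo g v (fun _ => alphaStd) b (fun _ => gammaStd k₁ k₂ k₃) d := by
  obtain ⟨L, B, R⟩ := exists_localRelations hC hF hu
  obtain ⟨V, hV⟩ := R.exists_isChartSystem hC
  choose h hh using R.exists_ratio hC
  obtain ⟨k₁, k₂, k₃, hγ⟩ := hV.exists_γ_eq R hC hh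
  have hα := hV.eventually_α_eq R hC
  choose G hGa hGv hVG hG' using fun n => (hV.analyticAt n).exists_local_inverse (hV.deriv_ne_zero n)
  refine ⟨G, fun n => V n (u n),
    -- The coefficients b and d are unrestricted; these are the ones the substitution produces.
    fun n z => C.β (G (n + 1) z.1, G n z.2.1, G (n - 1) z.2.2),
    fun n z => C.δ (G (n + 1) z.1, G n z.2.1, G (n - 1) z.2.2) / deriv (G n) z.2.1,
    k₁, k₂, k₃, fun n => ⟨hGa n, hG' n, hGv n⟩, fun n => (hV.ne n).symm, fun n => ?_⟩
  obtain ⟨m, rfl⟩ : ∃ m, n = m + 1 := ⟨n - 1, by ring⟩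
  simp only [triple, add_sub_cancel_right]
  set z₀ : ℂ × ℂ × ℂ :=
    (V (m + 1 + 1) (u (m + 1 + 1)), V (m + 1) (u (m + 1)), V m (u m)) with hz₀
  have c1 : Tendsto (fun z : ℂ × ℂ × ℂ => z.1) (𝓝 z₀) (𝓝 (V (m + 1 + 1) (u (m + 1 + 1)))) :=
    continuous_fst.tendsto z₀
  have c2 : Tendsto (fun z : ℂ × ℂ × ℂ => z.2.1) (𝓝 z₀) (𝓝 (V (m + 1) (u (m + 1)))) :=
    (continuous_fst.comp continuous_snd).tendsto z₀
  have c3 : Tendsto (fun z : ℂ × ℂ × ℂ => z.2.2) (𝓝 z₀) (𝓝 (V m (u m))) :=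
    (continuous_snd.comp continuous_snd).tendsto z₀
  have t : ∀ n, Tendsto (G n) (𝓝 (V n (u n))) (𝓝 (u n)) := fun n => by
    have := (hGa n).continuousAt.tendsto
    rwa [hGv n] at this
  have c : Tendsto (fun z : ℂ × ℂ × ℂ => (G (m + 1 + 1) z.1, G (m + 1) z.2.1, G m z.2.2)) (𝓝 z₀)
      (𝓝 (u (m + 1 + 1), u (m + 1), u m)) :=
    ((t _).comp c1).prodMk_nhds (((t _).comp c2).prodMk_nhds ((t _).comp c3))
  filter_upwards [c.eventually (hα m), c.eventually (hγ m), c1.eventually (hVG (m + 1 + 1)),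
    c2.eventually (hVG (m + 1)), c3.eventually (hVG m), c2.eventually
    (deriv_deriv_local_inverse (hGa (m + 1)) (by rw [hGv]; exact hV.analyticAt _) (hVG (m + 1)))]
    with z e1 e2 e3 e4 e5 e6 ξ η
  obtain ⟨e6, e7⟩ := e6
  simp only [e3, e4, e5] at e1 e2
  have h0 := left_ne_zero_of_mul (e6.trans_ne one_ne_zero)
  simp only [rhs]
  rw [e1, e2, e7]
  field_simp
  linear_combination deriv (G (m + 1)) z.2.1 * ξ * η * alphaStd z * e6

section Standard

variable (hα : ∀ z ∈ C.D, C.α z = alphaStd z)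
include hα

/-- On either diagonal the formula would have a simple pole, whereas α is continuous on D. -/
lemma ne_of_α_eq {z : ℂ × ℂ × ℂ} (hz : z ∈ C.D) : z.1 ≠ z.2.1 ∧ z.2.1 ≠ z.2.2 := by
  obtain ⟨x, y, z⟩ := z
  constructor
  · rintro (rfl : x = y)
    have hc : ContinuousAt (fun t => (t, x, z)) x := by fun_prop
    refine not_continuousAt_of_simple_pole (c := 1 / (x - z))
      ((C.analytic_α _ hz).continuousAt.comp_of_eq hc rfl) ?_
    exact hc.eventually ((C.isOpen_D.mem_nhds hz)) |>.mono fun t ht => hα _ ht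
  · rintro (rfl : y = z)
    have hc : ContinuousAt (fun t => (x, y, t)) y := by fun_prop
    refine not_continuousAt_of_simple_pole (c := -(1 / (x - y)))
      ((C.analytic_α _ hz).continuousAt.comp_of_eq hc rfl) ?_
    refine hc.eventually ((C.isOpen_D.mem_nhds hz)) |>.mono fun t ht => (hα _ ht).trans ?_
    rw [alphaStd, ← neg_sub t y, div_neg]
    ring

/-- For the standard α, ∂α/∂z = 1/(y - z)², so `dZ_dZ_α` gives L_n(z, y) = 2/(y - z), which is the
chart formula for the identity. -/
lemma isChartSystem_id {u : ℤ → ℂ} {L : ℤ → ℂ × ℂ → ℂ} {B : ℤ → Set ℂ}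
    (R : LocalRelations C u L B) : IsChartSystem L u fun _ t => t := by
  have hne : ∀ {n s t}, s ∈ B n → t ∈ B (n + 1) → t - s ≠ 0 := fun hs ht =>
    sub_ne_zero.2 (ne_of_α_eq hα (R.mem_D (R.center_mem _) ht hs)).2
  refine ⟨fun n => analyticAt_id, fun n => by simp, fun n => ?_, fun n => ?_⟩
  · exact (sub_ne_zero.1 (hne (R.center_mem n) (R.center_mem (n + 1)))).symm
  · filter_upwards [prod_mem_nhds (R.mem_nhds (R.center_mem n))
      (R.mem_nhds (R.center_mem (n + 1)))] with q hq
    obtain ⟨s, t⟩ := q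
    obtain ⟨hs, ht⟩ := hq
    dsimp only at hs ht
    have cx := R.center_mem (n + 1 + 1)
    have d1 : ∀ z ∈ B n, dZ C.α (u (n + 1 + 1), t, z) = 1 / (t - z) ^ 2 := by
      intro z hz
      have h1 : ∀ z ∈ B n, C.α (u (n + 1 + 1), t, z) = 1 / (t - z) - 1 / (u (n + 1 + 1) - t) :=
        fun z hz => hα _ (R.mem_D cx ht hz)
      have h2 : HasDerivAt (fun z => 1 / (t - z) - 1 / (u (n + 1 + 1) - t)) (1 / (t - z) ^ 2) z := by
        refine (((hasDerivAt_const z (1 : ℂ)).div ((hasDerivAt_id' z).const_sub t)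
          (hne hz ht)).sub_const (1 / (u (n + 1 + 1) - t))).congr_deriv ?_
        simp
      exact R.unique_deriv h1 hz (R.analyticAt_α cx ht hz).hasDerivAt_dZ h2
    have d2 : HasDerivAt (fun z => 1 / (t - z) ^ 2) (2 * (t - s) / ((t - s) ^ 2) ^ 2) s := by
      refine ((hasDerivAt_const s (1 : ℂ)).div (((hasDerivAt_id' s).const_sub t).pow 2)
        (pow_ne_zero 2 (hne hs ht))).congr_deriv ?_
      simp
    have d3 := R.dZ_dZ_α cx ht hs
    rw [R.unique_deriv d1 hs (R.analyticAt_α cx ht hs).dZ.hasDerivAt_dZ d2, d1 s hs] at d3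
    have h0 := hne hs ht
    simp only [preSchwarzian, deriv_id'', deriv_const'] at d3 ⊢
    rw [← neg_sub t s, div_neg]
    refine mul_left_cancel₀ (pow_ne_zero 2 h0) ?_
    field_simp at d3 ⊢
    linear_combination -d3

/-- The formula holds near one triple of the sequence and spreads over the connected set D. Without
a sequence in the domain the expansions would be vacuous and say nothing about γ. -/
lemma exists_γ_eq_of_expansion (hC : C.Nondegenerate) (hF : C.FirstExpansion) {u : ℤ → ℂ}
    (hu : C.InDomain u) : ∃ k₁ k₂ k₃ : ℂ, ∀ z ∈ C.D, C.γ z = gammaStd k₁ k₂ k₃ z := by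
  obtain ⟨L, B, R⟩ := exists_localRelations hC hF hu
  choose h hh using R.exists_ratio hC
  obtain ⟨k₁, k₂, k₃, hγ⟩ := (isChartSystem_id hα R).exists_γ_eq R hC hh
  refine ⟨k₁, k₂, k₃, C.analytic_γ.eqOn_of_preconnected_of_eventuallyEq (fun z hz => ?_)
    C.isConnected_D.isPreconnected
    (R.mem_D (R.center_mem (0 + 1 + 1)) (R.center_mem (0 + 1)) (R.center_mem 0)) (hγ 0)⟩
  exact analyticAt_gammaStd k₁ k₂ k₃ (ne_of_α_eq hα hz).1 (ne_of_α_eq hα hz).2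

lemma transformsTo_id {k₁ k₂ k₃ : ℂ} (hγ : ∀ z ∈ C.D, C.γ z = gammaStd k₁ k₂ k₃ z) {u : ℤ → ℂ}
    (hu : C.InDomain u) : C.TransformsTo (fun _ t => t) u (fun _ => alphaStd) (fun _ => C.β)
      (fun _ => gammaStd k₁ k₂ k₃) (fun _ => C.δ) := by
  intro n
  filter_upwards [C.isOpen_D.mem_nhds (hu n)] with z hz ξ η
  simp only [rhs, deriv_id'', deriv_const', Prod.mk.eta, hα z hz, hγ z hz]
  ring

end Standard

end QLChain
end

theorem theorem3 (C : QLChain) (hC : C.Nondegenerate) :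
    ((C.FirstExpansion ∧ C.SecondExpansion) ↔
      ∀ u : ℤ → ℂ, C.InDomain u →
        ∃ (g : ℤ → ℂ → ℂ) (v : ℤ → ℂ) (b d : ℤ → ℂ × ℂ × ℂ → ℂ) (k₁ k₂ k₃ : ℂ),
          IsPointTransformation g v u ∧ (∀ n : ℤ, v (n + 1) ≠ v n) ∧
          C.TransformsTo g v (fun _ => alphaStd) b (fun _ => gammaStd k₁ k₂ k₃) d) ∧
    ((∃ u : ℤ → ℂ, C.InDomain u) → (∀ z ∈ C.D, C.α z = alphaStd z) →
      ((C.FirstExpansion ∧ C.SecondExpansion) ↔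
        ∃ k₁ k₂ k₃ : ℂ, ∀ z ∈ C.D, C.γ z = gammaStd k₁ k₂ k₃ z)) := by
  refine ⟨⟨fun h u hu => C.exists_transformsTo hC h.1 hu, fun h => ?_⟩, fun ⟨u, hu⟩ hα =>
    ⟨fun h => C.exists_γ_eq_of_expansion hα hC h.1 hu, fun ⟨k₁, k₂, k₃, hγ⟩ => ?_⟩⟩
  · have key := fun (p : DynPoint) (hp : C.InDomain p.base) =>
      let ⟨_, _, _, _, _, _, _, hg, hv, hT⟩ := h p.base hp
      QLChain.expandsAt_of_transformsTo hp hg hv hT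
    exact ⟨fun p hp => (key p hp).1, fun p hp => (key p hp).2⟩
  -- The identity serves as point transformation; neighbouring values differ because α has no pole
  -- in D.
  · have key := fun (p : DynPoint) (hp : C.InDomain p.base) =>
      QLChain.expandsAt_of_transformsTo hp (g := fun _ t => t)
        (fun n => ⟨analyticAt_id, by simp, rfl⟩)
        (fun n => (QLChain.ne_of_α_eq hα (hp n)).1) (QLChain.transformsTo_id hα hγ hp)
    exact ⟨fun p hp => (key p hp).1, fun p hp => (key p hp).2⟩
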